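/- Let $A=\{0,1\}$. A partial function $f:A^*\to A^*$ is polynomially balanced if there are polynomials $p,q$ such that $|f(x)|\le p(|x|)$ and $|x|\le q(|f(x)|)$ for all $x\in\mathrm{Dom}(f)$. A partial function $f'$ is an inverse of $f$ if $f\circ f'\circ f=f$; a monoid $S$ is regular if for every $x\in S$ there is $x'\in S$ with $x\,x'\,x=x$. Let $\Sigma_1^{\mathsf P}=\mathsf{NP}$, $\Sigma_{k+1}^{\mathsf P}=\mathsf{NP}^{\Sigma_k^{\mathsf P}}$ for $k\ge 1$, and $\mathsf{PH}=\bigcup_{k\ge1}\Sigma_k^{\mathsf P}$. Let $\mathsf{fP}$ (respectively $\mathsf{fP}^{\mathcal C}$, $\mathsf{fPSpace}$) be the set of polynomially balanced partial functions $A^*\to A^*$ that are computed by a deterministic polynomial-time Turing machine (respectively a deterministic polynomial-time Turing machine with an oracle in the class of languages $\mathcal C$, a deterministic polynomial-space Turing machine). For a polynomially balanced $f$ let $f'_{\min}$ be the partial function with domain $\mathrm{Im}(f)$ that sends $y$ to the minimum of $f^{-1}(y)$ in dictionary order. Then: 1. For every $f\in\mathsf{fP}$, the function $f'_{\min}$ is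 an inverse of $f$ and belongs to $\mathsf{fP}^{\Sigma_1^{\mathsf P}}$. In particular, every $f\in\mathsf{fP}$ has an inverse in $\mathsf{fP}^{\Sigma_1^{\mathsf P}}$. 2. For every $k\ge1$ and every $f\in\mathsf{fP}^{\Sigma_k^{\mathsf P}}$, the function $f'_{\min}$ is an inverse of $f$ and belongs to $\mathsf{fP}^{\Sigma_{k+1}^{\mathsf P}}$. In particular, every $f\in\mathsf{fP}^{\Sigma_k^{\mathsf P}}$ has an inverse in $\mathsf{fP}^{\Sigma_{k+1}^{\mathsf P}}$. 3. $\mathsf{fP}^{\mathsf{PH}}$ and $\mathsf{fPSpace}$ are monoids under composition of partial functions, and both are regular. -/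

import Mathlib

/-! ## Partial functions on binary words -/

/-- Words over the alphabet `{0,1}`. -/
abbrev Word : Type := List Bool

/-- The monoid of all partial functions on words, under composition: `f * g = f ∘ g`. -/
instance partialFunctionMonoid : Monoid (Word →. Word) where
  mul f g := f.comp g
  one := PFun.id Word
  mul_assoc f g h := PFun.comp_assoc f g h
  one_mul f := PFun.id_comp f
  mul_one f := PFun.comp_id f

/-- `f'` is an inverse of `f`: `f ∘ f' ∘ f = f`. -/
def IsInverse (f' f : Word →. Word) : Prop := f * f' * f = f

/-- `f'` sends each `y ∈ Im f` to the least preimage of `y` in dictionary order (a proper prefix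
precedes its extensions, and `0 < 1`), and is undefined outside `Im f`. -/
def IsMinPreimage (f' f : Word →. Word) : Prop :=
  ∀ y x : Word, x ∈ f' y ↔ IsLeast {z : Word | y ∈ f z} x

/-- A monoid is regular if every element `x` has some `x'` with `x x' x = x`. -/
def IsRegularMonoid (S : Type*) [Monoid S] : Prop := ∀ x : S, ∃ x' : S, x * x' * x = x

/-- Polynomially balanced partial functions. -/
def PolyBalanced (f : Word →. Word) : Prop :=
  ∃ p q : Polynomial ℕ, ∀ x y : Word, y ∈ f x →
    y.length ≤ p.eval x.length ∧ x.length ≤ q.eval y.length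

/-! ## Multi-tape oracle Turing machines -/

/-- Tape symbols: a bit, or the blank `none`. -/
abbrev TapeSym : Type := Option Bool

/-- A head movement. -/
inductive Dir where
  | left
  | stay
  | right

/-- A tape, infinite in both directions and blank except for finitely many cells: `head` is the
scanned cell, `left` lists the recorded cells to the left of the head (nearest first), `right` those
to the right of it (nearest first). All other cells are blank. -/
structure TMTape where
  left : List TapeSym
  head : TapeSym
  right : List TapeSym

namespace TMTape

/-- The tape that holds the word `w`, with the head on its first letter. -/
def ofWord (w : Word) : TMTape where
  left := []
  head := w.head?
  right := w.tail.map some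

/-- Move the head by at most one cell. -/
def move (t : TMTape) : Dir → TMTape
  | .left => ⟨t.left.tail, t.left.headD none, t.head :: t.right⟩
  | .stay => t
  | .right => ⟨t.head :: t.left, t.right.headD none, t.right.tail⟩

/-- Write `a` in the scanned cell, then move. -/
def act (t : TMTape) (a : TapeSym × Dir) : TMTape := move { t with head := a.1 } a.2

/-- The word on the tape that starts at the head and extends to the right up to the first blank. -/
def word (t : TMTape) : Word := ((t.head :: t.right).takeWhile Option.isSome).reduceOption

/-- The number of recorded cells. Cells are never forgotten, so along a run this counts all the
cells that were visited or that initially held the input. -/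
def size (t : TMTape) : ℕ := t.left.length + 1 + t.right.length

end TMTape

/-- A (nondeterministic) oracle Turing machine with finitely many tapes and finite control. -/
structure OracleTM where
  /-- the states -/
  Q : Type
  [finQ : Fintype Q]
  /-- the (names of the) tapes -/
  K : Type
  [finK : Fintype K]
  inTape : K
  outTape : K
  queryTape : K
  start : Q
  accept : Q
  /-- `query q = some (q₁, q₀)` makes `q` a query state, with answer states `q₁` (yes), `q₀` (no). -/
  query : Q → Option (Q × Q)
  /-- For a state that is no query state and the scanned symbols: the possible next states together
  with the symbols to be written and the head moves. -/
  δ : Q → (K → TapeSym) → Set (Q × (K → TapeSym × Dir))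

attribute [instance] OracleTM.finQ OracleTM.finK

namespace OracleTM

variable (M : OracleTM) (O : Language Bool)

/-- Configurations. -/
structure Cfg where
  state : M.Q
  tape : M.K → TMTape

open Classical in
/-- The initial configuration: the input is on the input tape, all other tapes are blank. -/
noncomputable def init (x : Word) : M.Cfg where
  state := M.start
  tape i := if i = M.inTape then TMTape.ofWord x else TMTape.ofWord []

/-- One step of `M` with oracle `O`. -/
inductive Step : M.Cfg → M.Cfg → Prop
  | move (q q' : M.Q) (τ : M.K → TMTape) (a : M.K → TapeSym × Dir) :
      M.query q = none → (q', a) ∈ M.δ q (fun i => (τ i).head) →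
      Step ⟨q, τ⟩ ⟨q', fun i => (τ i).act (a i)⟩
  | yes (q q₁ q₀ : M.Q) (τ : M.K → TMTape) :
      M.query q = some (q₁, q₀) → (τ M.queryTape).word ∈ O → Step ⟨q, τ⟩ ⟨q₁, τ⟩
  | no (q q₁ q₀ : M.Q) (τ : M.K → TMTape) :
      M.query q = some (q₁, q₀) → (τ M.queryTape).word ∉ O → Step ⟨q, τ⟩ ⟨q₀, τ⟩

/-- `M.StepsIn O n c c'`: some computation of exactly `n` steps leads from `c` to `c'`. -/
inductive StepsIn : ℕ → M.Cfg → M.Cfg → Prop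
  | zero (c : M.Cfg) : StepsIn 0 c c
  | succ (n : ℕ) (c d e : M.Cfg) : StepsIn n c d → M.Step O d e → StepsIn (n + 1) c e

/-- The configuration `c` can be reached on input `x`. -/
def Reaches (x : Word) (c : M.Cfg) : Prop := ∃ n, M.StepsIn O n (M.init x) c

/-- `c` has no successor. -/
def Halted (c : M.Cfg) : Prop := ∀ d, ¬ M.Step O c d

/-- Some computation on input `x` halts in the accepting state, with final configuration `c`. -/
def AcceptsWith (x : Word) (c : M.Cfg) : Prop :=
  M.Reaches O x c ∧ M.Halted O c ∧ c.state = M.accept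

/-- At most one move is possible in each situation. -/
def Deterministic : Prop := ∀ q s, (M.δ q s).Subsingleton

/-- `M` has no query states, so it is an ordinary Turing machine. -/
def OracleFree : Prop := ∀ q, M.query q = none

/-- All computations, on all inputs, halt within polynomially many steps. -/
def PolyTime : Prop :=
  ∃ p : Polynomial ℕ, ∀ (x : Word) (n : ℕ) (c : M.Cfg),
    M.StepsIn O n (M.init x) c → n ≤ p.eval x.length

/-- On every input the machine uses polynomially many tape cells and halts. (This is used for
deterministic machines, which have a single computation on each input.) -/
def PolySpace : Prop :=
  ∃ p : Polynomial ℕ, ∀ x : Word,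
    (∀ c, M.Reaches O x c → ∑ i, (c.tape i).size ≤ p.eval x.length) ∧
    ∃ c, M.Reaches O x c ∧ M.Halted O c

/-- `M` with oracle `O` accepts the language `L`. -/
def Accepts (L : Language Bool) : Prop := ∀ x : Word, x ∈ L ↔ ∃ c, M.AcceptsWith O x c

/-- `M` with oracle `O` computes the partial function `f`: it accepts exactly the inputs
in the domain of `f`, and leaves the value of `f` on the output tape. -/
def Computes (f : Word →. Word) : Prop :=
  ∀ x y : Word, y ∈ f x ↔ ∃ c, M.AcceptsWith O x c ∧ (c.tape M.outTape).word = y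

end OracleTM

/-! ## The polynomial hierarchy -/

/-- The class `P`. -/
def classP : Set (Language Bool) :=
  {L | ∃ M : OracleTM, M.OracleFree ∧ M.Deterministic ∧ M.PolyTime 0 ∧ M.Accepts 0 L}

/-- The class `NP`. -/
def classNP : Set (Language Bool) :=
  {L | ∃ M : OracleTM, M.OracleFree ∧ M.PolyTime 0 ∧ M.Accepts 0 L}

/-- The class `NP^C`: nondeterministic polynomial time with an oracle in `C`. -/
def classNPOracle (C : Set (Language Bool)) : Set (Language Bool) :=
  {L | ∃ O ∈ C, ∃ M : OracleTM, M.PolyTime O ∧ M.Accepts O L}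

/-- `Σ₁ = NP` and `Σ_{k+1} = NP^{Σ_k}` for `k ≥ 1` (with the usual convention `Σ₀ = P`). -/
def SigmaP : ℕ → Set (Language Bool)
  | 0 => classP
  | 1 => classNP
  | k + 2 => classNPOracle (SigmaP (k + 1))

/-- The polynomial hierarchy, the union of all `Σ_k`, `k ≥ 1`. -/
def classPH : Set (Language Bool) := {L | ∃ k : ℕ, 1 ≤ k ∧ L ∈ SigmaP k}

/-! ## Classes of polynomially balanced partial functions -/

/-- `fP`. -/
def fP : Set (Word →. Word) :=
  {f | PolyBalanced f ∧
    ∃ M : OracleTM, M.OracleFree ∧ M.Deterministic ∧ M.PolyTime 0 ∧ M.Computes 0 f}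

/-- `fP^C`: deterministic polynomial time with an oracle in `C`. -/
def fPOracle (C : Set (Language Bool)) : Set (Word →. Word) :=
  {f | PolyBalanced f ∧
    ∃ O ∈ C, ∃ M : OracleTM, M.Deterministic ∧ M.PolyTime O ∧ M.Computes O f}

/-- `fPSpace`. -/
def fPSpace : Set (Word →. Word) :=
  {f | PolyBalanced f ∧
    ∃ M : OracleTM, M.OracleFree ∧ M.Deterministic ∧ M.PolySpace 0 ∧ M.Computes 0 f}

/-! Let `f` be polynomially balanced. The preimages of `y` have length at most `(|y| + 2) ^ d` for a
fixed `d`, so there are finitely many of them, and every point of the image has a least preimage.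
Any partial function that picks a preimage of each point of the image satisfies `f ∘ f' ∘ f = f`
(`isInverse_of_preimage`), and it is balanced with the two polynomials exchanged. Only the
complexity of the choice is at issue.

The least preimage is found letter by letter with the oracle `prefixLang f`, which tells whether
`w`, or some extension of `w`, is a preimage of `y`. Two questions per letter suffice
(`spec_loop_extend`), because in dictionary order a prefix precedes its extensions and everything
that begins with `w0` precedes everything that begins with `w1`. This language is in `NP` relative
to the oracle of `f`: guess the rest of the preimage, whose length is bounded, run the machine of
`f` on it and compare (`acc_prefixComp`). So it lies in `Σ₁` for `f` in `fP` and in `Σ_{k+1}` for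
`f` in `fP` with oracle in `Σ_k`. This gives the first two claims and the regularity of the monoid
over `PH`.

For composition, run the inner machine, copy its value, erase its tapes and run the outer machine
(`spec_composeComp`). Two oracles in `PH` are raised to a common level and merged into their join;
the levels are closed under joins by induction (`joinLang_mem_sigmaP`). In polynomial space all
words up to the length bound are enumerated and tested, with the same cells used again for each
(`spec_loop_tryWord`). The time is then uncontrolled, and the order is not the dictionary order, but
regularity needs only some inverse.

Most of the work is the construction of actual machines. They are assembled from components with
exits. `Comp.Run` records a time bound, a bound on the head positions and the exact set of outcomes
of all computations, so it handles nondeterminism and termination together. `Run.embed` shows that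
runs survive in a larger control, and yields the rules for sequencing and loops. Tapes are functions
on `ℤ` with an absolute head position; `TapeRep` ties them to the recorded tapes. `Spec.toTM` turns
a component into a machine, `spec_toComp` turns a machine into a component, and `spec_clean` resets
the simulated tapes for the next call. -/

noncomputable section
open scoped Classical

/-! ## Tapes with absolute positions -/

/-- A head movement as an integer. -/
def Dir.shift : Dir → ℤ
  | .left => -1
  | .stay => 0
  | .right => 1

/-- A tape as a function on `ℤ`, together with the position of the head. -/
@[ext] structure ATape where
  pos : ℤ
  cells : ℤ → TapeSym

namespace ATape

/-- The scanned symbol. -/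
def read (t : ATape) : TapeSym := t.cells t.pos

/-- Write a symbol and move. -/
def act (t : ATape) (a : TapeSym × Dir) : ATape :=
  ⟨t.pos + a.2.shift, Function.update t.cells t.pos a.1⟩

@[simp] theorem act_read_stay (t : ATape) : t.act (t.read, .stay) = t := by
  ext <;> simp [act, read, Dir.shift]

theorem natAbs_act_pos_le (t : ATape) (a : TapeSym × Dir) :
    (t.act a).pos.natAbs ≤ t.pos.natAbs + 1 := by
  rcases a with ⟨a, _ | _ | _⟩ <;> simp [act, Dir.shift] <;> omega

/-- The word `w` starts at the head and is followed by a blank. -/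
def HasWord (t : ATape) (w : Word) : Prop :=
  ∀ i : ℕ, i ≤ w.length → t.cells (t.pos + i) = w[i]?

/-- The blank after the word is part of `HasWord`, so the first blank determines the length. -/
theorem HasWord.unique {t : ATape} {v w : Word} (hv : t.HasWord v) (hw : t.HasWord w) : v = w := by
  have key : ∀ {v w : Word}, t.HasWord v → t.HasWord w → w.length ≤ v.length := by
    intro v w hv hw
    by_contra! h
    have h1 := hv v.length le_rfl
    rw [hw v.length h.le] at h1
    simp at h1
    omega
  apply List.ext_getElem? 
  intro i
  have hl := le_antisymm (key hv hw) (key hw hv)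
  by_cases hi : i ≤ v.length
  · rw [← hv i hi, ← hw i (by omega)]
  · rw [List.getElem?_eq_none (by omega), List.getElem?_eq_none (by omega)]

/-- The cells of a tape that holds the word `w` from position `s` on and is blank elsewhere. -/
def wordCells (s : ℤ) (w : Word) (i : ℤ) : TapeSym := if i < s then none else w[(i - s).toNat]?

theorem wordCells_add (s : ℤ) (w : Word) (i : ℕ) : wordCells s w (s + i) = w[i]? := by
  simp [wordCells]

theorem wordCells_zero (w : Word) (i : ℕ) : wordCells 0 w i = w[i]? := by
  simp [wordCells]

theorem wordCells_of_lt {s i : ℤ} (w : Word) (h : i < s) : wordCells s w i = none := by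
  simp [wordCells, h]

theorem wordCells_of_ge {s i : ℤ} {w : Word} (h : s + w.length ≤ i) : wordCells s w i = none := by
  simp only [wordCells]
  split
  · rfl
  · rw [List.getElem?_eq_none]; omega

@[simp] theorem wordCells_nil (s : ℤ) : wordCells s [] = fun _ => none := by
  funext i; simp [wordCells]

theorem wordCells_append (s : ℤ) (w : Word) (b : Bool) (p : ℤ) (hp : p = s + w.length) :
    Function.update (wordCells s w) p (some b) = wordCells s (w ++ [b]) := by
  subst hp
  funext i
  rcases lt_trichotomy i (s + w.length) with h | h | h
  · rw [Function.update_of_ne h.ne]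
    simp only [wordCells]
    split
    · rfl
    · rw [List.getElem?_append_left]; omega
  · subst h
    simp [wordCells_add]
  · rw [Function.update_of_ne h.ne', wordCells_of_ge h.le, wordCells_of_ge]
    simp; omega

theorem wordCells_cons (s : ℤ) (w : Word) (b : Bool) :
    Function.update (wordCells s w) (s - 1) (some b) = wordCells (s - 1) (b :: w) := by
  funext i
  rcases lt_trichotomy i (s - 1) with h | h | h
  · rw [Function.update_of_ne h.ne, wordCells_of_lt _ h, wordCells_of_lt]; omega
  · subst h
    simp [wordCells]
  · rw [Function.update_of_ne h.ne']
    obtain ⟨j, rfl⟩ : ∃ j : ℕ, i = s + j := ⟨(i - s).toNat, by omega⟩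
    rw [wordCells_add, show s + (j : ℤ) = s - 1 + (j + 1 : ℕ) by push_cast; ring, wordCells_add]
    simp

theorem wordCells_set (u v : Word) (a b : Bool) (p : ℤ) (hp : p = u.length) :
    Function.update (wordCells 0 (u ++ a :: v)) p (some b) = wordCells 0 (u ++ b :: v) := by
  subst hp
  funext i
  by_cases h : i = u.length
  · subst h; simp [wordCells_zero]
  · rw [Function.update_of_ne h]
    simp only [wordCells]
    split
    · rfl
    · rename_i h0
      obtain ⟨j, rfl⟩ : ∃ j : ℕ, i = j := ⟨i.toNat, by omega⟩
      simp only [sub_zero, Int.toNat_natCast]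
      rcases lt_or_ge j u.length with h1 | h1
      · rw [List.getElem?_append_left h1, List.getElem?_append_left h1]
      · rw [List.getElem?_append_right h1, List.getElem?_append_right h1]
        obtain ⟨k, hk⟩ : ∃ k, j - u.length = k + 1 := ⟨j - u.length - 1, by omega⟩
        rw [hk]; simp

/-- The tape that holds the word `w`, with the head on its first letter. -/
def ofWord (w : Word) : ATape := ⟨0, wordCells 0 w⟩

/-- The blank tape. -/
def blank : ATape := ⟨0, fun _ => none⟩

theorem ofWord_nil : ofWord [] = blank := by simp [ofWord, blank]

theorem hasWord_wordCells (s : ℤ) (w : Word) : (⟨s, wordCells s w⟩ : ATape).HasWord w :=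
  fun i _ => wordCells_add s w i

theorem hasWord_ofWord (w : Word) : (ofWord w).HasWord w := hasWord_wordCells 0 w

end ATape

/-! ## Components -/

/-- A piece of a multi-tape machine with tapes `K` and exits `E`. -/
structure Comp (K E : Type) where
  Q : Type
  [finQ : Fintype Q]
  start : Q
  query : Q → Option ((Q ⊕ E) × (Q ⊕ E))
  δ : Q → (K → TapeSym) → Set ((Q ⊕ E) × (K → TapeSym × Dir))

attribute [instance] Comp.finQ

/-- All heads are within distance `B` of the origin. -/
def Fits {K : Type} (B : ℕ∞) (τ : K → ATape) : Prop := ∀ k, ((τ k).pos.natAbs : ℕ∞) ≤ B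

@[simp] theorem fits_top {K : Type} (τ : K → ATape) : Fits ⊤ τ := fun _ => le_top

theorem Fits.mono {K : Type} {B B' : ℕ∞} {τ : K → ATape} (h : Fits B τ) (hB : B ≤ B') :
    Fits B' τ := fun k => (h k).trans hB

namespace Comp

variable {K E E' : Type}

/-- At most one move is possible in each situation. -/
def Det (C : Comp K E) : Prop := ∀ q s, (C.δ q s).Subsingleton

/-- There are no query states. -/
def Free (C : Comp K E) : Prop := ∀ q, C.query q = none

/-- One step of a component. -/
inductive Step (C : Comp K E) (O : Language Bool) (qT : K) (q : C.Q) (τ : K → ATape) :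
    (C.Q ⊕ E) → (K → ATape) → Prop
  | move (r a) : C.query q = none → (r, a) ∈ C.δ q (fun k => (τ k).read) →
      Step C O qT q τ r (fun k => (τ k).act (a k))
  | yes (r₁ r₀) : C.query q = some (r₁, r₀) → (∃ w ∈ O, (τ qT).HasWord w) → Step C O qT q τ r₁ τ
  | no (r₁ r₀) : C.query q = some (r₁, r₀) → (¬ ∃ w ∈ O, (τ qT).HasWord w) → Step C O qT q τ r₀ τ

/-- All computations from `(r, τ)` have at most `n` steps and keep the heads within distance `B` of
the origin, and `S` is the set of exits that they reach. -/
inductive Run (C : Comp K E) (O : Language Bool) (qT : K) (B : ℕ∞) :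
    (C.Q ⊕ E) → (K → ATape) → ℕ → Set (E × (K → ATape)) → Prop
  | exit (e τ n) : Fits B τ → Run C O qT B (.inr e) τ n {(e, τ)}
  | step (q τ n) (F : (C.Q ⊕ E) → (K → ATape) → Set (E × (K → ATape))) (S) : Fits B τ →
      (∀ r τ', C.Step O qT q τ r τ' → Run C O qT B r τ' n (F r τ')) →
      (∀ z, z ∈ S ↔ ∃ r τ', C.Step O qT q τ r τ' ∧ z ∈ F r τ') →
      Run C O qT B (.inl q) τ (n + 1) S

/-- The behaviour of a component from its start state. -/
def Spec (C : Comp K E) (O : Language Bool) (qT : K) (B : ℕ∞) (τ : K → ATape) (n : ℕ)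
    (S : Set (E × (K → ATape))) : Prop := C.Run O qT B (.inl C.start) τ n S

variable {O : Language Bool} {qT : K} {B : ℕ∞}

theorem Run.mono {C : Comp K E} {r τ n S} (h : C.Run O qT B r τ n S) :
    ∀ {m}, n ≤ m → C.Run O qT B r τ m S := by
  induction h with
  | exit e τ n hf => intro m _; exact .exit e τ m hf
  | step q τ n F S hf _ hS ih =>
    intro m hm
    obtain ⟨m, rfl⟩ : ∃ k, m = k + 1 := ⟨m - 1, by omega⟩
    exact .step q τ m F S hf (fun r τ' hs => ih r τ' hs (by omega)) hS

/-- The outcomes depend only on the component, its state and the tapes, whatever the time bound.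
This identifies outcome sets that were chosen or obtained along different routes. -/
theorem Run.unique {C : Comp K E} {r τ n S} (h : C.Run O qT B r τ n S) :
    ∀ {m S'}, C.Run O qT B r τ m S' → S = S' := by
  induction h with
  | exit e τ n hf => intro m S' h'; cases h'; rfl
  | step q τ n F S hf _ hS ih =>
    intro m S' h'
    cases h' with
    | step _ _ m F' _ _ h2 hS' =>
      ext z
      rw [hS, hS']
      constructor
      · rintro ⟨r, τ', hs, hz⟩; exact ⟨r, τ', hs, ih r τ' hs (h2 r τ' hs) ▸ hz⟩
      · rintro ⟨r, τ', hs, hz⟩; exact ⟨r, τ', hs, (ih r τ' hs (h2 r τ' hs)).symm ▸ hz⟩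

theorem Run.congr {C : Comp K E} {r τ n S S'} (h : C.Run O qT B r τ n S) (hS : S = S') :
    C.Run O qT B r τ n S' := hS ▸ h

theorem Run.weaken {C : Comp K E} {r τ n S} (h : C.Run O qT B r τ n S) {B' : ℕ∞} (hB : B ≤ B') :
    C.Run O qT B' r τ n S := by
  induction h with
  | exit e τ n hf => exact .exit e τ n (hf.mono hB)
  | step q τ n F S hf _ hS ih => exact .step q τ n F S (hf.mono hB) ih hS

theorem Run.fits {C : Comp K E} {r τ n S} (h : C.Run O qT B r τ n S) : Fits B τ := by
  cases h <;> assumption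

theorem Run.fits_exit {C : Comp K E} {r τ n S} (h : C.Run O qT B r τ n S) :
    ∀ z ∈ S, Fits B z.2 := by
  induction h with
  | exit e τ n hf => rintro z rfl; exact hf
  | step q τ n F S hf _ hS ih =>
    intro z hz
    obtain ⟨r, τ', hs, hz⟩ := (hS z).1 hz
    exact ih r τ' hs z hz

theorem Step.natAbs_le {C : Comp K E} {q τ r τ'} (h : C.Step O qT q τ r τ') (k : K) :
    (τ' k).pos.natAbs ≤ (τ k).pos.natAbs + 1 := by
  cases h with
  | move _ a => exact (τ k).natAbs_act_pos_le (a k)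
  | yes => omega
  | no => omega

/-- A step moves each head by at most one cell, so time bounds space. Subroutines can therefore be
specified with `B = ⊤`, and a finite bound is restored afterwards. -/
theorem Run.fits_of_top {C : Comp K E} {r τ n S} (h : C.Run O qT ⊤ r τ n S) :
    ∀ {b : ℕ}, Fits b τ → C.Run O qT (b + n : ℕ) r τ n S := by
  induction h with
  | exit e τ n hf => intro b hb; exact .exit e τ n (hb.mono (by exact_mod_cast Nat.le_add_right _ _))
  | step q τ n F S hf _ hS ih =>
    intro b hb
    refine .step q τ n F S (hb.mono (by exact_mod_cast Nat.le_add_right _ _)) ?_ hS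
    intro r τ' hs
    have := ih r τ' hs (b := b + 1) (fun k => by
      have h1 := hs.natAbs_le k
      have h2 : (τ k).pos.natAbs ≤ b := by exact_mod_cast hb k
      exact_mod_cast h1.trans (by omega))
    rwa [show b + 1 + n = b + (n + 1) by ring] at this

/-- The runs of a component inside a larger one. -/
theorem Run.embed {C : Comp K E} {C' : Comp K E'} {φ : C.Q → C'.Q} {ψ : C.Q ⊕ E → C'.Q ⊕ E'}
    (hψ : ∀ q, ψ (.inl q) = .inl (φ q))
    (hq : ∀ q, C'.query (φ q) = (C.query q).map (Prod.map ψ ψ))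
    (hδ : ∀ q s, C'.δ (φ q) s = Prod.map ψ id '' C.δ q s)
    {m : ℕ} {r τ n S} (h : C.Run O qT B r τ n S) : ∀ {G : E → (K → ATape) → Set (E' × (K → ATape))},
    (∀ e τ', (e, τ') ∈ S → C'.Run O qT B (ψ (.inr e)) τ' m (G e τ')) →
    C'.Run O qT B (ψ r) τ (n + m) {z | ∃ e τ', (e, τ') ∈ S ∧ z ∈ G e τ'} := by
  induction h with
  | exit e τ n hf =>
    intro G hG
    refine ((hG e τ rfl).mono (by omega)).congr ?_
    ext z; simp
  | step q τ n F S hf hr hS ih =>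
    intro G hG
    -- The transitions out of `φ q` are by hypothesis the images under `ψ` of those out of `q`, for
    -- moves as well as for answers.
    have hstep : ∀ r' τ', C'.Step O qT (φ q) τ r' τ' ↔ ∃ r, r' = ψ r ∧ C.Step O qT q τ r τ' := by
      intro r' τ'
      constructor
      · intro h
        cases h with
        | move _ a h1 h2 =>
          rw [hδ] at h2
          obtain ⟨⟨r, a'⟩, h3, h4⟩ := h2
          simp only [Prod.map_apply, id_eq, Prod.mk.injEq] at h4
          obtain ⟨rfl, rfl⟩ := h4
          exact ⟨r, rfl, .move r a' (by simpa [hq] using h1) h3⟩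
        | yes r₁ r₀ h1 h2 =>
          rw [hq, Option.map_eq_some_iff] at h1
          obtain ⟨⟨s₁, s₀⟩, h3, h4⟩ := h1
          simp only [Prod.map_apply, Prod.mk.injEq] at h4
          exact ⟨s₁, h4.1.symm, .yes s₁ s₀ h3 h2⟩
        | no r₁ r₀ h1 h2 =>
          rw [hq, Option.map_eq_some_iff] at h1
          obtain ⟨⟨s₁, s₀⟩, h3, h4⟩ := h1
          simp only [Prod.map_apply, Prod.mk.injEq] at h4
          exact ⟨s₀, h4.2.symm, .no s₁ s₀ h3 h2⟩
      · rintro ⟨r, rfl, h⟩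
        cases h with
        | move _ a h1 h2 =>
          exact .move _ a (by simp [hq, h1]) (by rw [hδ]; exact ⟨_, h2, rfl⟩)
        | yes _ r₀ h1 h2 => exact .yes (ψ r) (ψ r₀) (by simp [hq, h1]) h2
        | no r₁ _ h1 h2 => exact .no (ψ r₁) (ψ r) (by simp [hq, h1]) h2
    have hih : ∀ r τ', C.Step O qT q τ r τ' → C'.Run O qT B (ψ r) τ' (n + m)
        {z | ∃ e τ'', (e, τ'') ∈ F r τ' ∧ z ∈ G e τ''} := fun r τ' hs =>
      ih r τ' hs fun e τ'' he => hG e τ'' ((hS _).2 ⟨r, τ', hs, he⟩)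
    rw [hψ, show n + 1 + m = n + m + 1 by ring]
    -- `ψ` need not be injective, so the outcome set of a target `r'` is collected over all `r` with
    -- `ψ r = r'`; by `Run.unique` they contribute the same set.
    refine .step _ _ _ (fun r' τ' => {z | ∃ r, r' = ψ r ∧ C.Step O qT q τ r τ' ∧
      ∃ e τ'', (e, τ'') ∈ F r τ' ∧ z ∈ G e τ''}) _ hf ?_ ?_
    · intro r' τ' hs
      obtain ⟨r, rfl, hr⟩ := (hstep _ _).1 hs
      refine (hih r τ' hr).congr ?_
      ext z
      constructor
      · intro hz; exact ⟨r, rfl, hr, hz⟩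
      · rintro ⟨r₂, he, hr₂, hz⟩
        have := (hih r₂ τ' hr₂)
        rw [← he] at this
        exact (this.unique (hih r τ' hr)) ▸ hz
    · intro z
      constructor
      · rintro ⟨e, τ'', h1, h2⟩
        obtain ⟨r, τ', hs, hz⟩ := (hS _).1 h1
        exact ⟨ψ r, τ', (hstep _ _).2 ⟨r, rfl, hs⟩, r, rfl, hs, e, τ'', hz, h2⟩
      · rintro ⟨r', τ', -, r, rfl, hs, e, τ'', hz, h2⟩
        exact ⟨e, τ'', (hS _).2 ⟨r, τ', hs, hz⟩, h2⟩

/-! ### Elementary components -/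

/-- A single move. -/
def choose (f : (K → TapeSym) → Set (E × (K → TapeSym × Dir))) : Comp K E where
  Q := Unit
  start := ()
  query _ := none
  δ _ s := Prod.map .inr id '' f s

/-- A single deterministic move. -/
def act (f : (K → TapeSym) → E × (K → TapeSym × Dir)) : Comp K E := choose fun s => {f s}

/-- Halt without reaching an exit. -/
def fail : Comp K E := choose fun _ => ∅

/-- Do nothing. -/
def ret (e : E) : Comp K E := act fun s => (e, fun k => (s k, .stay))

/-- Ask the oracle. -/
def ask : Comp K Bool where
  Q := Unit
  start := ()
  query _ := some (.inr true, .inr false)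
  δ _ _ := ∅

theorem choose_det {f : (K → TapeSym) → Set (E × (K → TapeSym × Dir))}
    (h : ∀ s, (f s).Subsingleton) : (choose f).Det := fun _ s => (h s).image _

@[simp] theorem act_det (f : (K → TapeSym) → E × (K → TapeSym × Dir)) : (act f).Det :=
  choose_det fun _ => Set.subsingleton_singleton

@[simp] theorem fail_det : (fail : Comp K E).Det := choose_det fun _ => Set.subsingleton_empty
@[simp] theorem ret_det (e : E) : (ret e : Comp K E).Det := act_det _
@[simp] theorem ask_det : (ask : Comp K Bool).Det := fun _ _ => Set.subsingleton_empty
@[simp] theorem choose_free (f : (K → TapeSym) → Set (E × (K → TapeSym × Dir))) :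
    (choose f).Free := fun _ => rfl
@[simp] theorem act_free (f : (K → TapeSym) → E × (K → TapeSym × Dir)) : (act f).Free :=
  fun _ => rfl
@[simp] theorem fail_free : (fail : Comp K E).Free := fun _ => rfl
@[simp] theorem ret_free (e : E) : (ret e : Comp K E).Free := fun _ => rfl

theorem spec_choose {f : (K → TapeSym) → Set (E × (K → TapeSym × Dir))} {τ : K → ATape}
    (h0 : Fits B τ)
    (h1 : ∀ z ∈ f (fun k => (τ k).read), Fits B fun k => (τ k).act (z.2 k)) :
    (choose f).Spec O qT B τ 1
      ((fun z => (z.1, fun k => (τ k).act (z.2 k))) '' f (fun k => (τ k).read)) := by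
  refine .step (C := choose f) () τ 0 (fun r τ' => {z | r = .inr z.1 ∧ τ' = z.2}) _ h0 ?_ ?_
  · intro r τ' hs
    cases hs with
    | move _ a h2 h3 =>
      obtain ⟨⟨e, a⟩, h4, h5⟩ := h3
      cases h5
      refine (Run.exit e _ 0 (h1 _ h4)).congr ?_
      ext ⟨e', τ'⟩
      simp only [Set.mem_singleton_iff, Set.mem_ofPred_eq, Prod.mk.injEq, id_eq]
      exact and_congr ⟨fun h => h ▸ rfl, fun h => (Sum.inr.inj h).symm⟩ eq_comm
    | yes _ _ h => cases h
    | no _ _ h => cases h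
  · rintro ⟨e, τ'⟩
    constructor
    · rintro ⟨⟨e', a⟩, h2, h3⟩
      cases h3
      exact ⟨.inr e', _, .move (C := choose f) (.inr e') a rfl ⟨_, h2, rfl⟩, rfl, rfl⟩
    · rintro ⟨r, τ'', hs, rfl, rfl⟩
      cases hs with
      | move _ a h2 h3 =>
        obtain ⟨⟨e, a⟩, h4, h5⟩ := h3
        cases h5
        exact ⟨_, h4, rfl⟩
      | yes _ _ h => cases h
      | no _ _ h => cases h

theorem spec_act {f : (K → TapeSym) → E × (K → TapeSym × Dir)} {τ : K → ATape}
    (h0 : Fits B τ) {e : E} {τ' : K → ATape} (h1 : Fits B τ')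
    (he : (f fun k => (τ k).read).1 = e)
    (hτ : ∀ k, (τ k).act ((f fun k => (τ k).read).2 k) = τ' k) :
    (act f).Spec O qT B τ 1 {(e, τ')} := by
  obtain rfl : τ' = _ := (funext hτ).symm
  subst he
  refine (spec_choose h0 ?_).congr ?_
  · rintro z rfl; exact h1
  · simp

theorem spec_fail {τ : K → ATape} (h0 : Fits B τ) : (fail : Comp K E).Spec O qT B τ 1 ∅ :=
  (spec_choose h0 (by simp)).congr (by simp)

theorem spec_ret {τ : K → ATape} (h0 : Fits B τ) (e : E) :
    (ret e : Comp K E).Spec O qT B τ 1 {(e, τ)} :=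
  spec_act h0 h0 rfl (by simp)

theorem spec_ask {τ : K → ATape} (h0 : Fits B τ) {b : Bool}
    (hb : b = true ↔ ∃ w ∈ O, (τ qT).HasWord w) :
    (ask : Comp K Bool).Spec O qT B τ 1 {(b, τ)} := by
  have hs : ∀ r τ', (ask : Comp K Bool).Step O qT () τ r τ' ↔ r = .inr b ∧ τ' = τ := by
    intro r τ'
    constructor
    · intro h
      cases h with
      | move _ a h2 h3 => cases h2
      | yes _ _ h h' => cases h; rw [hb.2 h']; exact ⟨rfl, rfl⟩
      | no _ _ h h' =>
        cases h
        cases b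
        · exact ⟨rfl, rfl⟩
        · exact absurd (hb.1 rfl) h'
    · rintro ⟨rfl, rfl⟩
      cases b
      · exact .no (C := ask) _ _ rfl (fun h => by simpa using hb.2 h)
      · exact .yes (C := ask) _ _ rfl (hb.1 rfl)
  refine .step (C := ask) () τ 0 (fun r τ' => {z | z = (b, τ)}) _ h0 ?_ ?_
  · intro r τ' h
    obtain ⟨rfl, rfl⟩ := (hs _ _).1 h
    exact .exit _ _ _ h0
  · intro z
    simp [hs]

/-- Change the names of the exits. -/
def relabel {E E' : Type} (g : E → E') (C : Comp K E) : Comp K E' where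
  Q := C.Q
  start := C.start
  query q := (C.query q).map (Prod.map (Sum.map id g) (Sum.map id g))
  δ q s := Prod.map (Sum.map id g) id '' C.δ q s

theorem spec_relabel {C : Comp K E} {g : E → E'} {τ n S} (h : C.Spec O qT B τ n S) :
    (C.relabel g).Spec O qT B τ n (Prod.map g id '' S) := by
  have := Run.embed (C := C) (C' := C.relabel g) (φ := id) (ψ := Sum.map id g) (m := 0)
    (G := fun e τ => {(g e, τ)}) (fun _ => rfl) (fun _ => rfl) (fun _ _ => rfl) h
    (fun e τ' he => .exit _ _ _ (h.fits_exit _ he))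
  refine Run.congr this ?_
  ext ⟨e, τ'⟩
  simp only [Set.mem_ofPred_eq, Set.mem_singleton_iff, Set.mem_image, Prod.exists, Prod.map_apply, id_eq,
    Prod.mk.injEq]
  constructor
  · rintro ⟨a, b, h1, rfl, rfl⟩; exact ⟨a, _, h1, rfl, rfl⟩
  · rintro ⟨a, b, h1, rfl, rfl⟩; exact ⟨a, _, h1, rfl, rfl⟩

@[simp] theorem relabel_det {C : Comp K E} (g : E → E') (h : C.Det) : (C.relabel g).Det :=
  fun q s => (h q s).image _
@[simp] theorem relabel_free {C : Comp K E} (g : E → E') (h : C.Free) : (C.relabel g).Free :=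
  fun q => by simp [relabel, h q]

/-- Sequential composition. -/
def bind [Fintype E] (C : Comp K E) (D : E → Comp K E') : Comp K E' where
  Q := C.Q ⊕ Σ e, (D e).Q
  start := .inl C.start
  query := Sum.elim
    (fun q => (C.query q).map (Prod.map (Sum.elim (fun q => .inl (.inl q)) fun e => .inl (.inr ⟨e, (D e).start⟩))
      (Sum.elim (fun q => .inl (.inl q)) fun e => .inl (.inr ⟨e, (D e).start⟩))))
    (fun q => ((D q.1).query q.2).map (Prod.map (Sum.map (fun p => .inr ⟨q.1, p⟩) id)
      (Sum.map (fun p => .inr ⟨q.1, p⟩) id)))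
  δ := Sum.elim
    (fun q s => Prod.map (Sum.elim (fun q => .inl (.inl q)) fun e => .inl (.inr ⟨e, (D e).start⟩)) id '' C.δ q s)
    (fun q s => Prod.map (Sum.map (fun p => .inr ⟨q.1, p⟩) id) id '' (D q.1).δ q.2 s)

/-- Two applications of `Run.embed`: `C` goes to the left summand of the states, with its exit `e`
glued to the start of `D e`, and each `D e` goes to its own summand. The time bound `m` is common to
all branches. -/
theorem spec_bind [Fintype E] {C : Comp K E} {D : E → Comp K E'} {τ n m S}
    {G : E → (K → ATape) → Set (E' × (K → ATape))} (h : C.Spec O qT B τ n S)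
    (hD : ∀ e τ', (e, τ') ∈ S → (D e).Spec O qT B τ' m (G e τ')) :
    (C.bind D).Spec O qT B τ (n + m) {z | ∃ e τ', (e, τ') ∈ S ∧ z ∈ G e τ'} := by
  refine Run.embed (C' := C.bind D) (φ := .inl)
    (ψ := Sum.elim (fun q => .inl (.inl q)) fun e => .inl (.inr ⟨e, (D e).start⟩))
    (fun _ => rfl) (fun _ => rfl) (fun _ _ => rfl) h ?_
  intro e τ' he
  have := Run.embed (C := D e) (C' := C.bind D) (φ := fun q => .inr ⟨e, q⟩)
    (ψ := Sum.map (fun p => .inr ⟨e, p⟩) id) (m := 0) (G := fun e τ => {(e, τ)})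
    (fun _ => rfl) (fun _ => rfl) (fun _ _ => rfl) (hD e τ' he)
    (fun e' τ'' he' => .exit _ _ _ ((hD e τ' he).fits_exit _ he'))
  refine Run.congr this ?_
  ext ⟨e, τ'⟩
  simp only [Set.mem_ofPred_eq, Set.mem_singleton_iff, Prod.mk.injEq]
  constructor
  · rintro ⟨a, b, h1, rfl, rfl⟩; exact h1
  · intro h1; exact ⟨_, _, h1, rfl, rfl⟩

/-- Sequential composition after a run with a single outcome. -/
theorem spec_bind_single [Fintype E] {C : Comp K E} {D : E → Comp K E'} {τ n m e τ' S}
    (h : C.Spec O qT B τ n {(e, τ')}) (hD : (D e).Spec O qT B τ' m S) :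
    (C.bind D).Spec O qT B τ (n + m) S := by
  refine Run.congr (spec_bind (G := fun _ _ => S) h (fun e' τ'' he => ?_)) ?_
  · cases he; exact hD
  · ext z; simp

theorem spec_bind_empty [Fintype E] {C : Comp K E} {D : E → Comp K E'} {τ n}
    (h : C.Spec O qT B τ n ∅) : (C.bind D).Spec O qT B τ n ∅ := by
  refine Run.congr (spec_bind (m := 0) (G := fun _ _ => ∅) h (fun e' τ'' he => ?_)) ?_
  · cases he
  · ext z; simp

theorem bind_det [Fintype E] {C : Comp K E} {D : E → Comp K E'} (h : C.Det) (hD : ∀ e, (D e).Det) :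
    (C.bind D).Det := by
  rintro (q | q) s
  · exact (h q s).image _
  · exact (hD q.1 q.2 s).image _

theorem bind_free [Fintype E] {C : Comp K E} {D : E → Comp K E'} (h : C.Free)
    (hD : ∀ e, (D e).Free) : (C.bind D).Free := by
  rintro (q | q)
  · simp [bind, h q]
  · simp [bind, hD q.1 q.2]

/-- A loop with a state from a finite set: `body s` leads to the next state or leaves the loop. -/
def iter {S : Type} [Fintype S] (body : S → Comp K (S ⊕ E)) (s₀ : S) : Comp K E where
  Q := Σ s, (body s).Q
  start := ⟨s₀, (body s₀).start⟩
  query q := ((body q.1).query q.2).map (Prod.map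
    (Sum.elim (fun p => .inl ⟨q.1, p⟩) (Sum.map (fun s => ⟨s, (body s).start⟩) id))
    (Sum.elim (fun p => .inl ⟨q.1, p⟩) (Sum.map (fun s => ⟨s, (body s).start⟩) id)))
  δ q s := Prod.map
    (Sum.elim (fun p => .inl ⟨q.1, p⟩) (Sum.map (fun s => ⟨s, (body s).start⟩) id)) id ''
      (body q.1).δ q.2 s

/-- The start state plays no part in the transitions, so runs carry over between loops that differ
only there. The continuation of a loop can then be specified as a loop that starts at `s'`. -/
theorem run_iter_start {S : Type} [Fintype S] {body : S → Comp K (S ⊕ E)} {s s' : S} {r τ n T}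
    (h : (iter body s).Run O qT B r τ n T) : (iter body s').Run O qT B r τ n T := by
  have := Run.embed (C := iter body s) (C' := iter body s') (φ := id) (ψ := id) (m := 0)
    (G := fun e τ => {(e, τ)}) (fun _ => rfl)
    (fun _ => ((congrArg (fun f => Option.map f _) Prod.map_id).trans (congrFun Option.map_id _)).symm)
    (fun _ _ => ((congrArg (fun f => f '' _) Prod.map_id).trans (Set.image_id _)).symm) h
    (fun e τ' he => .exit _ _ _ (h.fits_exit _ he))
  refine Run.congr this ?_
  ext ⟨e, τ'⟩
  simp

/-- A single unrolling: a pass through the body ends at a proper exit or at the start of the next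
pass. The induction over the passes is left to the user of the rule. -/
theorem spec_iter {S : Type} [Fintype S] {body : S → Comp K (S ⊕ E)} {s : S} {τ n m T}
    {G : S → (K → ATape) → Set (E × (K → ATape))} (h : (body s).Spec O qT B τ n T)
    (hG : ∀ s' τ', (.inl s', τ') ∈ T → (iter body s').Spec O qT B τ' m (G s' τ')) :
    (iter body s).Spec O qT B τ (n + m)
      {z | (.inr z.1, z.2) ∈ T ∨ ∃ s' τ', (.inl s', τ') ∈ T ∧ z ∈ G s' τ'} := by
  have := Run.embed (C' := iter body s) (φ := fun p => ⟨s, p⟩) (m := m)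
    (ψ := Sum.elim (fun p => .inl ⟨s, p⟩) (Sum.map (fun s => ⟨s, (body s).start⟩) id))
    (G := fun e τ' => Sum.elim (fun s' => G s' τ') (fun e => {(e, τ')}) e)
    (fun _ => rfl) (fun _ => rfl) (fun _ _ => rfl) h ?_
  · refine Run.congr this ?_
    ext ⟨e, τ'⟩
    simp only [Set.mem_ofPred_eq, Sum.exists, Sum.elim_inl, Sum.elim_inr, Set.mem_singleton_iff, Prod.mk.injEq]
    constructor
    · rintro (⟨a, b, h1, h2⟩ | ⟨a, b, h1, rfl, rfl⟩)
      · exact .inr ⟨a, b, h1, h2⟩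
      · exact .inl h1
    · rintro (h1 | ⟨a, b, h1, h2⟩)
      · exact .inr ⟨_, _, h1, rfl, rfl⟩
      · exact .inl ⟨a, b, h1, h2⟩
  · rintro (s' | e) τ' he
    · exact run_iter_start (s := s') (hG s' τ' he)
    · exact .exit _ _ _ (h.fits_exit _ he)

theorem iter_det {S : Type} [Fintype S] {body : S → Comp K (S ⊕ E)} {s₀ : S}
    (h : ∀ s, (body s).Det) : (iter body s₀).Det := fun q s => (h q.1 q.2 s).image _

theorem iter_free {S : Type} [Fintype S] {body : S → Comp K (S ⊕ E)} {s₀ : S}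
    (h : ∀ s, (body s).Free) : (iter body s₀).Free := fun q => by simp [iter, h q.1 q.2]

/-- `none` means that a loop continues. -/
def loopExit : Option E → Unit ⊕ E
  | none => .inl ()
  | some e => .inr e

/-- Repeat until the body returns a value. -/
def loop (C : Comp K (Option E)) : Comp K E :=
  iter (fun _ : Unit => C.relabel loopExit) ()

theorem loop_det {C : Comp K (Option E)} (h : C.Det) : (loop C).Det := iter_det fun _ => relabel_det _ h
theorem loop_free {C : Comp K (Option E)} (h : C.Free) : (loop C).Free :=
  iter_free fun _ => relabel_free _ h

theorem spec_loop {C : Comp K (Option E)} {τ n m T} {G : (K → ATape) → Set (E × (K → ATape))}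
    (h : C.Spec O qT B τ n T)
    (hG : ∀ τ', (none, τ') ∈ T → (loop C).Spec O qT B τ' m (G τ')) :
    (loop C).Spec O qT B τ (n + m)
      {z | (some z.1, z.2) ∈ T ∨ ∃ τ', (none, τ') ∈ T ∧ z ∈ G τ'} := by
  refine Run.congr (spec_iter (S := Unit) (body := fun _ => C.relabel loopExit)
    (s := ()) (G := fun _ => G) (spec_relabel h) ?_) ?_
  · rintro ⟨⟩ τ' ⟨⟨o, τ''⟩, h1, h2⟩
    cases o with
    | none => cases h2; exact hG _ h1
    | some e => cases h2
  · ext ⟨e, τ'⟩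
    simp only [Set.mem_image, Prod.exists, Prod.map_apply, id_eq, Prod.mk.injEq, Set.mem_ofPred_eq]
    constructor
    · rintro (⟨o, τ'', h1, h2, rfl⟩ | ⟨_, τ₁, ⟨o, τ₂, h1, h2, rfl⟩, h3⟩)
      · cases o with
        | none => cases h2
        | some e => cases h2; exact .inl h1
      · cases o with
        | none => exact .inr ⟨_, h1, h3⟩
        | some e => cases h2
    · rintro (h1 | ⟨τ₁, h1, h2⟩)
      · exact .inl ⟨_, _, h1, rfl, rfl⟩
      · exact .inr ⟨(), _, ⟨_, _, h1, rfl, rfl⟩, h2⟩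

theorem spec_loop_exit {C : Comp K (Option E)} {τ n e τ'} (h : C.Spec O qT B τ n {(some e, τ')}) :
    (loop C).Spec O qT B τ n {(e, τ')} := by
  refine Run.congr (spec_loop (m := 0) (G := fun _ => ∅) h ?_) ?_
  · rintro τ' h; cases h
  · ext ⟨e, τ'⟩; simp

theorem spec_loop_fail {C : Comp K (Option E)} {τ n} (h : C.Spec O qT B τ n ∅) :
    (loop C).Spec O qT B τ n ∅ := by
  refine Run.congr (spec_loop (m := 0) (G := fun _ => ∅) h ?_) ?_
  · rintro τ' h; cases h
  · ext ⟨e, τ'⟩; simp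

theorem spec_loop_next {C : Comp K (Option E)} {τ n τ' m S} (h : C.Spec O qT B τ n {(none, τ')})
    (h' : (loop C).Spec O qT B τ' m S) : (loop C).Spec O qT B τ (n + m) S := by
  refine Run.congr (spec_loop (G := fun _ => S) h ?_) ?_
  · rintro τ' h; cases h; exact h'
  · ext ⟨e, τ'⟩; simp

/-- `t i` is the state of the tapes after `i` passes, the invariant of a deterministic loop whose
passes take time `m`; the time `m'` belongs to whatever follows the first `n` passes. -/
theorem spec_loop_iterate {C : Comp K (Option E)} {m m' : ℕ} {S} (n : ℕ) (t : ℕ → K → ATape)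
    (h : ∀ i < n, C.Spec O qT B (t i) m {(none, t (i + 1))})
    (h' : (loop C).Spec O qT B (t n) m' S) : (loop C).Spec O qT B (t 0) (n * m + m') S := by
  induction n generalizing t with
  | zero => simpa using h'
  | succ n ih =>
    have := spec_loop_next (h 0 (by omega)) (ih (fun i => t (i + 1)) (fun i hi => h (i + 1) (by omega)) h')
    refine this.mono (le_of_eq ?_)
    ring

end Comp
end

noncomputable section
open scoped Classical

/-! ## Recorded tapes and absolute tapes -/

/-- The recorded tape `t` has the contents of `a`; it was started at the origin, and the recorded
cells are within distance `b` of it. -/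
structure TapeRep (b : ℕ) (t : TMTape) (a : ATape) : Prop where
  head : t.head = a.read
  right : ∀ n : ℕ, t.right.getD n none = a.cells (a.pos + (n + 1))
  left : ∀ n : ℕ, t.left.getD n none = a.cells (a.pos - (n + 1))
  pos_le : a.pos ≤ t.left.length
  neg_pos_le : -a.pos ≤ t.right.length
  left_le : t.left.length ≤ b + a.pos
  right_le : t.right.length + a.pos ≤ b

namespace TapeRep

theorem size_le {b : ℕ} {t : TMTape} {a : ATape} (h : TapeRep b t a) : t.size ≤ 2 * b + 1 := by
  have := h.left_le
  have := h.right_le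
  simp only [TMTape.size]
  omega

/-- The recorded cells form an interval that contains the origin (`pos_le`, `neg_pos_le`) and the
head, so their number exceeds the distance of the two. The spare cell leaves room for one more move.
-/
theorem natAbs_lt {b B : ℕ} {t : TMTape} {a : ATape} (h : TapeRep b t a) (hB : t.size ≤ B) :
    a.pos.natAbs + 1 ≤ B := by
  have := h.pos_le
  have := h.neg_pos_le
  simp only [TMTape.size] at hB
  omega

/-- An interval of at most `B` cells around the origin stays within distance `B`, and unrecorded
cells are blank. This confines the region that has to be erased after a simulation. -/
theorem cells_eq_none {b B : ℕ} {t : TMTape} {a : ATape} (h : TapeRep b t a) (hB : t.size ≤ B) {i : ℤ}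
    (hi : B < i.natAbs) : a.cells i = none := by
  have h1 := h.left_le
  have h2 := h.pos_le
  have h3 := h.neg_pos_le
  simp only [TMTape.size] at hB
  rcases lt_trichotomy i a.pos with hlt | rfl | hlt
  · obtain ⟨n, rfl⟩ : ∃ n : ℕ, i = a.pos - (n + 1) := ⟨(a.pos - i - 1).toNat, by omega⟩
    rw [← h.left, List.getD_eq_default]
    omega
  · omega
  · obtain ⟨n, rfl⟩ : ∃ n : ℕ, i = a.pos + (n + 1) := ⟨(i - a.pos - 1).toNat, by omega⟩
    rw [← h.right, List.getD_eq_default]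
    omega

/-- A new cell is recorded only when the head enters it, and `hb` keeps that cell within distance
`b`. -/
theorem act {b : ℕ} {t : TMTape} {a : ATape} (h : TapeRep b t a) (x : TapeSym × Dir)
    (hb : (a.act x).pos.natAbs ≤ b) : TapeRep b (t.act x) (a.act x) := by
  obtain ⟨h1, h2, h3, h4, h5, h6, h7⟩ := h
  have key : ∀ i, i ≠ a.pos → Function.update a.cells a.pos x.1 i = a.cells i :=
    fun i hi => Function.update_of_ne hi _ _
  have h20 := h2 0
  have h30 := h3 0
  have h2s : ∀ n : ℕ, t.right.tail.getD n none = a.cells (a.pos + (n + 2)) := fun n => by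
    have := h2 (n + 1)
    rcases hr : t.right with _ | ⟨y, l⟩ <;> rw [hr] at this <;> simp at this ⊢ <;>
      rw [this] <;> ring_nf
  have h3s : ∀ n : ℕ, t.left.tail.getD n none = a.cells (a.pos - (n + 2)) := fun n => by
    have := h3 (n + 1)
    rcases hr : t.left with _ | ⟨y, l⟩ <;> rw [hr] at this <;> simp at this ⊢ <;>
      rw [this] <;> ring_nf
  rcases x with ⟨x, _ | _ | _⟩
  · simp only [ATape.act, Dir.shift] at hb
    constructor <;> simp only [TMTape.act, TMTape.move, ATape.act, ATape.read, Dir.shift]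
    · rw [key _ (by omega), List.headD_eq_getD, h30]; simp [sub_eq_add_neg]
    · rintro (_ | n)
      · simp
      · rw [key _ (by push_cast; omega), List.getD_cons_succ, h2]; congr 1; push_cast; ring
    · intro n
      rw [key _ (by omega), h3s]; congr 1; ring
    all_goals simp; omega
  · simp only [ATape.act, Dir.shift] at hb
    constructor <;> simp only [TMTape.act, TMTape.move, ATape.act, ATape.read, Dir.shift, add_zero]
    · simp
    · intro n; rw [key _ (by omega), h2]
    · intro n; rw [key _ (by omega), h3]
    all_goals omega
  · simp only [ATape.act, Dir.shift] at hb
    constructor <;> simp only [TMTape.act, TMTape.move, ATape.act, ATape.read, Dir.shift]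
    · rw [key _ (by omega), List.headD_eq_getD, h20]; simp
    · intro n
      rw [key _ (by omega), h2s]; congr 1; ring
    · rintro (_ | n)
      · simp
      · rw [key _ (by push_cast; omega), List.getD_cons_succ, h3]; congr 1; push_cast; ring
    all_goals simp; omega

theorem ofWord (w : Word) {b : ℕ} (hb : w.length ≤ b) :
    TapeRep b (TMTape.ofWord w) (ATape.ofWord w) := by
  constructor <;> simp only [TMTape.ofWord, ATape.ofWord, ATape.read]
  · rw [List.head?_eq_getElem?]; exact (ATape.wordCells_zero w 0).symm
  · intro n
    have := ATape.wordCells_zero w (n + 1)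
    push_cast at this
    rw [zero_add, this]
    cases w with
    | nil => simp
    | cons x w => rw [List.getD_eq_getElem?_getD]; simp; cases w[n]? <;> rfl
  · intro n
    rw [ATape.wordCells_of_lt _ (by omega)]; simp
  all_goals simp
  all_goals omega

theorem hasWord {b : ℕ} {t : TMTape} {a : ATape} (h : TapeRep b t a) : a.HasWord t.word := by
  have key : ∀ (l : List TapeSym) (g : ℕ → TapeSym), (∀ n, l.getD n none = g n) →
      ∀ i : ℕ, i ≤ (l.takeWhile Option.isSome).reduceOption.length →
        g i = (l.takeWhile Option.isSome).reduceOption[i]? := by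
    intro l
    induction l with
    | nil => intro g hg i _; rw [← hg]; simp
    | cons x l ih =>
      intro g hg i hi
      cases x with
      | none =>
        simp at hi; subst hi; rw [← hg]; simp
      | some x =>
        rcases i with _ | i
        · rw [← hg]; simp
        · have := ih (fun n => g (n + 1)) (fun n => by rw [← hg]; simp) i (by simpa using hi)
          rw [this]; simp
  intro i hi
  refine key (t.head :: t.right) (fun n => a.cells (a.pos + n)) ?_ i hi
  rintro (_ | n)
  · simpa [ATape.read] using h.head
  · simpa using h.right n

theorem word_eq_iff {b : ℕ} {t : TMTape} {a : ATape} (h : TapeRep b t a) {w : Word} :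
    t.word = w ↔ a.HasWord w :=
  ⟨fun e => e ▸ h.hasWord, fun hw => h.hasWord.unique hw⟩

end TapeRep

namespace ATape

theorem HasWord.cons {t : ATape} {w : Word} (h : t.HasWord w) (b : Bool) :
    (⟨t.pos - 1, Function.update t.cells (t.pos - 1) (some b)⟩ : ATape).HasWord (b :: w) := by
  rintro (_ | i) hi
  · simp
  · have : t.pos - 1 + ((i + 1 : ℕ) : ℤ) = t.pos + i := by push_cast; ring
    simp only [this]
    rw [Function.update_of_ne (by omega), h i (by simpa using hi)]
    simp

end ATape

/-! ## Bounded computations of machines -/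

namespace OracleTM

variable {M : OracleTM} {O : Language Bool}

/-- All computations from `c` have at most `n` steps, and record at most `B` cells of each tape. -/
def Bounded (M : OracleTM) (O : Language Bool) (c : M.Cfg) (n B : ℕ) : Prop :=
  ∀ m d, M.StepsIn O m c d → m ≤ n ∧ ∀ i, (d.tape i).size ≤ B

theorem StepsIn.head {c d e : M.Cfg} {m : ℕ} (h : M.Step O c d) (h' : M.StepsIn O m d e) :
    M.StepsIn O (m + 1) c e := by
  induction h' with
  | zero => exact .succ 0 c c _ (.zero c) h
  | succ n d d' e _ hs ih => exact .succ _ _ _ _ (ih h) hs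

theorem StepsIn.cases_head {c e : M.Cfg} {m : ℕ} (h : M.StepsIn O m c e) :
    (m = 0 ∧ c = e) ∨ ∃ d k, m = k + 1 ∧ M.Step O c d ∧ M.StepsIn O k d e := by
  induction h with
  | zero c => exact .inl ⟨rfl, rfl⟩
  | succ n c d e _ hs ih =>
    right
    rcases ih with ⟨rfl, rfl⟩ | ⟨d', k, rfl, h1, h2⟩
    · exact ⟨e, 0, rfl, hs, .zero e⟩
    · exact ⟨d', k + 1, rfl, h1, .succ _ _ _ _ h2 hs⟩

theorem StepsIn.eq_of_halted {c e : M.Cfg} {m : ℕ} (h : M.StepsIn O m c e) (hc : M.Halted O c) :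
    m = 0 ∧ c = e := by
  rcases h.cases_head with h | ⟨d, k, -, hs, -⟩
  · exact h
  · exact absurd hs (hc d)

theorem Bounded.step {c d : M.Cfg} {n B : ℕ} (h : M.Bounded O c (n + 1) B) (hs : M.Step O c d) :
    M.Bounded O d n B := fun m e he => by
  obtain ⟨h1, h2⟩ := h (m + 1) e (he.head hs)
  exact ⟨by omega, h2⟩

theorem Bounded.halted {c : M.Cfg} {B : ℕ} (h : M.Bounded O c 0 B) : M.Halted O c := fun d hs => by
  have := (h 1 d (.succ 0 c c d (.zero c) hs)).1
  omega

theorem Bounded.exists_halted {n B : ℕ} : ∀ {c : M.Cfg}, M.Bounded O c n B →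
    ∃ m d, M.StepsIn O m c d ∧ M.Halted O d := by
  induction n with
  | zero => exact fun {c} h => ⟨0, c, .zero c, h.halted⟩
  | succ n ih =>
    intro c h
    by_cases hc : M.Halted O c
    · exact ⟨0, c, .zero c, hc⟩
    · simp only [Halted, not_forall, not_not] at hc
      obtain ⟨d, hd⟩ := hc
      obtain ⟨m, e, h1, h2⟩ := ih (h.step hd)
      exact ⟨m + 1, e, h1.head hd, h2⟩

theorem Deterministic.step_unique (hM : M.Deterministic) {c d e : M.Cfg} (hd : M.Step O c d)
    (he : M.Step O c e) : d = e := by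
  cases hd with
  | move q q' τ a h1 h2 =>
    cases he with
    | move _ q'' _ a' h3 h4 =>
      have := hM _ _ h2 h4
      cases this; rfl
    | yes _ _ _ _ h3 => rw [h1] at h3; cases h3
    | no _ _ _ _ h3 => rw [h1] at h3; cases h3
  | yes q q₁ q₀ τ h1 h2 =>
    cases he with
    | move _ q'' _ a' h3 h4 => rw [h1] at h3; cases h3
    | yes _ _ _ _ h3 => rw [h1] at h3; cases h3; rfl
    | no _ _ _ _ h3 h4 => exact absurd h2 h4
  | no q q₁ q₀ τ h1 h2 =>
    cases he with
    | move _ q'' _ a' h3 h4 => rw [h1] at h3; cases h3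
    | no _ _ _ _ h3 => rw [h1] at h3; cases h3; rfl
    | yes _ _ _ _ h3 h4 => exact absurd h4 h2

/-- Determinism makes any two computations from one configuration comparable, so none outlasts a
halting one. For polynomial space, where only halting is given, this supplies a time bound for each
input. -/
theorem Deterministic.steps_le (hM : M.Deterministic) {c d e : M.Cfg} {m n : ℕ}
    (hd : M.StepsIn O m c d) (hh : M.Halted O d) (he : M.StepsIn O n c e) :
    n ≤ m ∧ (M.Halted O e → e = d) := by
  induction m generalizing c n with
  | zero =>
    rcases hd.cases_head with ⟨-, rfl⟩ | ⟨_, _, h, _⟩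
    · obtain ⟨rfl, rfl⟩ := he.eq_of_halted hh
      exact ⟨le_rfl, fun _ => rfl⟩
    · omega
  | succ m ih =>
    rcases hd.cases_head with ⟨h, -⟩ | ⟨c₁, k, h, h1, h2⟩
    · omega
    · obtain rfl : m = k := by omega
      rcases he.cases_head with ⟨rfl, rfl⟩ | ⟨c₂, l, rfl, h3, h4⟩
      · exact ⟨by omega, fun hc => absurd h1 (hc _)⟩
      · obtain rfl := hM.step_unique h1 h3
        obtain ⟨h5, h6⟩ := ih h2 h4
        exact ⟨by omega, h6⟩

end OracleTM
end

noncomputable section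
open scoped Classical

/-! ## Components as machines -/

namespace Comp

variable {K E E' : Type} {O : Language Bool} {qT : K} {B : ℕ∞}

/-- The state of a machine that stands for a state of a component or its exit. -/
def toState (C : Comp K Unit) : C.Q ⊕ Unit → Option C.Q := Sum.elim some fun _ => none

/-- The machine that runs a component; it accepts at the exit. -/
def toTM [Fintype K] (C : Comp K Unit) (inT outT qT : K) : OracleTM where
  Q := Option C.Q
  K := K
  inTape := inT
  outTape := outT
  queryTape := qT
  start := some C.start
  accept := none
  query q := q.bind fun q => (C.query q).map (Prod.map C.toState C.toState)
  δ q s := {z | ∃ p, q = some p ∧ z ∈ Prod.map C.toState id '' C.δ p s}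

theorem toTM_deterministic [Fintype K] {C : Comp K Unit} (h : C.Det) (inT outT qT : K) :
    (C.toTM inT outT qT).Deterministic := by
  rintro q s z ⟨p, rfl, hz⟩ z' ⟨p', h', hz'⟩
  cases h'
  exact (h p s).image _ hz hz'

theorem toTM_oracleFree [Fintype K] {C : Comp K Unit} (h : C.Free) (inT outT qT : K) :
    (C.toTM inT outT qT).OracleFree := by
  rintro (_ | q)
  · rfl
  · simp [toTM, h q]

theorem toTM_halted [Fintype K] (C : Comp K Unit) (inT outT qT : K) (σ : K → TMTape) :
    (C.toTM inT outT qT).Halted O ⟨none, σ⟩ := by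
  intro d h
  cases h with
  | move _ _ _ a _ h => obtain ⟨p, h, -⟩ := h; cases h
  | yes _ _ _ _ h => cases h
  | no _ _ _ _ h => cases h

theorem exists_mem_iff_word_mem {b : ℕ} {t : TMTape} {a : ATape} (h : TapeRep b t a) :
    (∃ w ∈ O, a.HasWord w) ↔ t.word ∈ O :=
  ⟨fun ⟨_, h1, h2⟩ => (h.hasWord.unique h2) ▸ h1, fun h1 => ⟨_, h1, h.hasWord⟩⟩

theorem toTM_step [Fintype K] {C : Comp K Unit} {inT outT : K} {b : ℕ} {q : C.Q}
    {σ : K → TMTape} {τ : K → ATape} (hσ : ∀ k, TapeRep b (σ k) (τ k)) {r τ'}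
    (h : C.Step O qT q τ r τ') (hf : Fits b τ') : ∃ σ' : K → TMTape,
      (C.toTM inT outT qT).Step O ⟨some q, σ⟩ ⟨C.toState r, σ'⟩ ∧ ∀ k, TapeRep b (σ' k) (τ' k) := by
  cases h with
  | move _ a h1 h2 =>
    refine ⟨fun k => (σ k).act (a k), .move (M := C.toTM inT outT qT) (some q) _ σ a ?_ ?_,
      fun k => (hσ k).act _ (by exact_mod_cast hf k)⟩
    · simp [toTM, h1]
    · refine ⟨q, rfl, (r, a), ?_, rfl⟩
      have e : (fun k => (σ k).head) = fun k => (τ k).read := funext fun k => (hσ k).head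
      exact e ▸ h2
  | yes _ r₀ h1 h2 =>
    exact ⟨σ, .yes (M := C.toTM inT outT qT) (some q) _ (C.toState r₀) σ (by simp [toTM, h1])
      ((exists_mem_iff_word_mem (hσ qT)).1 h2), hσ⟩
  | no r₁ _ h1 h2 =>
    exact ⟨σ, .no (M := C.toTM inT outT qT) (some q) (C.toState r₁) _ σ (by simp [toTM, h1])
      (mt (exists_mem_iff_word_mem (hσ qT)).2 h2), hσ⟩

theorem step_of_toTM_step [Fintype K] {C : Comp K Unit} {inT outT : K} {b : ℕ} {q : C.Q}
    {σ : K → TMTape} {τ : K → ATape} (hσ : ∀ k, TapeRep b (σ k) (τ k))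
    (hf : ∀ r τ', C.Step O qT q τ r τ' → Fits b τ') {d}
    (h : (C.toTM inT outT qT).Step O ⟨some q, σ⟩ d) : ∃ r τ', C.Step O qT q τ r τ' ∧
      d.state = C.toState r ∧ ∀ k, TapeRep b (d.tape k) (τ' k) := by
  cases h with
  | move _ q' _ a h1 h2 =>
    obtain ⟨p, hp, ⟨r, a⟩, h3, h4⟩ := h2
    cases hp
    cases h4
    have e : (fun k => (σ k).head) = fun k => (τ k).read := funext fun k => (hσ k).head
    have hs : C.Step O qT q τ r _ := .move r a (by simpa [toTM] using h1) (e ▸ h3)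
    exact ⟨r, _, hs, rfl, fun k => (hσ k).act _ (by exact_mod_cast hf _ _ hs k)⟩
  | yes _ r₁ r₀ _ h1 h2 =>
    simp only [toTM, Option.bind_some, Option.map_eq_some_iff, Prod.exists, Prod.map_apply] at h1
    obtain ⟨s₁, s₀, h3, rfl, rfl⟩ := h1
    exact ⟨s₁, τ, .yes s₁ s₀ h3 ((exists_mem_iff_word_mem (hσ qT)).2 h2), rfl, hσ⟩
  | no _ r₁ r₀ _ h1 h2 =>
    simp only [toTM, Option.bind_some, Option.map_eq_some_iff, Prod.exists, Prod.map_apply] at h1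
    obtain ⟨s₁, s₀, h3, rfl, rfl⟩ := h1
    exact ⟨s₀, τ, .no s₁ s₀ h3 (mt (exists_mem_iff_word_mem (hσ qT)).1 h2), rfl, hσ⟩

/-- Steps of the component and of the machine correspond through `TapeRep b`, so induction on the
run transfers termination and both inclusions between the outcomes and the reachable exits. The exit
becomes the state `none`, which has no successor; reaching it is therefore acceptance. -/
theorem Run.toTM [Fintype K] {C : Comp K Unit} {inT outT : K} {b : ℕ} {r τ n S}
    (h : C.Run O qT b r τ n S) : ∀ σ : K → TMTape, (∀ k, TapeRep b (σ k) (τ k)) →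
      (C.toTM inT outT qT).Bounded O ⟨C.toState r, σ⟩ n (2 * b + 1) ∧
      (∀ z ∈ S, ∃ m, ∃ σ' : K → TMTape, (C.toTM inT outT qT).StepsIn O m ⟨C.toState r, σ⟩ ⟨none, σ'⟩ ∧
        ∀ k, TapeRep b (σ' k) (z.2 k)) ∧
      (∀ m, ∀ σ' : K → TMTape, (C.toTM inT outT qT).StepsIn O m ⟨C.toState r, σ⟩ ⟨none, σ'⟩ →
        ∃ z ∈ S, ∀ k, TapeRep b (σ' k) (z.2 k)) := by
  induction h with
  | exit e τ n hf =>
    intro σ hσ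
    refine ⟨?_, ?_, ?_⟩
    · intro m d hd
      obtain ⟨rfl, rfl⟩ := hd.eq_of_halted (toTM_halted C inT outT qT σ)
      exact ⟨Nat.zero_le _, fun k => (hσ k).size_le⟩
    · rintro z rfl
      exact ⟨0, σ, .zero _, hσ⟩
    · intro m σ' hd
      obtain ⟨rfl, h⟩ := hd.eq_of_halted (toTM_halted C inT outT qT σ)
      cases h
      exact ⟨_, rfl, hσ⟩
  | step q τ n F S hf hr hS ih =>
    intro σ hσ
    have hfit : ∀ r τ', C.Step O qT q τ r τ' → Fits b τ' := fun r τ' hs => (hr r τ' hs).fits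
    refine ⟨?_, ?_, ?_⟩
    · intro m d hd
      rcases hd.cases_head with ⟨rfl, rfl⟩ | ⟨⟨s, σ'⟩, k, rfl, h1, h2⟩
      · exact ⟨Nat.zero_le _, fun k => (hσ k).size_le⟩
      · obtain ⟨r, τ', hs, rfl, h3⟩ := step_of_toTM_step hσ hfit h1
        obtain ⟨h4, h5⟩ := (ih r τ' hs σ' h3).1 k d h2
        exact ⟨by omega, h5⟩
    · intro z hz
      obtain ⟨r, τ', hs, hz⟩ := (hS z).1 hz
      obtain ⟨σ', h1, h2⟩ := toTM_step (inT := inT) (outT := outT) hσ hs (hfit _ _ hs)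
      obtain ⟨m, σ'', h3, h4⟩ := (ih r τ' hs σ' h2).2.1 z hz
      exact ⟨m + 1, σ'', h3.head h1, h4⟩
    · intro m σ' hd
      rcases hd.cases_head with ⟨rfl, h⟩ | ⟨⟨s, σ₁⟩, k, rfl, h1, h2⟩
      · cases h
      · obtain ⟨r, τ', hs, rfl, h3⟩ := step_of_toTM_step hσ hfit h1
        obtain ⟨z, hz, h4⟩ := (ih r τ' hs σ₁ h3).2.2 k σ' h2
        exact ⟨z, (hS z).2 ⟨r, τ', hs, hz⟩, h4⟩

/-- The initial tapes. -/
def initTapes (inT : K) (x : Word) (k : K) : ATape := if k = inT then .ofWord x else .blank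

theorem rep_init {M : OracleTM} (x : Word) {b : ℕ} (hb : x.length ≤ b) (k : M.K) :
    TapeRep b ((M.init x).tape k) (initTapes M.inTape x k) := by
  simp only [OracleTM.init, initTapes]
  split
  · exact .ofWord x hb
  · rw [← ATape.ofWord_nil]; exact .ofWord [] (Nat.zero_le _)

/-- The acceptance behaviour of the machine of a component. -/
theorem Spec.toTM [Fintype K] {C : Comp K Unit} {inT outT : K} {b : ℕ} {x : Word} {n S}
    (h : C.Spec O qT b (initTapes inT x) n S) (hb : x.length ≤ b) :
    (C.toTM inT outT qT).Bounded O ((C.toTM inT outT qT).init x) n (2 * b + 1) ∧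
    ((∃ c, (C.toTM inT outT qT).AcceptsWith O x c) ↔ S.Nonempty) ∧
    ∀ y, (∃ c, (C.toTM inT outT qT).AcceptsWith O x c ∧ (c.tape outT).word = y) ↔
      ∃ z ∈ S, (z.2 outT).HasWord y := by
  obtain ⟨h1, h2, h3⟩ := Run.toTM (inT := inT) (outT := outT) h _
    (rep_init (M := C.toTM inT outT qT) x hb)
  refine ⟨h1, ⟨?_, ?_⟩, fun y => ⟨?_, ?_⟩⟩
  · rintro ⟨⟨s, σ⟩, ⟨m, h4⟩, -, rfl⟩
    obtain ⟨z, hz, -⟩ := h3 m σ h4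
    exact ⟨z, hz⟩
  · rintro ⟨z, hz⟩
    obtain ⟨m, σ, h4, -⟩ := h2 z hz
    exact ⟨_, ⟨m, h4⟩, toTM_halted C inT outT qT σ, rfl⟩
  · rintro ⟨⟨s, σ⟩, ⟨⟨m, h4⟩, -, rfl⟩, h5⟩
    obtain ⟨z, hz, h6⟩ := h3 m σ h4
    exact ⟨z, hz, (h6 outT).word_eq_iff.1 h5⟩
  · rintro ⟨z, hz, h5⟩
    obtain ⟨m, σ, h4, h6⟩ := h2 z hz
    exact ⟨_, ⟨⟨m, h4⟩, toTM_halted C inT outT qT σ, rfl⟩, (h6 outT).word_eq_iff.2 h5⟩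

/-! ### Moves of one or two tapes -/

/-- A move that reads and changes a single tape. -/
def one (k : K) (g : TapeSym → E × (TapeSym × Dir)) : Comp K E :=
  act fun s => ((g (s k)).1, Function.update (fun j => (s j, .stay)) k (g (s k)).2)

@[simp] theorem one_det (k : K) (g : TapeSym → E × (TapeSym × Dir)) : (one k g).Det := act_det _
@[simp] theorem one_free (k : K) (g : TapeSym → E × (TapeSym × Dir)) : (one k g).Free := act_free _

theorem spec_one {k : K} {g : TapeSym → E × (TapeSym × Dir)} {τ : K → ATape} {e : E} {t : ATape}
    (h0 : Fits B τ) (h1 : Fits B (Function.update τ k t)) (he : (g (τ k).read).1 = e)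
    (ht : (τ k).act (g (τ k).read).2 = t) :
    (one k g).Spec O qT B τ 1 {(e, Function.update τ k t)} := by
  refine spec_act h0 h1 he fun j => ?_
  by_cases hj : j = k
  · subst hj; simpa using ht
  · simp [hj]

/-- A move that reads and changes two tapes. -/
def two (a b : K) (g : TapeSym → TapeSym → E × (TapeSym × Dir) × (TapeSym × Dir)) : Comp K E :=
  act fun s => ((g (s a) (s b)).1,
    Function.update (Function.update (fun j => (s j, .stay)) a (g (s a) (s b)).2.1) b
      (g (s a) (s b)).2.2)

@[simp] theorem two_det (a b : K) (g : TapeSym → TapeSym → E × (TapeSym × Dir) × (TapeSym × Dir)) :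
    (two a b g).Det := act_det _
@[simp] theorem two_free (a b : K) (g : TapeSym → TapeSym → E × (TapeSym × Dir) × (TapeSym × Dir)) :
    (two a b g).Free := act_free _

theorem spec_two {a b : K} {g : TapeSym → TapeSym → E × (TapeSym × Dir) × (TapeSym × Dir)}
    {τ : K → ATape} {e : E} {s t : ATape} (hab : a ≠ b)
    (h0 : Fits B τ) (h1 : Fits B (Function.update (Function.update τ a s) b t))
    (he : (g (τ a).read (τ b).read).1 = e)
    (hs : (τ a).act (g (τ a).read (τ b).read).2.1 = s)
    (ht : (τ b).act (g (τ a).read (τ b).read).2.2 = t) :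
    (two a b g).Spec O qT B τ 1 {(e, Function.update (Function.update τ a s) b t)} := by
  refine spec_act h0 h1 he fun j => ?_
  by_cases hb : j = b
  · subst hb; simpa using ht
  · by_cases ha : j = a
    · subst ha; simpa [hab] using hs
    · simp [ha, hb]

end Comp

/-! ## Machines as components -/

namespace OracleTM

variable (M : OracleTM) (b : Bool)

/-- One step of `M`, where `b` is put in front of each query. -/
def stepComp (q : M.Q) : Comp M.K (M.Q ⊕ Bool) :=
  match M.query q with
  | some (q₁, q₀) =>
    (Comp.one M.queryTape fun s => ((), s, .left)).bind fun _ =>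
    (Comp.one M.queryTape fun s => (s, some b, .stay)).bind fun s =>
    Comp.ask.bind fun r =>
    Comp.one M.queryTape fun _ => (Sum.inl (if r then q₁ else q₀), s, .right)
  | none => Comp.choose fun s => {z | (∃ q' a, (q', a) ∈ M.δ q s ∧ z = (Sum.inl q', a)) ∨
      (M.δ q s = ∅ ∧ z = (Sum.inr (decide (q = M.accept)), fun k => (s k, .stay)))}

/-- The component that runs `M` and returns whether `M` accepts. -/
def toComp : Comp M.K Bool := Comp.iter (M.stepComp b) M.start

variable {M b}

theorem toComp_det (h : M.Deterministic) : (M.toComp b).Det := by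
  refine Comp.iter_det fun q => ?_
  unfold stepComp
  split
  · exact Comp.bind_det (by simp) fun _ => Comp.bind_det (by simp) fun _ =>
      Comp.bind_det (by simp) fun _ => by simp
  · refine Comp.choose_det fun s => ?_
    rintro z (⟨q', a, h1, rfl⟩ | ⟨h1, rfl⟩) z' (⟨q'', a', h2, rfl⟩ | ⟨h2, rfl⟩)
    · have := h q s h1 h2
      cases this; rfl
    · rw [h2] at h1; cases h1
    · rw [h1] at h2; cases h2
    · rfl

theorem toComp_free (h : M.OracleFree) : (M.toComp b).Free := by
  refine Comp.iter_free fun q => ?_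
  unfold stepComp
  rw [h q]
  simp

/-- The cell to the left of the query word is lent to the letter `b`: its symbol is kept in the
finite control and written back after the answer, so the tapes end up unchanged. The letter allows
one oracle to serve several simulated machines. The excursion by one cell is covered by `natAbs_lt`.
-/
theorem spec_stepComp_query {O' : Language Bool} {O : Language Bool}
    (hO : ∀ x, b :: x ∈ O' ↔ x ∈ O) {B B' : ℕ} {q q₁ q₀ : M.Q} {σ : M.K → TMTape} {τ : M.K → ATape}
    (hσ : ∀ k, TapeRep B' (σ k) (τ k)) (hB : ∀ k, (σ k).size ≤ B) (h : M.query q = some (q₁, q₀)) :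
    (M.stepComp b q).Spec O' M.queryTape B τ 4
      {(.inl (if (σ M.queryTape).word ∈ O then q₁ else q₀), τ)} := by
  have hf : ∀ k, (τ k).pos.natAbs + 1 ≤ B := fun k => (hσ k).natAbs_lt (hB k)
  have hfu : ∀ c, Fits B (Function.update τ M.queryTape ⟨(τ M.queryTape).pos - 1, c⟩) := by
    intro c k
    by_cases hk : k = M.queryTape
    · subst hk
      have := hf M.queryTape
      simp only [Function.update_self]
      exact_mod_cast (show ((τ M.queryTape).pos - 1).natAbs ≤ B by omega)
    · have := hf k
      simp only [Function.update_of_ne hk]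
      exact_mod_cast (show (τ k).pos.natAbs ≤ B by omega)
  have hf0 : Fits B τ := fun k => by
    have := hf k
    exact_mod_cast (show (τ k).pos.natAbs ≤ B by omega)
  set t := τ M.queryTape with ht
  have hw := (hσ M.queryTape).hasWord
  rw [← ht] at hw
  unfold stepComp
  rw [h]
  refine Comp.spec_bind_single (n := 1) (m := 3) (e := ())
    (τ' := Function.update τ M.queryTape ⟨t.pos - 1, t.cells⟩)
    (Comp.spec_one hf0 (hfu _) rfl ?_) ?_
  · rw [← ht]; simp [ATape.act, Dir.shift, ATape.read, sub_eq_add_neg]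
  refine Comp.spec_bind_single (n := 1) (m := 2) (e := t.cells (t.pos - 1))
    (τ' := Function.update τ M.queryTape ⟨t.pos - 1, Function.update t.cells (t.pos - 1) (some b)⟩)
    ((Comp.spec_one (t := ⟨t.pos - 1, Function.update t.cells (t.pos - 1) (some b)⟩)
      (e := t.cells (t.pos - 1)) (hfu _) (by simpa using hfu _) ?_ ?_).congr (by simp)) ?_
  · simp [ATape.read]
  · simp [ATape.act, Dir.shift]
  refine Comp.spec_bind_single (n := 1) (m := 1) (e := decide ((σ M.queryTape).word ∈ O))
    (Comp.spec_ask (hfu _) ?_) ?_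
  · simp only [Function.update_self, decide_eq_true_eq]
    rw [← hO]
    refine ⟨fun h => ⟨_, h, hw.cons b⟩, ?_⟩
    rintro ⟨w, h1, h2⟩
    rwa [← h2.unique (hw.cons b)]
  · refine (Comp.spec_one (t := t) (hfu _) (by simpa [ht] using hf0) rfl ?_).congr ?_
    · simp [ATape.act, Dir.shift]
    · simp [ht]

end OracleTM
end

/-! ### Correctness of the simulation of a machine by a component -/

noncomputable section
open scoped Classical

namespace Comp

/-- Determinism gives at most one outcome. -/
theorem Run.subsingleton {K E : Type} {O : Language Bool} {qT : K} {B : ℕ∞} {C : Comp K E} (hC : C.Det) {r τ n S} (h : C.Run O qT B r τ n S) :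
    S.Subsingleton := by
  induction h with
  | exit e τ n hf => exact Set.subsingleton_singleton
  | step q τ n F S hf hr hS ih =>
    intro z hz z' hz'
    obtain ⟨r, τ', h1, h2⟩ := (hS z).1 hz
    obtain ⟨r', τ'', h3, h4⟩ := (hS z').1 hz'
    have : r = r' ∧ τ' = τ'' := by
      cases h1 with
      | move _ a h5 h6 =>
        cases h3 with
        | move _ a' h7 h8 => cases hC _ _ h6 h8; exact ⟨rfl, rfl⟩
        | yes _ _ h7 => rw [h5] at h7; cases h7
        | no _ _ h7 => rw [h5] at h7; cases h7
      | yes _ _ h5 h6 =>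
        cases h3 with
        | move _ a' h7 h8 => rw [h5] at h7; cases h7
        | yes _ _ h7 => rw [h5] at h7; cases h7; exact ⟨rfl, rfl⟩
        | no _ _ h7 h8 => exact absurd h6 h8
      | no _ _ h5 h6 =>
        cases h3 with
        | move _ a' h7 h8 => rw [h5] at h7; cases h7
        | yes _ _ h7 h8 => exact absurd h8 h6
        | no _ _ h7 => rw [h5] at h7; cases h7; exact ⟨rfl, rfl⟩
    obtain ⟨rfl, rfl⟩ := this
    exact ih r τ' h1 h2 h4

end Comp

namespace OracleTM

variable {M : OracleTM} {b : Bool}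

theorem halted_iff {O : Language Bool} {q : M.Q} {σ : M.K → TMTape} :
    M.Halted O ⟨q, σ⟩ ↔ M.query q = none ∧ M.δ q (fun k => (σ k).head) = ∅ := by
  constructor
  · intro h
    have hq : M.query q = none := by
      rcases hq : M.query q with _ | ⟨q₁, q₀⟩
      · rfl
      · by_cases ho : (σ M.queryTape).word ∈ O
        · exact absurd (.yes q q₁ q₀ σ hq ho) (h _)
        · exact absurd (.no q q₁ q₀ σ hq ho) (h _)
    refine ⟨hq, Set.eq_empty_iff_forall_notMem.2 ?_⟩
    rintro ⟨q', a⟩ ha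
    exact h _ (.move q q' σ a hq ha)
  · rintro ⟨h1, h2⟩ d hd
    cases hd with
    | move _ q' _ a _ h => rw [h2] at h; exact h
    | yes _ _ _ _ h => rw [h1] at h; cases h
    | no _ _ _ _ h => rw [h1] at h; cases h

theorem spec_stepComp_halted {O' O : Language Bool} {B : ℕ∞} {q : M.Q} {σ : M.K → TMTape}
    {τ : M.K → ATape} {b' : ℕ} (hσ : ∀ k, TapeRep b' (σ k) (τ k)) (hf : Fits B τ)
    (h : M.Halted O ⟨q, σ⟩) : (M.stepComp b q).Spec O' M.queryTape B τ 1
      {(.inr (decide (q = M.accept)), τ)} := by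
  obtain ⟨h1, h2⟩ := halted_iff.1 h
  have e : (fun k => (σ k).head) = fun k => (τ k).read := funext fun k => (hσ k).head
  rw [e] at h2
  unfold stepComp
  rw [h1]
  refine (Comp.spec_choose hf ?_).congr ?_
  · rintro z (⟨q', a, h3, rfl⟩ | ⟨h3, rfl⟩)
    · rw [h2] at h3; cases h3
    · simpa using hf
  · ext z
    simp only [h2]
    constructor
    · rintro ⟨z, ⟨q', a, h3, rfl⟩ | ⟨h3, rfl⟩, rfl⟩
      · cases h3
      · simp
    · rintro rfl
      exact ⟨_, .inr ⟨trivial, rfl⟩, by simp⟩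

/-- The bound on the recorded cells keeps every next head position within `B`. Both directions of
the correspondence of steps are recorded, as nondeterminism requires; the time 4 is that of a query.
-/
theorem spec_stepComp {O' O : Language Bool} (hO : ∀ x, b :: x ∈ O' ↔ x ∈ O) {B : ℕ} {q : M.Q}
    {σ : M.K → TMTape} {τ : M.K → ATape} (hσ : ∀ k, TapeRep B (σ k) (τ k))
    (hB : ∀ k, (σ k).size ≤ B) (h : ¬ M.Halted O ⟨q, σ⟩) : ∃ T,
      (M.stepComp b q).Spec O' M.queryTape B τ 4 T ∧
      (∀ z ∈ T, ∃ q' σ', z.1 = .inl q' ∧ M.Step O ⟨q, σ⟩ ⟨q', σ'⟩ ∧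
        ∀ k, TapeRep B (σ' k) (z.2 k)) ∧
      (∀ q' σ', M.Step O ⟨q, σ⟩ ⟨q', σ'⟩ →
        ∃ τ', (.inl q', τ') ∈ T ∧ ∀ k, TapeRep B (σ' k) (τ' k)) := by
  rcases hq : M.query q with _ | ⟨q₁, q₀⟩
  · have hne : M.δ q (fun k => (σ k).head) ≠ ∅ := fun h' => h (halted_iff.2 ⟨hq, h'⟩)
    have e : (fun k => (σ k).head) = fun k => (τ k).read := funext fun k => (hσ k).head
    have hf : ∀ k, (τ k).pos.natAbs + 1 ≤ B := fun k => (hσ k).natAbs_lt (hB k)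
    have hact : ∀ (a : M.K → TapeSym × Dir) k, ((τ k).act (a k)).pos.natAbs ≤ B := fun a k =>
      ((τ k).natAbs_act_pos_le (a k)).trans (hf k)
    have hT := Comp.spec_choose (O := O') (qT := M.queryTape) (B := B) (τ := τ)
      (f := fun s => {z | (∃ q' a, (q', a) ∈ M.δ q s ∧ z = (Sum.inl q', a)) ∨
        (M.δ q s = ∅ ∧ z = (Sum.inr (decide (q = M.accept)), fun k => (s k, .stay)))})
      (fun k => by exact_mod_cast (Nat.le_of_succ_le (hf k)))
      (fun z _ k => by exact_mod_cast hact z.2 k)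
    refine ⟨_, (by unfold stepComp; rw [hq]; exact hT.mono (by omega)), ?_, ?_⟩
    · rintro _ ⟨z, ⟨q', a, h3, rfl⟩ | ⟨h3, rfl⟩, rfl⟩
      · exact ⟨q', fun k => (σ k).act (a k), rfl, .move q q' σ a hq (e ▸ h3),
          fun k => (hσ k).act _ (hact a k)⟩
      · exact absurd (e ▸ h3) hne
    · intro q' σ' hs
      cases hs with
      | move _ _ _ a h1 h2 =>
        exact ⟨_, ⟨(.inl q', a), .inl ⟨q', a, e ▸ h2, rfl⟩, rfl⟩, fun k => (hσ k).act _ (hact a k)⟩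
      | yes _ _ _ _ h1 => rw [hq] at h1; cases h1
      | no _ _ _ _ h1 => rw [hq] at h1; cases h1
  · refine ⟨_, spec_stepComp_query hO hσ hB hq, ?_, ?_⟩
    · rintro _ rfl
      refine ⟨_, σ, rfl, ?_, hσ⟩
      split
      · exact .yes _ _ _ _ hq ‹_›
      · exact .no _ _ _ _ hq ‹_›
    · intro q' σ' hs
      cases hs with
      | move _ _ _ a h1 h2 => rw [hq] at h1; cases h1
      | yes _ _ _ _ h1 h2 => rw [hq] at h1; cases h1; exact ⟨τ, by simp [h2], hσ⟩
      | no _ _ _ _ h1 h2 => rw [hq] at h1; cases h1; exact ⟨τ, by simp [h2], hσ⟩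

/-- The simulation of `M` follows the computations of `M`. -/
theorem spec_iter_stepComp {O' O : Language Bool} (hO : ∀ x, b :: x ∈ O' ↔ x ∈ O) {B : ℕ} (n : ℕ) :
    ∀ (q : M.Q) (σ : M.K → TMTape) (τ : M.K → ATape), (∀ k, TapeRep B (σ k) (τ k)) →
      M.Bounded O ⟨q, σ⟩ n B → ∃ S,
        (Comp.iter (M.stepComp b) q).Spec O' M.queryTape B τ (4 * n + 1) S ∧
        (∀ z ∈ S, ∃ m d, M.StepsIn O m ⟨q, σ⟩ d ∧ M.Halted O d ∧ z.1 = decide (d.state = M.accept) ∧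
          ∀ k, TapeRep B (d.tape k) (z.2 k)) ∧
        (∀ m d, M.StepsIn O m ⟨q, σ⟩ d → M.Halted O d →
          ∃ z ∈ S, z.1 = decide (d.state = M.accept) ∧ ∀ k, TapeRep B (d.tape k) (z.2 k)) := by
  induction n with
  -- Both cases begin alike; for `n = 0` a bounded configuration has already halted, so the second
  -- branch is void there.
  | zero | succ n ih =>
    intro q σ τ hσ hb
    have hB : ∀ k, (σ k).size ≤ B := (hb 0 _ (.zero _)).2
    by_cases hh : M.Halted O ⟨q, σ⟩
    · have hf : Fits B τ := fun k => by
        exact_mod_cast (Nat.le_of_succ_le ((hσ k).natAbs_lt (hB k)))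
      refine ⟨{(decide (q = M.accept), τ)}, Comp.Run.mono ((Comp.spec_iter (G := fun _ _ => ∅)
        (m := 0) (spec_stepComp_halted hσ hf hh) ?_).congr ?_) (n := 1) (by omega), ?_, ?_⟩
      · rintro s' τ' h; cases h
      · ext ⟨z, τ⟩; simp
      · rintro _ rfl
        exact ⟨0, _, .zero _, hh, rfl, hσ⟩
      · intro m d hd _
        obtain ⟨rfl, rfl⟩ := hd.eq_of_halted hh
        exact ⟨_, rfl, rfl, hσ⟩
    · first
      | exact absurd hb.halted hh
      | obtain ⟨T, h1, h2, h3⟩ := spec_stepComp (b := b) hO hσ hB hh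
        -- `spec_iter` takes the outcomes as a function of the next state and tapes; pairs outside
        -- `T` receive the default value `∅`.
        have key : ∀ q' τ', ∃ S, (Sum.inl q', τ') ∈ T →
            (Comp.iter (M.stepComp b) q').Spec O' M.queryTape B τ' (4 * n + 1) S ∧
            (∀ z ∈ S, ∃ m d, M.StepsIn O m ⟨q, σ⟩ d ∧ M.Halted O d ∧
              z.1 = decide (d.state = M.accept) ∧ ∀ k, TapeRep B (d.tape k) (z.2 k)) := by
          intro q' τ'
          by_cases hT : (Sum.inl q', τ') ∈ T
          · obtain ⟨q'', σ', h4, h5, h6⟩ := h2 _ hT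
            cases h4
            obtain ⟨S, h7, h8, -⟩ := ih q' σ' τ' h6 (hb.step h5)
            refine ⟨S, fun _ => ⟨h7, fun z hz => ?_⟩⟩
            obtain ⟨m, d, h9, h10⟩ := h8 z hz
            exact ⟨m + 1, d, h9.head h5, h10⟩
          · exact ⟨∅, fun h => absurd h hT⟩
        choose G hG using key
        refine ⟨_, (Comp.spec_iter h1 (fun q' τ' h => (hG q' τ' h).1)).mono (by omega), ?_, ?_⟩
        · rintro ⟨e, τ'⟩ (hz | ⟨q', τ'', hT, hz⟩)
          · obtain ⟨_, _, h4, -⟩ := h2 _ hz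
            cases h4
          · exact (hG q' τ'' hT).2 _ hz
        · intro m d hd hdh
          rcases hd.cases_head with ⟨rfl, rfl⟩ | ⟨⟨q', σ'⟩, k, rfl, h4, h5⟩
          · exact absurd hdh hh
          · obtain ⟨τ', h6, h7⟩ := h3 q' σ' h4
            obtain ⟨S, h8, -, h9⟩ := ih q' σ' τ' h7 (hb.step h4)
            obtain ⟨z, hz, h10⟩ := h9 k d h5 hdh
            -- The absolute tapes determine the outcomes, so the set chosen for `(q', τ')` is the
            -- one obtained from this particular `σ'`.
            rw [h8.unique (hG q' τ' h6).1] at hz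
            exact ⟨z, .inr ⟨q', τ', h6, hz⟩, h10⟩

theorem _root_.TMTape.length_word_le (t : TMTape) : t.word.length ≤ t.size := by
  have h1 := List.reduceOption_length_le ((t.head :: t.right).takeWhile Option.isSome)
  have h2 := (List.takeWhile_prefix (p := Option.isSome) (l := t.head :: t.right)).length_le
  simp only [TMTape.word, TMTape.size, List.length_cons] at *
  omega

/-- The simulation of `M` on the input `x`. -/
theorem spec_toComp {O' O : Language Bool} (hO : ∀ x, b :: x ∈ O' ↔ x ∈ O) {B n : ℕ} {x : Word}
    (hb : M.Bounded O (M.init x) n B) (hx : x.length ≤ B) : ∃ S,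
      (M.toComp b).Spec O' M.queryTape B (Comp.initTapes M.inTape x) (4 * n + 1) S ∧
      (∀ z ∈ S, (∀ k i, B < Int.natAbs i → (z.2 k).cells i = none) ∧
        (z.1 = true → ∃ c, M.AcceptsWith O x c ∧
          ∀ k, (z.2 k).HasWord (c.tape k).word ∧ (c.tape k).word.length ≤ B)) ∧
      (∀ c, M.AcceptsWith O x c → ∃ z ∈ S, z.1 = true ∧ ∀ k, (z.2 k).HasWord (c.tape k).word) ∧
      S.Nonempty ∧ (M.Deterministic → S.Subsingleton) := by
  obtain ⟨S, h1, h2, h3⟩ := spec_iter_stepComp hO n M.start _ _ (Comp.rep_init x hx) hb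
  refine ⟨S, h1, ?_, ?_, ?_, fun h => h1.subsingleton (toComp_det h)⟩
  · intro z hz
    obtain ⟨m, d, h4, h5, h6, h7⟩ := h2 z hz
    have hs := (hb m d h4).2
    refine ⟨fun k i hi => (h7 k).cells_eq_none (hs k) hi, fun h => ⟨d, ⟨⟨m, h4⟩, h5, ?_⟩,
      fun k => ⟨(h7 k).hasWord, (TMTape.length_word_le _).trans (hs k)⟩⟩⟩
    rw [h6] at h
    exact of_decide_eq_true h
  · rintro c ⟨⟨m, h4⟩, h5, h6⟩
    obtain ⟨z, hz, h7, h8⟩ := h3 m c h4 h5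
    exact ⟨z, hz, by simp [h7, h6], fun k => (h8 k).hasWord⟩
  · obtain ⟨m, d, h4, h5⟩ := hb.exists_halted
    obtain ⟨z, hz, -⟩ := h3 m d h4 h5
    exact ⟨z, hz⟩

end OracleTM

namespace Comp

variable {K K' E : Type} {O : Language Bool} {qT : K} {B : ℕ∞}

/-! ### Components on more tapes -/

/-- Which tape of a component a tape stands for: `(k, true)` for the tape `k` itself, `(k, false)`
for a tape whose head moves along with that of `k`. -/
def spread (own : K' → Option (K × Bool)) (s : K' → TapeSym) (a : K → TapeSym × Dir) (k' : K') :
    TapeSym × Dir :=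
  match own k' with
  | none => (s k', .stay)
  | some (k, true) => a k
  | some (k, false) => (s k', (a k).2)

/-- Run a component on some of the tapes. -/
def map (C : Comp K E) (e : K → K') (own : K' → Option (K × Bool)) : Comp K' E where
  Q := C.Q
  start := C.start
  query := C.query
  δ q s := (fun z => (z.1, spread own s z.2)) '' C.δ q (fun k => s (e k))

/-- The tapes of a component among the other tapes. -/
def lay (own : K' → Option (K × Bool)) (base : K' → ATape) (σ : K → ATape) (k' : K') : ATape :=
  match own k' with
  | none => base k'
  | some (k, true) => σ k
  | some (k, false) => ⟨(σ k).pos, (base k').cells⟩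

theorem map_det {C : Comp K E} (h : C.Det) (e : K → K') (own : K' → Option (K × Bool)) :
    (C.map e own).Det := fun q _ => (h q _).image _
theorem map_free {C : Comp K E} (h : C.Free) (e : K → K') (own : K' → Option (K × Bool)) :
    (C.map e own).Free := h

/-- Each tape `e k` is owned by `k`, so `lay` is injective in `σ`, and a step on the laid out tapes
is the same as a step of the component. Companion tapes keep their contents and only follow the
head. -/
theorem Run.map {C : Comp K E} {e : K → K'} {own : K' → Option (K × Bool)}
    (he : ∀ k, own (e k) = some (k, true))
    {base : K' → ATape} (hbase : Fits B base) {r σ n S} (h : C.Run O qT B r σ n S) :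
    (C.map e own).Run O (e qT) B r (lay own base σ) n ((fun z => (z.1, lay own base z.2)) '' S) := by
  have hlay : ∀ σ k, lay own base σ (e k) = σ k := fun σ k => by simp [lay, he]
  have hfit : ∀ σ, Fits B σ → Fits B (lay own base σ) := by
    intro σ h k'
    unfold lay
    split
    · exact hbase k'
    · exact h _
    · exact h _
  have hinj : Function.Injective (lay own base) := by
    intro σ σ' h
    funext k
    rw [← hlay σ k, h, hlay]
  have hspread : ∀ σ (a : K → TapeSym × Dir), (fun k' => (lay own base σ k').act
      (spread own (fun k' => (lay own base σ k').read) a k')) =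
      lay own base (fun k => (σ k).act (a k)) := by
    intro σ a
    funext k'
    rcases ho : own k' with _ | ⟨k, _ | _⟩
    · simp [lay, spread, ho]
    · simp [lay, spread, ho, ATape.act, ATape.read]
    · simp [lay, spread, ho]
  induction h with
  | exit x τ n hf =>
    refine (Run.exit (C := C.map e own) x _ n (hfit _ hf)).congr ?_
    simp
  | step q τ n F S hf hr hS ih =>
    have hstep : ∀ r τ'', (C.map e own).Step O (e qT) q (lay own base τ) r τ'' ↔
        ∃ τ', τ'' = lay own base τ' ∧ C.Step O qT q τ r τ' := by
      intro r τ''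
      constructor
      · intro h
        cases h with
        | move _ a h1 h2 =>
          obtain ⟨⟨r', a⟩, h3, h4⟩ := h2
          cases h4
          simp only [hlay] at h3
          exact ⟨_, hspread _ _, .move _ _ h1 h3⟩
        | yes _ _ h1 h2 => exact ⟨τ, rfl, .yes _ _ h1 (by simpa only [hlay] using h2)⟩
        | no _ _ h1 h2 => exact ⟨τ, rfl, .no _ _ h1 (by simpa only [hlay] using h2)⟩
      · rintro ⟨σ', h', h⟩
        subst h'
        rcases h with @⟨_, a, h1, h2⟩ | @⟨_, _, h1, h2⟩ | @⟨_, _, h1, h2⟩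
        · rw [← hspread]
          exact .move _ _ h1 ⟨(r, a), by simpa only [hlay] using h2, rfl⟩
        · exact .yes _ _ h1 (by simpa only [hlay] using h2)
        · exact .no _ _ h1 (by simpa only [hlay] using h2)
    refine .step (C := C.map e own) q _ n (fun r τ'' => {z | ∃ τ' : K → ATape, τ'' = lay own base τ' ∧
      z ∈ (fun z => (z.1, lay own base z.2)) '' F r τ'}) _ (hfit _ hf) ?_ ?_
    · intro r τ'' hs
      obtain ⟨τ', rfl, hs'⟩ := (hstep r τ'').1 hs
      refine (ih r τ' hs').congr ?_
      ext z
      constructor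
      · intro h; exact ⟨τ', rfl, h⟩
      · rintro ⟨τ₁, h1, h⟩
        rwa [hinj h1]
    · intro z
      constructor
      · rintro ⟨z, hz, rfl⟩
        obtain ⟨r, τ', hs, hz⟩ := (hS z).1 hz
        exact ⟨r, _, (hstep r _).2 ⟨τ', rfl, hs⟩, τ', rfl, z, hz, rfl⟩
      · rintro ⟨r, τ'', hs, τ', rfl, z, hz, rfl⟩
        obtain ⟨τ₁, h1, hs⟩ := (hstep r _).1 hs
        obtain rfl := hinj h1
        exact ⟨z, (hS z).2 ⟨r, τ', hs, hz⟩, rfl⟩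

end Comp
end

noncomputable section
open scoped Classical

/-! ## Subroutines -/

namespace ATape

theorem act_same (t : ATape) {x : TapeSym} (hx : x = t.read) (d : Dir) :
    t.act (x, d) = ⟨t.pos + d.shift, t.cells⟩ := by
  subst hx; simp [act, read]

theorem wordCells_ne_none {s i : ℤ} {w : Word} (h1 : s ≤ i) (h2 : i < s + w.length) :
    wordCells s w i ≠ none := by
  obtain ⟨j, rfl⟩ : ∃ j : ℕ, i = s + j := ⟨(i - s).toNat, by omega⟩
  rw [wordCells_add, List.getElem?_eq_getElem (by omega)]
  simp

theorem wordCells_dropLast (s : ℤ) (w : Word) (b : Bool) (p : ℤ) (hp : p = s + w.length) :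
    Function.update (wordCells s (w ++ [b])) p none = wordCells s w := by
  rw [← wordCells_append s w b p hp, Function.update_idem]
  have : wordCells s w p = none := wordCells_of_ge hp.ge
  rw [← this, Function.update_eq_self]

theorem HasWord.cells_eq {t : ATape} {w : Word} (h : t.HasWord w) {i : ℕ} (hi : i < w.length) :
    t.cells (t.pos + i) = some w[i] := by
  rw [h i hi.le, List.getElem?_eq_getElem hi]

theorem HasWord.cells_length {t : ATape} {w : Word} (h : t.HasWord w) :
    t.cells (t.pos + w.length) = none := by
  rw [h _ le_rfl, List.getElem?_eq_none le_rfl]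

end ATape

/-- The word `1ⁿ`. -/
def ones (n : ℕ) : Word := List.replicate n true

@[simp] theorem length_ones (n : ℕ) : (ones n).length = n := List.length_replicate

theorem ones_succ (n : ℕ) : ones (n + 1) = ones n ++ [true] := List.replicate_succ'

namespace Comp

variable {K E : Type} {O : Language Bool} {qT : K}

theorem Spec.of_eq {B : ℕ∞} {C : Comp K E} {τ τ' : K → ATape} {n n' : ℕ} {S S' : Set (E × (K → ATape))}
    (h : C.Spec O qT B τ n S) (hn : n ≤ n') (hτ : τ = τ') (hS : S = S') : C.Spec O qT B τ' n' S' := by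
  subst hτ hS; exact h.mono hn

theorem spec_one_top {k : K} {g : TapeSym → E × (TapeSym × Dir)} {τ τ' : K → ATape} {e : E}
    (he : (g (τ k).read).1 = e)
    (hτ : Function.update τ k ((τ k).act (g (τ k).read).2) = τ') :
    (one k g).Spec O qT ⊤ τ 1 {(e, τ')} :=
  hτ ▸ spec_one (fits_top _) (fits_top _) he rfl

theorem spec_two_top {a b : K} {g : TapeSym → TapeSym → E × (TapeSym × Dir) × (TapeSym × Dir)}
    {τ τ' : K → ATape} {e : E} (hab : a ≠ b)
    (he : (g (τ a).read (τ b).read).1 = e)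
    (hτ : Function.update (Function.update τ a ((τ a).act (g (τ a).read (τ b).read).2.1)) b
      ((τ b).act (g (τ a).read (τ b).read).2.2) = τ') :
    (two a b g).Spec O qT ⊤ τ 1 {(e, τ')} :=
  hτ ▸ spec_two hab (fits_top _) (fits_top _) he rfl rfl

theorem update_update {a b : K} (hab : a ≠ b) (τ : K → ATape) (s t s' t' : ATape) :
    Function.update (Function.update (Function.update (Function.update τ a s) b t) a s') b t' =
      Function.update (Function.update τ a s') b t' := by
  rw [Function.update_comm hab.symm, Function.update_idem, Function.update_idem]

/-- Move left to the first blank, starting one cell to the left of the head, then one cell right. -/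
def rewind (a : K) : Comp K Unit :=
  (one a fun s => ((), s, .left)).bind fun _ =>
    loop (one a fun s => (if s = none then some () else none, s, if s = none then .right else .left))

@[simp] theorem rewind_det (a : K) : (rewind a).Det :=
  bind_det (by simp) fun _ => loop_det (by simp)
@[simp] theorem rewind_free (a : K) : (rewind a).Free :=
  bind_free (by simp) fun _ => loop_free (by simp)

theorem spec_rewind {a : K} {τ : K → ATape} (s : ℤ) (j : ℕ) (hp : (τ a).pos = s + j)
    (hc : ∀ i, s ≤ i → i < s + j → (τ a).cells i ≠ none) (h0 : (τ a).cells (s - 1) = none) :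
    (rewind a).Spec O qT ⊤ τ (j + 2) {((), Function.update τ a ⟨s, (τ a).cells⟩)} := by
  have h := spec_loop_iterate (O := O) (qT := qT) (B := ⊤) (m := 1) (m' := 1)
    (C := one a fun s => (if s = none then some () else none, s, if s = none then .right else .left))
    (S := {((), Function.update τ a ⟨s, (τ a).cells⟩)})
    j (fun i => Function.update τ a ⟨s + j - 1 - i, (τ a).cells⟩) ?_ ?_
  · refine Run.mono (spec_bind_single (spec_one_top (e := ()) rfl rfl) (h.of_eq le_rfl ?_ rfl)) (by omega)
    simp [ATape.act_same, hp, Dir.shift, sub_eq_add_neg]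
  · intro i hi
    have hne : (τ a).cells (s + j - 1 - i) ≠ none := hc _ (by omega) (by omega)
    refine spec_one_top (by simp [ATape.read, hne]) ?_
    rw [ATape.act_same _ rfl]
    simp only [Function.update_self, ATape.read, hne, if_false, Function.update_idem, Dir.shift]
    congr 2; push_cast; ring
  · have e : s + j - 1 - j = s - 1 := by ring
    refine spec_loop_exit (spec_one_top (by simp [ATape.read, e, h0]) ?_)
    rw [ATape.act_same _ rfl]
    simp [ATape.read, e, h0, Dir.shift]

/-- Copy the word at the head of `a` to the blank tape `b`. -/
def copy (a b : K) : Comp K Unit :=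
  (loop (two a b fun s u => if s = none then (some (), (s, .stay), (u, .stay))
    else (none, (s, .right), (s, .right)))).bind fun _ => rewind b

@[simp] theorem copy_det (a b : K) : (copy a b).Det :=
  bind_det (loop_det (by simp)) fun _ => by simp
@[simp] theorem copy_free (a b : K) : (copy a b).Free :=
  bind_free (loop_free (by simp)) fun _ => by simp

theorem spec_copyLoop {a b : K} {τ : K → ATape} (hab : a ≠ b) {w : Word} (ha : (τ a).HasWord w)
    (hb : τ b = .blank) : (loop (two a b fun s u => if s = none then (some (), (s, .stay), (u, .stay))
      else (none, (s, .right), (s, .right)))).Spec O qT ⊤ τ (w.length + 1)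
      {((), Function.update (Function.update τ a ⟨(τ a).pos + w.length, (τ a).cells⟩) b
        ⟨w.length, ATape.wordCells 0 w⟩)} := by
  have h := spec_loop_iterate (O := O) (qT := qT) (B := ⊤) (m := 1) (m' := 1)
    (C := two a b fun s u => if s = none then (some (), (s, .stay), (u, .stay))
      else (none, (s, .right), (s, .right)))
    (S := {((), Function.update (Function.update τ a ⟨(τ a).pos + w.length, (τ a).cells⟩) b
        ⟨w.length, ATape.wordCells 0 w⟩)})
    w.length (fun i => Function.update (Function.update τ a ⟨(τ a).pos + i, (τ a).cells⟩) b
      ⟨i, ATape.wordCells 0 (w.take i)⟩) ?_ ?_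
  · refine h.of_eq (by omega) ?_ rfl
    simp only [Nat.cast_zero, add_zero, List.take_zero, ATape.wordCells_nil, Function.update_eq_self]
    rw [← ATape.blank, ← hb, Function.update_eq_self]
  · intro i hi
    have hc := ha.cells_eq hi
    refine spec_two_top hab ?_ ?_
    · simp [hab, ATape.read, hc]
    · simp only [Function.update_of_ne hab, Function.update_self, ATape.read, hc, reduceCtorEq,
        if_false]
      rw [ATape.act_same _ (by simp [ATape.read, hc])]
      simp only [ATape.act, Dir.shift]
      rw [ATape.wordCells_append _ _ _ _ (by simp; omega), List.take_append_getElem]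
      rw [update_update hab]
      push_cast
      rw [add_assoc]
  · have hc := ha.cells_length
    refine spec_loop_exit (spec_two_top hab ?_ ?_)
    · simp [hab, ATape.read, hc]
    · simp only [Function.update_of_ne hab, Function.update_self, ATape.read, hc, if_true]
      rw [ATape.act_same _ (by simp [ATape.read, hc]), ATape.act_same _ (by simp [ATape.read]),
        update_update hab]
      simp [Dir.shift]

theorem spec_copy {a b : K} {τ : K → ATape} (hab : a ≠ b) {w : Word} (ha : (τ a).HasWord w)
    (hb : τ b = .blank) : (copy a b).Spec O qT ⊤ τ (2 * w.length + 3)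
      {((), Function.update (Function.update τ a ⟨(τ a).pos + w.length, (τ a).cells⟩) b
        (.ofWord w))} := by
  refine Run.mono (spec_bind_single (spec_copyLoop hab ha hb)
    ((spec_rewind 0 w.length ?_ ?_ ?_).of_eq le_rfl rfl ?_)) (by omega)
  · simp
  · simp only [Function.update_self]
    exact fun i h1 h2 => ATape.wordCells_ne_none h1 h2
  · simpa using ATape.wordCells_of_lt w (by omega)
  · simp [ATape.ofWord]

end Comp
end

/-! ### Unary arithmetic, clocks and comparison of words -/

noncomputable section
open scoped Classical

namespace Comp

variable {K E : Type} {O : Language Bool} {qT : K}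

/-- Move right through the word on `a`, and write a `1` on `b` in each step. -/
def tally (a b : K) : Comp K Unit :=
  loop (two a b fun s _ => if s = none then (some (), (s, .left), (some true, .right))
    else (none, (s, .right), (some true, .right)))

/-- The round that meets the blank also writes a `1`, hence `w.length + 1`; it steps back onto the
last letter, where `unwind` takes over. -/
theorem spec_tally {a b : K} {τ : K → ATape} (hab : a ≠ b) {w : Word} (ha : τ a = .ofWord w)
    {n : ℕ} (hb : τ b = ⟨n, ATape.wordCells 0 (ones n)⟩) :
    (tally a b).Spec O qT ⊤ τ (w.length + 1)
      {((), Function.update (Function.update τ a ⟨w.length - 1, ATape.wordCells 0 w⟩) b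
        ⟨(n + w.length + 1 : ℕ), ATape.wordCells 0 (ones (n + w.length + 1))⟩)} := by
  have hw := ATape.hasWord_ofWord w
  have h := spec_loop_iterate (O := O) (qT := qT) (B := ⊤) (m := 1) (m' := 1)
    (C := two a b fun s _ => if s = none then (some (), (s, .left), (some true, .right))
      else (none, (s, .right), (some true, .right)))
    (S := {((), Function.update (Function.update τ a ⟨w.length - 1, ATape.wordCells 0 w⟩) b
        ⟨(n + w.length + 1 : ℕ), ATape.wordCells 0 (ones (n + w.length + 1))⟩)})
    w.length (fun i => Function.update (Function.update τ a ⟨i, ATape.wordCells 0 w⟩) b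
      ⟨(n + i : ℕ), ATape.wordCells 0 (ones (n + i))⟩) ?_ ?_
  · refine h.of_eq (by omega) ?_ rfl
    simp only [Nat.cast_zero, add_zero]
    rw [← hb, ← ATape.ofWord, ← ha, Function.update_eq_self, Function.update_eq_self]
  · intro i hi
    have hc : ATape.wordCells 0 w i = some w[i] := by simpa [ATape.ofWord] using hw.cells_eq hi
    refine spec_two_top hab ?_ ?_
    · simp [hab, ATape.read, hc]
    · simp only [Function.update_of_ne hab, Function.update_self, ATape.read, hc, reduceCtorEq,
        if_false]
      rw [ATape.act_same _ (by simp [ATape.read, hc]), update_update hab]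
      simp only [ATape.act, Dir.shift]
      rw [ATape.wordCells_append _ _ _ _ (by simp), ← ones_succ]
      push_cast
      rw [add_assoc, add_assoc]
  · have hc : ATape.wordCells 0 w w.length = none := by
      simpa [ATape.ofWord] using hw.cells_length
    refine spec_loop_exit (spec_two_top hab ?_ ?_)
    · simp [hab, ATape.read, hc]
    · simp only [Function.update_of_ne hab, Function.update_self, ATape.read, hc, if_true]
      rw [ATape.act_same _ (by simp [ATape.read, hc]), update_update hab]
      simp only [ATape.act, Dir.shift]
      rw [ATape.wordCells_append _ _ _ _ (by simp), ← ones_succ]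
      push_cast
      rfl

/-- Move left to the first blank, then one cell right. -/
def unwind (a : K) (e : E) : Comp K E :=
  loop (one a fun s => (if s = none then some e else none, s, if s = none then .right else .left))

theorem spec_unwind {a : K} {τ : K → ATape} {w : Word} (e : E)
    (ha : τ a = ⟨w.length - 1, ATape.wordCells 0 w⟩) :
    (unwind a e).Spec O qT ⊤ τ (w.length + 1) {(e, Function.update τ a (.ofWord w))} := by
  have h := spec_loop_iterate (O := O) (qT := qT) (B := ⊤) (m := 1) (m' := 1)
    (C := one a fun s => (if s = none then some e else none, s, if s = none then .right else .left))
    (S := {(e, Function.update τ a (.ofWord w))})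
    w.length (fun i => Function.update τ a ⟨w.length - 1 - i, ATape.wordCells 0 w⟩) ?_ ?_
  · refine h.of_eq (by omega) ?_ rfl
    simp only [Nat.cast_zero, sub_zero]
    rw [← ha, Function.update_eq_self]
  · intro i hi
    have hne : ATape.wordCells 0 w (w.length - 1 - i) ≠ none :=
      ATape.wordCells_ne_none (by omega) (by omega)
    refine spec_one_top (by simp [ATape.read, hne]) ?_
    rw [ATape.act_same _ rfl]
    simp only [Function.update_self, ATape.read, hne, if_false, Function.update_idem, Dir.shift]
    congr 2; push_cast; ring
  · have e1 : (w.length - 1 - w.length : ℤ) = -1 := by ring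
    have h0 : ATape.wordCells 0 w (-1) = none := ATape.wordCells_of_lt _ (by omega)
    refine spec_loop_exit (spec_one_top (by simp [ATape.read, e1, h0]) ?_)
    rw [ATape.act_same _ rfl]
    simp [ATape.read, e1, h0, Dir.shift, ATape.ofWord]

/-- Erase a word backwards. -/
def wipe (a : K) : Comp K Unit :=
  (one a fun s => ((), s, .left)).bind fun _ =>
    loop (one a fun s => (if s = none then some () else none, none, if s = none then .right else .left))

theorem spec_wipe {a : K} {τ : K → ATape} {n : ℕ} (ha : τ a = ⟨n, ATape.wordCells 0 (ones n)⟩) :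
    (wipe a).Spec O qT ⊤ τ (n + 2) {((), Function.update τ a .blank)} := by
  have h := spec_loop_iterate (O := O) (qT := qT) (B := ⊤) (m := 1) (m' := 1)
    (C := one a fun s => (if s = none then some () else none, none, if s = none then .right else .left))
    (S := {((), Function.update τ a .blank)})
    n (fun i => Function.update τ a ⟨n - 1 - i, ATape.wordCells 0 (ones (n - i))⟩) ?_ ?_
  · refine Run.mono (spec_bind_single (spec_one_top (e := ()) rfl rfl) (h.of_eq le_rfl ?_ rfl)) (by omega)
    rw [ATape.act_same _ rfl, ha]
    simp [Dir.shift, sub_eq_add_neg]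
  · intro i hi
    obtain ⟨k, rfl⟩ : ∃ k, n = i + 1 + k := ⟨n - (i + 1), by omega⟩
    have e1 : ((i + 1 + k : ℕ) : ℤ) - 1 - i = k := by push_cast; ring
    have e2 : i + 1 + k - i = k + 1 := by omega
    have e3 : i + 1 + k - (i + 1) = k := by omega
    have e4 : ((i + 1 + k : ℕ) : ℤ) - 1 - (i + 1 : ℕ) = k - 1 := by push_cast; ring
    have hne : ATape.wordCells 0 (ones (k + 1)) k ≠ none :=
      ATape.wordCells_ne_none (by omega) (by simp)
    refine spec_one_top (by simp only [Function.update_self, ATape.read, e1, e2, hne, if_false]) ?_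
    simp only [Function.update_self, ATape.read, e1, e2, e3, e4, hne, if_false,
      Function.update_idem, Dir.shift, ATape.act]
    rw [ones_succ, ATape.wordCells_dropLast _ _ _ _ (by simp)]
    simp [sub_eq_add_neg]
  · refine spec_loop_exit (spec_one_top ?_ ?_)
    · simp [ones, ATape.read]
    · simp [ones, ATape.read, ATape.act, Dir.shift, ATape.blank]

/-- Add the length of the word on `a` plus one to `t`, unless the head of `v` is on a blank. -/
def multBody (a t v : K) : Comp K (Option Unit) :=
  (one v fun s => (decide (s = none), s, if s = none then .stay else .right)).bind fun fin =>
    if fin then ret (some ()) else (tally a t).bind fun _ => unwind a none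

/-- Multiply the unary number on `t` by the length of the word on `a` plus two; `v` is blank. -/
def mult (a t v : K) : Comp K Unit :=
  (copy t v).bind fun _ => (loop (multBody a t v)).bind fun _ => (wipe v).bind fun _ => rewind t

theorem mult_det (a t v : K) : (mult a t v).Det := by
  refine bind_det (by simp) fun _ => bind_det (loop_det (bind_det (by simp) ?_)) fun _ =>
    bind_det (bind_det (by simp) fun _ => loop_det (by simp)) fun _ => by simp
  rintro (_ | _)
  · exact bind_det (loop_det (by simp)) fun _ => loop_det (by simp)
  · exact ret_det _

theorem mult_free (a t v : K) : (mult a t v).Free := by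
  refine bind_free (by simp) fun _ => bind_free (loop_free (bind_free (by simp) ?_)) fun _ =>
    bind_free (bind_free (by simp) fun _ => loop_free (by simp)) fun _ => by simp
  rintro (_ | _)
  · exact bind_free (loop_free (by simp)) fun _ => loop_free (by simp)
  · exact ret_free _

/-- The tapes `t` and `v` inside the loop of `mult`. -/
def multTapes (t v : K) (τ : K → ATape) (n m i : ℕ) : K → ATape :=
  Function.update (Function.update τ t ⟨m, ATape.wordCells 0 (ones m)⟩) v
    ⟨i, ATape.wordCells 0 (ones n)⟩

theorem spec_multBody {a t v : K} {τ : K → ATape} (hat : a ≠ t) (hav : a ≠ v) (htv : t ≠ v)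
    {w : Word} (ha : τ a = .ofWord w) {n m i : ℕ} (hi : i < n) :
    (multBody a t v).Spec O qT ⊤ (multTapes t v τ n m i) (2 * w.length + 3)
      {(none, multTapes t v τ n (m + w.length + 1) (i + 1))} := by
  have hne : ATape.wordCells 0 (ones n) i ≠ none := ATape.wordCells_ne_none (by omega) (by simpa)
  have h1 : (one v fun s => (decide (s = none), s, if s = none then .stay else .right)).Spec O qT ⊤
      (multTapes t v τ n m i) 1 {(false, multTapes t v τ n m (i + 1))} := by
    refine spec_one_top (by simp [multTapes, ATape.read, hne]) ?_
    simp only [multTapes, Function.update_self, ATape.read, hne, if_false]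
    rw [ATape.act_same _ (by simp [ATape.read])]
    simp [Dir.shift]
  have h2 := spec_tally (O := O) (qT := qT) (τ := multTapes t v τ n m (i + 1)) hat (w := w) (n := m)
    (by simp [multTapes, hat, hav, ha]) (by simp [multTapes, htv])
  have h3 := spec_unwind (O := O) (qT := qT) (w := w) (e := (none : Option Unit))
    (τ := Function.update (Function.update (multTapes t v τ n m (i + 1)) a
      ⟨w.length - 1, ATape.wordCells 0 w⟩) t
        ⟨(m + w.length + 1 : ℕ), ATape.wordCells 0 (ones (m + w.length + 1))⟩) (a := a) (by simp [hat])
  have h4 := spec_bind_single (D := fun _ => unwind a none) h2 h3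
  unfold multBody
  refine Spec.of_eq (n := 1 + (w.length + 1 + (w.length + 1))) (spec_bind_single h1 (D := fun fin =>
    if fin then ret (some ()) else (tally a t).bind fun _ => unwind a none) h4) (by omega) rfl ?_
  congr 2
  funext k
  simp only [multTapes]
  by_cases e1 : k = a
  · subst e1; simp [hat, hav, ha]
  · by_cases e2 : k = t
    · subst e2; simp [htv, e1]
    · by_cases e3 : k = v
      · subst e3; simp [e1, e2]
      · simp [e1, e2, e3]

theorem spec_multLoop {a t v : K} {τ : K → ATape} (hat : a ≠ t) (hav : a ≠ v) (htv : t ≠ v)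
    {w : Word} (ha : τ a = .ofWord w) {n : ℕ} :
    (loop (multBody a t v)).Spec O qT ⊤ (multTapes t v τ n n 0) (n * (2 * w.length + 3) + 2)
      {((), multTapes t v τ n (n + n * (w.length + 1)) n)} := by
  refine (spec_loop_iterate (m := 2 * w.length + 3) (m' := 2) n
    (fun i => multTapes t v τ n (n + i * (w.length + 1)) i) ?_ ?_).of_eq le_rfl (by simp) rfl
  · intro i hi
    refine (spec_multBody hat hav htv ha hi).of_eq le_rfl rfl ?_
    congr 3; ring
  · have hc : ATape.wordCells 0 (ones n) n = none := ATape.wordCells_of_ge (by simp)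
    refine spec_loop_exit (spec_bind_single (n := 1) (m := 1) (e := true)
      (τ' := multTapes t v τ n (n + n * (w.length + 1)) n)
      (D := fun fin => if fin then ret (some ()) else (tally a t).bind fun _ => unwind a none)
      (spec_one_top ?_ ?_) (spec_ret (fits_top _) _))
    · simp [multTapes, ATape.read, hc]
    · simp only [multTapes, Function.update_self, ATape.read, hc, if_true]
      rw [ATape.act_same _ (by simp [ATape.read, hc])]
      simp [Dir.shift]

/-- `t` already holds `n` ones, and each of the `n` letters of its copy on `v` adds `w.length + 1`
more. This is why the clocks are powers of `w.length + 2`. -/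
theorem spec_mult {a t v : K} {τ : K → ATape} (hat : a ≠ t) (hav : a ≠ v) (htv : t ≠ v) {w : Word}
    {n : ℕ} (ha : τ a = .ofWord w) (ht : τ t = .ofWord (ones n)) (hv : τ v = .blank) :
    (mult a t v).Spec O qT ⊤ τ (n * (3 * w.length + 8) + 9)
      {((), Function.update τ t (.ofWord (ones (n * (w.length + 2)))))} := by
  have h1 : (copy t v).Spec O qT ⊤ τ (2 * n + 3) {((), multTapes t v τ n n 0)} :=
    (spec_copy htv (w := ones n) (by rw [ht]; exact ATape.hasWord_ofWord _) hv).of_eq (by simp) rfl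
      (by simp [multTapes, ht, ATape.ofWord])
  have h2 := spec_multLoop (O := O) (qT := qT) hat hav htv ha (n := n)
  have h3 := spec_wipe (O := O) (qT := qT) (a := v) (n := n)
    (τ := multTapes t v τ n (n + n * (w.length + 1)) n) (by simp [multTapes])
  have h4 := spec_rewind (O := O) (qT := qT) (a := t)
    (τ := Function.update (multTapes t v τ n (n + n * (w.length + 1)) n) v .blank) 0
    (n + n * (w.length + 1)) (by simp [multTapes, htv]) ?_ ?_
  · refine (spec_bind_single h1 <| spec_bind_single h2 <| spec_bind_single h3 h4).of_eq ?_ rfl ?_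
    · nlinarith
    · have e : n + n * (w.length + 1) = n * (w.length + 2) := by ring
      simp only [multTapes, Function.update_idem, Function.update_of_ne htv, Function.update_self, e]
      rw [Function.update_comm htv.symm, Function.update_idem, Function.update_comm htv, ← hv,
        Function.update_eq_self]
      rfl
  · simp only [multTapes, Function.update_of_ne htv, Function.update_self]
    exact fun i h1 h2 => ATape.wordCells_ne_none h1 (by simpa using h2)
  · simp only [multTapes, Function.update_of_ne htv, Function.update_self]
    exact ATape.wordCells_of_lt _ (by omega)

/-- Write `(n + 2) ^ d` in unary on `t`, where `n` is the length of the word on `a`. -/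
def clock (a t v : K) : ℕ → Comp K Unit
  | 0 => one t fun _ => ((), some true, .stay)
  | d + 1 => (clock a t v d).bind fun _ => mult a t v

theorem clock_det (a t v : K) : ∀ d, (clock a t v d).Det
  | 0 => one_det _ _
  | d + 1 => bind_det (clock_det a t v d) fun _ => mult_det a t v

theorem clock_free (a t v : K) : ∀ d, (clock a t v d).Free
  | 0 => one_free _ _
  | d + 1 => bind_free (clock_free a t v d) fun _ => mult_free a t v

/-- A bound on the time for `clock`. -/
def clockTime (n : ℕ) : ℕ → ℕ
  | 0 => 1
  | d + 1 => clockTime n d + ((n + 2) ^ d * (3 * n + 8) + 9)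

theorem spec_clock {a t v : K} {τ : K → ATape} (hat : a ≠ t) (hav : a ≠ v) (htv : t ≠ v) {w : Word}
    (ha : τ a = .ofWord w) (ht : τ t = .blank) (hv : τ v = .blank) (d : ℕ) :
    (clock a t v d).Spec O qT ⊤ τ (clockTime w.length d)
      {((), Function.update τ t (.ofWord (ones ((w.length + 2) ^ d))))} := by
  induction d with
  | zero =>
    refine spec_one_top rfl ?_
    simp only [ht, ATape.act, ATape.blank, Dir.shift, pow_zero, ATape.ofWord]
    rw [show ones 1 = [] ++ [true] from rfl, ← ATape.wordCells_append 0 [] true 0 (by simp)]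
    simp
  | succ d ih =>
    refine Run.mono (spec_bind_single ih ((spec_mult hat hav htv (w := w) ?_
      (n := (w.length + 2) ^ d) ?_ ?_).of_eq le_rfl rfl ?_)) le_rfl
    · simp [hat, ha]
    · simp
    · simp [htv.symm, hv]
    · simp [pow_succ]

/-- Compare the words at the heads of `a` and `b`. -/
def compare (a b : K) : Comp K Bool :=
  loop (two a b fun s u => (if s = u then (if s = none then some true else none) else some false,
    (s, if s = u ∧ s ≠ none then .right else .stay), (u, if s = u ∧ s ≠ none then .right else .stay)))

@[simp] theorem compare_det (a b : K) : (compare a b).Det := loop_det (by simp)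
@[simp] theorem compare_free (a b : K) : (compare a b).Free := loop_free (by simp)

/-- Both heads are displaced by the same `j`, so they can later be brought back together by
`rewindWith`. -/
theorem spec_compare {a b : K} (hab : a ≠ b) {v w : Word} {τ : K → ATape} (ha : (τ a).HasWord v)
    (hb : (τ b).HasWord w) : ∃ j ≤ w.length,
      (compare a b).Spec O qT ⊤ τ (w.length + 1) {(decide (v = w),
        Function.update (Function.update τ a ⟨(τ a).pos + j, (τ a).cells⟩) b
          ⟨(τ b).pos + j, (τ b).cells⟩)} := by
  -- `j` is the first index at which the words differ or both end.
  obtain ⟨j, hj, h1, h2⟩ : ∃ j ≤ w.length, (∀ i < j, v[i]? = w[i]? ∧ v[i]? ≠ none) ∧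
      (v[j]? = w[j]? → v[j]? = none) := by
    by_cases h : ∃ j : ℕ, v[j]? = w[j]? → v[j]? = none
    · refine ⟨Nat.find h, ?_, fun i hi => ?_, Nat.find_spec h⟩
      · refine Nat.find_min' h fun e => ?_
        rw [e]; simp
      · have := Nat.find_min h hi
        tauto
    · push Not at h
      exact absurd (by simp) (h (max v.length w.length)).2
  have hjv : j ≤ v.length := by
    by_contra! hlt
    exact (h1 v.length hlt).2 (by simp)
  have hva : ∀ i ≤ j, (τ a).cells ((τ a).pos + i) = v[i]? := fun i hi => ha i (by omega)
  have hwb : ∀ i ≤ j, (τ b).cells ((τ b).pos + i) = w[i]? := fun i hi => hb i (by omega)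
  refine ⟨j, hj, (spec_loop_iterate (m := 1) (m' := 1) j (fun i => Function.update
    (Function.update τ a ⟨(τ a).pos + i, (τ a).cells⟩) b ⟨(τ b).pos + i, (τ b).cells⟩)
    ?_ (spec_loop_exit (spec_two_top hab ?_ ?_))).of_eq (by omega) (by simp) rfl⟩
  · intro i hi
    have ea := hva i hi.le
    have eb := hwb i hi.le
    rw [← (h1 i hi).1] at eb
    have hne := (h1 i hi).2
    refine spec_two_top hab ?_ ?_
    · simp only [Function.update_of_ne hab, Function.update_self, ATape.read, ea, eb, if_true, hne,
        if_false]
    · simp only [Function.update_of_ne hab, Function.update_self, ATape.read, ea, eb,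
        ne_eq, hne, not_false_eq_true, and_self, if_true]
      rw [ATape.act_same _ (by simp [ATape.read, ea]), ATape.act_same _ (by simp [ATape.read, eb]),
        update_update hab]
      simp only [Dir.shift]
      push_cast
      rw [add_assoc, add_assoc]
  · have ea := hva j le_rfl
    have eb := hwb j le_rfl
    simp only [Function.update_of_ne hab, Function.update_self, ATape.read, ea, eb]
    by_cases h3 : v[j]? = w[j]?
    · have h4 := h2 h3
      have : v = w := by
        have e1 : v.length = j := le_antisymm (by simpa using h4) hjv
        have e2 : w.length = j := le_antisymm (by rw [h3] at h4; simpa using h4) hj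
        apply List.ext_getElem?
        intro i
        by_cases hi : i < j
        · exact (h1 i hi).1
        · rw [List.getElem?_eq_none (by omega), List.getElem?_eq_none (by omega)]
      subst this
      simp [h4]
    · have : v ≠ w := by rintro rfl; exact h3 rfl
      simp [h3, this]
  · have ea := hva j le_rfl
    have eb := hwb j le_rfl
    have h3 : ¬ (v[j]? = w[j]? ∧ v[j]? ≠ none) := by tauto
    simp only [Function.update_of_ne hab, Function.update_self, ATape.read, ea, eb, if_neg h3]
    rw [ATape.act_same _ (by simp [ATape.read, ea]), ATape.act_same _ (by simp [ATape.read, eb]),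
      update_update hab]
    simp [Dir.shift]

end Comp
end

noncomputable section
open scoped Classical

/-! ## Simulation with clean-up -/

/-- The tapes of our machines: an input tape, a work tape, a query tape, two tapes for the clock, and
tapes for simulated machines, each with a tape that marks its origin. -/
inductive Tp (D : Type) where
  | I | X | Q | V | T
  | dat (d : D)
  | sh (d : D)

namespace Tp

variable {D : Type}

instance [Finite D] : Finite (Tp D) := by
  let f : Tp D → Fin 5 ⊕ D ⊕ D := fun
    | I => .inl 0 | X => .inl 1 | Q => .inl 2 | V => .inl 3 | T => .inl 4
    | dat d => .inr (.inl d) | sh d => .inr (.inr d)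
  refine Finite.of_injective f ?_
  rintro (_ | _) (_ | _) h <;> simp_all [f]

instance [Finite D] : Fintype (Tp D) := Fintype.ofFinite _

/-- The tapes `P` of simulated machines among the other tapes `τ`. -/
def lay (τ : Tp D → ATape) (P : D → ATape) : Tp D → ATape
  | dat d => P d
  | sh d => ⟨(P d).pos, ATape.wordCells 0 [true]⟩
  | k => τ k

theorem lay_update_dat (τ : Tp D → ATape) (P : D → ATape) (d : D) (t : ATape) (ht : t.pos = (P d).pos) :
    Function.update (lay τ P) (.dat d) t = lay τ (Function.update P d t) := by
  funext k
  rcases k with _ | _ | _ | _ | _ | d' | d'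
  case dat => by_cases h : d' = d <;> simp [lay, h]
  case sh =>
    by_cases h : d' = d
    · subst h; simp [lay, ht]
    · simp [lay, h]
  all_goals simp [lay]

/-- The tapes outside of the simulated machines. -/
def aux : Tp D → Prop
  | dat _ => False
  | sh _ => False
  | _ => True

theorem lay_update (τ : Tp D → ATape) (P : D → ATape) {k : Tp D} (hk : k.aux) (t : ATape) :
    Function.update (lay τ P) k t = lay (Function.update τ k t) P := by
  funext k'
  by_cases h : k' = k
  · subst h; cases k' <;> simp_all [lay, aux]
  · rw [Function.update_of_ne h]
    cases k' <;> simp_all [lay]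

theorem fits_lay {B : ℕ∞} {τ : Tp D → ATape} {P : D → ATape}
    (hτ : ∀ k : Tp D, k.aux → ((τ k).pos.natAbs : ℕ∞) ≤ B) (hP : Fits B P) : Fits B (lay τ P) := by
  intro k
  cases k with
  | dat d => exact hP d
  | sh d => exact hP d
  | _ => exact hτ _ trivial

end Tp

namespace Comp

variable {D E : Type} {O : Language Bool} {qT : Tp D}

/-- The moves of a sweep along the clock: every simulated tape moves as told by `g`. -/
def sweepAct (g : TapeSym → TapeSym → TapeSym × Dir) (dir : Dir) (s : Tp D → TapeSym) :
    Tp D → TapeSym × Dir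
  | .T => (s .T, dir)
  | .dat d => g (s (.dat d)) (s (.sh d))
  | .sh d => (s (.sh d), (g (s (.dat d)) (s (.sh d))).2)
  | k => (s k, .stay)

/-- Apply `g` to the simulated tapes once for each step along the clock. -/
def sweep (g : TapeSym → TapeSym → TapeSym × Dir) (dir opp : Dir) : Comp (Tp D) Unit :=
  loop (act fun s => if s .T = none
    then (some (), Function.update (fun k => (s k, .stay)) .T (s .T, opp))
    else (none, sweepAct g dir s))

/-- The effect of `g` on a simulated tape. -/
def sweepStep (g : TapeSym → TapeSym → TapeSym × Dir) (t : ATape) : ATape :=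
  t.act (g t.read (ATape.wordCells 0 [true] t.pos))

theorem spec_sweep (g : TapeSym → TapeSym → TapeSym × Dir) (dir opp : Dir) (N : ℕ) (p : ℤ)
    (c : ℤ → TapeSym) (hc : ∀ i < N, c (p + i * dir.shift) ≠ none)
    (h0 : c (p + N * dir.shift) = none) (τ : Tp D → ATape) (P : D → ATape) :
    (sweep g dir opp).Spec O qT ⊤ (Tp.lay (Function.update τ .T ⟨p, c⟩) P) (N + 1)
      {((), Tp.lay (Function.update τ .T ⟨p + N * dir.shift + opp.shift, c⟩)
        fun d => (sweepStep g)^[N] (P d))} := by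
  refine (spec_loop_iterate (m := 1) (m' := 1) N (fun i =>
    Tp.lay (Function.update τ .T ⟨p + i * dir.shift, c⟩) fun d => (sweepStep g)^[i] (P d))
    ?_ (spec_loop_exit (spec_act (fits_top _) (fits_top _) ?_ ?_))).of_eq (by omega) (by simp) rfl
  · intro i hi
    have hne := hc i hi
    refine spec_act (fits_top _) (fits_top _) ?_ ?_
    · simp [Tp.lay, ATape.read, hne]
    · intro k
      rw [if_neg (by simp [Tp.lay, ATape.read, hne])]
      cases k with
      | T =>
        simp only [Tp.lay, sweepAct, Function.update_self]
        rw [ATape.act_same _ rfl]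
        congr 1; push_cast; ring
      | dat d => simp [Tp.lay, sweepAct, Function.iterate_succ_apply', sweepStep, ATape.read]
      | sh d =>
        simp only [Tp.lay, sweepAct, Function.iterate_succ_apply']
        rw [ATape.act_same _ rfl]
        simp [sweepStep, ATape.act, ATape.read]
      | _ => simp [Tp.lay, sweepAct]
  · simp [Tp.lay, ATape.read, h0]
  · intro k
    rw [if_pos (by simp [Tp.lay, ATape.read, h0])]
    cases k with
    | T =>
      simp only [Tp.lay, Function.update_self]
      rw [ATape.act_same _ rfl]
    | _ => simp [Tp.lay]

/-- A sweep along the clock and back. -/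
def sweepTwice (g : TapeSym → TapeSym → TapeSym × Dir) : Comp (Tp D) Unit :=
  (sweep g .right .left).bind fun _ => sweep g .left .right

/-- The way back returns the clock to its initial state, so it can be used again; `g` is applied `N`
times in each direction. -/
theorem spec_sweepTwice (g : TapeSym → TapeSym → TapeSym × Dir) {N : ℕ} {τ : Tp D → ATape}
    (hτ : τ .T = .ofWord (ones N)) (P : D → ATape) :
    (sweepTwice g).Spec O qT ⊤ (Tp.lay τ P) (2 * N + 2)
      {((), Tp.lay τ fun d => (sweepStep g)^[2 * N] (P d))} := by
  have e : Function.update τ .T ⟨0, ATape.wordCells 0 (ones N)⟩ = τ := by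
    rw [← ATape.ofWord, ← hτ, Function.update_eq_self]
  have h1 := spec_sweep (O := O) (qT := qT) g .right .left N 0 (ATape.wordCells 0 (ones N))
    (fun i hi => ATape.wordCells_ne_none (by simp [Dir.shift]) (by simpa [Dir.shift]))
    (ATape.wordCells_of_ge (by simp [Dir.shift])) τ P
  have h2 := spec_sweep (O := O) (qT := qT) g .left .right N (0 + N * Dir.right.shift + Dir.left.shift)
    (ATape.wordCells 0 (ones N))
    (fun i hi => ATape.wordCells_ne_none (by simp [Dir.shift]; omega) (by simp [Dir.shift]; omega))
    (ATape.wordCells_of_lt _ (by simp [Dir.shift])) τ fun d => (sweepStep g)^[N] (P d)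
  rw [e] at h1
  refine (spec_bind_single h1 h2).of_eq (by omega) rfl ?_
  rw [show (0 + N * Dir.right.shift + Dir.left.shift + N * Dir.left.shift + Dir.right.shift : ℤ) = 0 by
    simp [Dir.shift], e]
  simp only [← Function.iterate_add_apply, two_mul]

theorem sweepTwice_det (g : TapeSym → TapeSym → TapeSym × Dir) :
    (sweepTwice g : Comp (Tp D) Unit).Det :=
  bind_det (loop_det (by simp)) fun _ => loop_det (by simp)

theorem sweepTwice_free (g : TapeSym → TapeSym → TapeSym × Dir) :
    (sweepTwice g : Comp (Tp D) Unit).Free :=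
  bind_free (loop_free (by simp)) fun _ => loop_free (by simp)

/-- Make the simulated tapes blank and move their heads to the origin. -/
def clean : Comp (Tp D) Unit :=
  (sweepTwice fun s _ => (s, .right)).bind fun _ =>
  (sweepTwice fun _ _ => (none, .left)).bind fun _ =>
  (sweepTwice fun _ _ => (none, .left)).bind fun _ =>
  (sweepTwice fun s u => (s, if u = none then .right else .stay)).bind fun _ =>
  sweepTwice fun s u => (s, if u = none then .right else .stay)

theorem clean_det : (clean : Comp (Tp D) Unit).Det := by
  refine bind_det (sweepTwice_det _) fun _ => bind_det (sweepTwice_det _) fun _ =>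
    bind_det (sweepTwice_det _) fun _ => bind_det (sweepTwice_det _) fun _ => sweepTwice_det _

theorem clean_free : (clean : Comp (Tp D) Unit).Free := by
  refine bind_free (sweepTwice_free _) fun _ => bind_free (sweepTwice_free _) fun _ =>
    bind_free (sweepTwice_free _) fun _ => bind_free (sweepTwice_free _) fun _ => sweepTwice_free _

theorem sweepStep_right (m : ℕ) (t : ATape) :
    (sweepStep fun s _ => (s, .right))^[m] t = ⟨t.pos + m, t.cells⟩ := by
  induction m with
  | zero => simp
  | succ m ih =>
    rw [Function.iterate_succ_apply', ih, sweepStep, ATape.act_same _ rfl]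
    simp [Dir.shift, add_assoc]

theorem sweepStep_erase (m : ℕ) (t : ATape) : (sweepStep fun _ _ => (none, .left))^[m] t =
    ⟨t.pos - m, fun i => if t.pos - m < i ∧ i ≤ t.pos then none else t.cells i⟩ := by
  induction m with
  | zero =>
    ext
    · simp
    · simp
  | succ m ih =>
    rw [Function.iterate_succ_apply', ih, sweepStep]
    refine ATape.ext ?_ (funext fun i => ?_)
    · simp [ATape.act, Dir.shift]; omega
    · simp only [ATape.act]
      by_cases h : i = t.pos - m
      · subst h
        rw [Function.update_self, if_pos (by push_cast; omega)]
      · rw [Function.update_of_ne h]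
        refine if_congr ?_ rfl rfl
        push_cast
        omega

/-- The companion tape is blank to the left of the origin and marked at the origin. The head moves
right until it meets the mark and then stays, so surplus steps do no harm. -/
theorem sweepStep_seek (m : ℕ) (c : ℤ → TapeSym) (p : ℤ) (hp : p ≤ 0) (hm : -p ≤ m) :
    (sweepStep fun s u => (s, if u = none then .right else .stay))^[m] ⟨p, c⟩ = ⟨0, c⟩ := by
  induction m generalizing p with
  | zero =>
    obtain rfl : p = 0 := by omega
    rfl
  | succ m ih =>
    rw [Function.iterate_succ_apply, sweepStep, ATape.act_same _ rfl]
    rcases hp.lt_or_eq with h | rfl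
    · rw [if_pos (ATape.wordCells_of_lt _ h)]
      exact ih _ (by simp [Dir.shift]; omega) (by simp [Dir.shift]; omega)
    · rw [if_neg (ATape.wordCells_ne_none le_rfl (by simp))]
      exact ih _ (by simp [Dir.shift]) (by simp [Dir.shift])

/-- Let `p` be the position of a head, with `|p| < N`. The first double sweep brings it to `p + 2N`,
beyond all contents. Two erasing double sweeps then clear the cells from `p + 2N` down to `p - 2N +
1`, which include everything within distance `N` of the origin. From `p - 2N`, less than `3N` to the
left of the origin, the last two have `4N` steps to find the mark. -/
theorem spec_clean {N : ℕ} {τ : Tp D → ATape} (hτ : τ .T = .ofWord (ones N)) {P : D → ATape}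
    (hP : ∀ d, (P d).pos.natAbs < N) (hc : ∀ d i, N ≤ Int.natAbs i → (P d).cells i = none) :
    (clean).Spec O qT ⊤ (Tp.lay τ P) (10 * N + 10) {((), Tp.lay τ fun _ => .blank)} := by
  refine (spec_bind_single (spec_sweepTwice _ hτ _) <| spec_bind_single (spec_sweepTwice _ hτ _) <|
    spec_bind_single (spec_sweepTwice _ hτ _) <| spec_bind_single (spec_sweepTwice _ hτ _) <|
    spec_sweepTwice _ hτ _).of_eq (by omega) rfl ?_
  congr 3
  funext d
  have h1 := hP d
  rw [← Function.iterate_add_apply, ← Function.iterate_add_apply, sweepStep_right, sweepStep_erase,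
    sweepStep_seek _ _ _ (by push_cast; omega) (by push_cast; omega), ATape.blank]
  congr 1
  funext i
  simp only []
  split
  · rfl
  · exact hc d i (by push_cast at *; omega)

/-- Mark the origin of the simulated tapes. -/
def mark : Comp (Tp D) Unit := act fun s => ((), fun
  | .sh _ => (some true, .stay)
  | k => (s k, .stay))

@[simp] theorem mark_det : (mark : Comp (Tp D) Unit).Det := act_det _
@[simp] theorem mark_free : (mark : Comp (Tp D) Unit).Free := act_free _

theorem spec_mark {τ : Tp D → ATape} (hd : ∀ d, τ (.dat d) = .blank) (hs : ∀ d, τ (.sh d) = .blank) :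
    (mark).Spec O qT ⊤ τ 1 {((), Tp.lay τ fun _ => .blank)} := by
  refine spec_act (fits_top _) (fits_top _) rfl fun k => ?_
  cases k with
  | sh d =>
    simp only [hs, ATape.act, ATape.blank, Dir.shift, Tp.lay]
    rw [show [true] = [] ++ [true] from rfl, ← ATape.wordCells_append 0 [] true 0 (by simp)]
    simp
  | dat d => simp [Tp.lay, hd]
  | _ => simp [Tp.lay]

end Comp

/-! ### Simulation of a machine next to other tapes -/

namespace OracleTM

variable {D : Type}

/-- The simulated machine uses the tapes `dat (e k)`, accompanied by `sh (e k)`. -/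
def own {K : Type} (e : K → D) : Tp D → Option (K × Bool)
  | .dat d => if h : ∃ k, e k = d then some (h.choose, true) else none
  | .sh d => if h : ∃ k, e k = d then some (h.choose, false) else none
  | _ => none

theorem choose_eq {K : Type} {e : K → D} (he : Function.Injective e) (k : K)
    (h : ∃ k', e k' = e k) : h.choose = k := he h.choose_spec

/-- The simulation of `M` on the tapes `dat (e k)`. -/
def sim (M : OracleTM) (b : Bool) (e : M.K → D) : Comp (Tp D) Bool :=
  (M.toComp b).map (fun k => .dat (e k)) (own e)

theorem sim_det {M : OracleTM} (h : M.Deterministic) (b : Bool) (e : M.K → D) : (M.sim b e).Det :=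
  Comp.map_det (toComp_det h) _ _

theorem sim_free {M : OracleTM} (h : M.OracleFree) (b : Bool) (e : M.K → D) : (M.sim b e).Free :=
  Comp.map_free (toComp_free h) _ _

/-- `spec_toComp` carried over by `Run.map`. The companion tapes travel along, so that `clean` can
find the origin after the simulated tapes have been filled in an unknown way. -/
theorem spec_sim {M : OracleTM} {b : Bool} {O' O : Language Bool} (hO : ∀ x, b :: x ∈ O' ↔ x ∈ O)
    {B n : ℕ} {x : Word} (hb : M.Bounded O (M.init x) n B) (hx : x.length ≤ B) {e : M.K → D}
    (he : Function.Injective e) {τ : Tp D → ATape}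
    (hτ : ∀ k : Tp D, k.aux → ((τ k).pos.natAbs : ℕ∞) ≤ B) : ∃ S : Set (Bool × (D → ATape)),
      (M.sim b e).Spec O' (.dat (e M.queryTape)) B
        (Tp.lay τ (Function.update (fun _ => .blank) (e M.inTape) (.ofWord x))) (4 * n + 1)
        ((fun z => (z.1, Tp.lay τ z.2)) '' S) ∧
      (∀ z ∈ S, (∀ d, (z.2 d).pos.natAbs ≤ B ∧ ∀ i, B < Int.natAbs i → (z.2 d).cells i = none) ∧
        (z.1 = true → ∃ c, M.AcceptsWith O x c ∧
          ∀ k, (z.2 (e k)).HasWord (c.tape k).word ∧ (c.tape k).word.length ≤ B)) ∧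
      (∀ c, M.AcceptsWith O x c → ∃ z ∈ S, z.1 = true ∧ ∀ k, (z.2 (e k)).HasWord (c.tape k).word) ∧
      S.Nonempty ∧ (M.Deterministic → S.Subsingleton) := by
  obtain ⟨S, h1, h2, h3, h4, h5⟩ := spec_toComp hO hb hx
  -- Simulated tapes that do not belong to `M` are blank throughout.
  let ext : (M.K → ATape) → D → ATape := fun σ d =>
    if h : ∃ k, e k = d then σ h.choose else .blank
  have hext : ∀ σ k, ext σ (e k) = σ k := fun σ k => by
    simp only [ext]
    rw [dif_pos ⟨k, rfl⟩, choose_eq he]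
  have hlay : ∀ σ, Comp.lay (own e) (Tp.lay τ fun _ => .blank) σ = Tp.lay τ (ext σ) := by
    intro σ
    funext k
    cases k with
    | dat d =>
      by_cases h : ∃ k, e k = d
      · simp only [Comp.lay, own, dif_pos h, Tp.lay, ext]
      · simp only [Comp.lay, own, dif_neg h, Tp.lay, ext]
    | sh d =>
      by_cases h : ∃ k, e k = d
      · simp only [Comp.lay, own, dif_pos h, Tp.lay, ext]
      · simp only [Comp.lay, own, dif_neg h, Tp.lay, ext]
    | _ => rfl
  have hinit : ext (Comp.initTapes M.inTape x) =
      Function.update (fun _ => .blank) (e M.inTape) (.ofWord x) := by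
    funext d
    by_cases h : ∃ k, e k = d
    · obtain ⟨k, rfl⟩ := h
      rw [hext, Comp.initTapes]
      by_cases hk : k = M.inTape
      · subst hk; simp
      · rw [if_neg hk, Function.update_of_ne (he.ne hk)]
    · simp only [ext]
      rw [dif_neg h, Function.update_of_ne (fun h' => h ⟨_, h'.symm⟩)]
  refine ⟨(fun z => (z.1, ext z.2)) '' S, ?_, ?_, ?_, h4.image _, fun h => (h5 h).image _⟩
  · have := Comp.Run.map (C := M.toComp b) (e := fun k => Tp.dat (e k)) (own := own e)
      (base := Tp.lay τ fun _ => .blank) ?_ ?_ h1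
    · rw [hlay, hinit] at this
      refine this.congr ?_
      rw [Set.image_image]
      simp only [hlay]
    · intro k
      have h : ∃ k', e k' = e k := ⟨k, rfl⟩
      simp only [own, dif_pos h, choose_eq he]
    · exact Tp.fits_lay hτ fun d => by simp [ATape.blank]
  · rintro _ ⟨z, hz, rfl⟩
    obtain ⟨h6, h7⟩ := h2 z hz
    refine ⟨fun d => ?_, ?_⟩
    · by_cases h : ∃ k, e k = d
      · obtain ⟨k, rfl⟩ := h
        simp only [hext]
        exact ⟨by exact_mod_cast h1.fits_exit z hz k, h6 k⟩
      · simp only [ext, dif_neg h]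
        simp [ATape.blank]
    · simpa only [hext] using h7
  · intro c hc
    obtain ⟨z, hz, h6, h7⟩ := h3 c hc
    exact ⟨_, ⟨z, hz, rfl⟩, h6, by simpa only [hext] using h7⟩

end OracleTM
end

/-! ### Copying without displacement, and the recovery of space bounds -/

noncomputable section
open scoped Classical

namespace Comp

variable {K E : Type} {O : Language Bool} {qT : K}

/-- Move `a` as in `rewind`, and move `b` along. -/
def rewindWith (a b : K) : Comp K Unit :=
  (two a b fun s u => ((), (s, .left), (u, .left))).bind fun _ =>
    loop (two a b fun s u => (if s = none then some () else none,
      (s, if s = none then .right else .left), (u, if s = none then .right else .left)))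

@[simp] theorem rewindWith_det (a b : K) : (rewindWith a b).Det :=
  bind_det (by simp) fun _ => loop_det (by simp)
@[simp] theorem rewindWith_free (a b : K) : (rewindWith a b).Free :=
  bind_free (by simp) fun _ => loop_free (by simp)

theorem spec_rewindWith {a b : K} {τ : K → ATape} (hab : a ≠ b) (s : ℤ) (j : ℕ)
    (hp : (τ a).pos = s + j) (hc : ∀ i, s ≤ i → i < s + j → (τ a).cells i ≠ none)
    (h0 : (τ a).cells (s - 1) = none) : (rewindWith a b).Spec O qT ⊤ τ (j + 2)
      {((), Function.update (Function.update τ a ⟨s, (τ a).cells⟩) b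
        ⟨(τ b).pos - j, (τ b).cells⟩)} := by
  have h := spec_loop_iterate (O := O) (qT := qT) (B := ⊤) (m := 1) (m' := 1)
    (C := two a b fun s u => (if s = none then some () else none,
      (s, if s = none then .right else .left), (u, if s = none then .right else .left)))
    (S := {((), Function.update (Function.update τ a ⟨s, (τ a).cells⟩) b
        ⟨(τ b).pos - j, (τ b).cells⟩)})
    j (fun i => Function.update (Function.update τ a ⟨s + j - 1 - i, (τ a).cells⟩) b
      ⟨(τ b).pos - 1 - i, (τ b).cells⟩) ?_ ?_
  · refine Run.mono (spec_bind_single (spec_two_top (e := ()) hab rfl rfl) (h.of_eq le_rfl ?_ rfl))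
      (by omega)
    rw [ATape.act_same _ rfl, ATape.act_same _ rfl]
    simp [hp, Dir.shift, sub_eq_add_neg]
  · intro i hi
    have hne : (τ a).cells (s + j - 1 - i) ≠ none := hc _ (by omega) (by omega)
    refine spec_two_top hab (by simp [hab, ATape.read, hne]) ?_
    rw [ATape.act_same _ rfl, ATape.act_same _ rfl, update_update hab]
    simp only [Function.update_of_ne hab, Function.update_self, ATape.read, hne, if_false, Dir.shift]
    push_cast
    congr 2
    · congr 1; ring
    · ring
  · have e : s + j - 1 - j = s - 1 := by ring
    refine spec_loop_exit (spec_two_top hab (by simp [hab, ATape.read, e, h0]) ?_)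
    rw [ATape.act_same _ rfl, ATape.act_same _ rfl, update_update hab]
    simp only [Function.update_of_ne hab, Function.update_self, ATape.read, e, h0, if_true, Dir.shift]
    congr 2
    · congr 1; ring
    · ring

/-- Copy the word at the head of `a` to the blank tape `b`, and return to the starting position. -/
def dup (a b : K) : Comp K Unit :=
  (loop (two a b fun s u => if s = none then (some (), (s, .stay), (u, .stay))
    else (none, (s, .right), (s, .right)))).bind fun _ => rewindWith b a

@[simp] theorem dup_det (a b : K) : (dup a b).Det :=
  bind_det (loop_det (by simp)) fun _ => by simp
@[simp] theorem dup_free (a b : K) : (dup a b).Free :=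
  bind_free (loop_free (by simp)) fun _ => by simp

theorem spec_dup {a b : K} {τ : K → ATape} (hab : a ≠ b) {w : Word} (ha : (τ a).HasWord w)
    (hb : τ b = .blank) : (dup a b).Spec O qT ⊤ τ (2 * w.length + 3)
      {((), Function.update τ b (.ofWord w))} := by
  refine Run.mono (spec_bind_single (spec_copyLoop hab ha hb)
    ((spec_rewindWith hab.symm 0 w.length ?_ ?_ ?_).of_eq le_rfl rfl ?_)) (by omega)
  · simp
  · simp only [Function.update_self]
    exact fun i h1 h2 => ATape.wordCells_ne_none h1 h2
  · simpa using ATape.wordCells_of_lt w (by omega)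
  · simp only [Function.update_of_ne hab, Function.update_self]
    rw [Function.update_idem, Function.update_comm hab.symm, Function.update_idem]
    simp [ATape.ofWord]

/-- Here the specifications with `B = ⊤` acquire a space bound: the initial distance of the heads
plus the running time. -/
theorem Spec.lift {C : Comp K E} {τ : K → ATape} {n b B : ℕ} {S : Set (E × (K → ATape))}
    (h : C.Spec O qT ⊤ τ n S) (hb : Fits b τ) (hB : b + n ≤ B) : C.Spec O qT B τ n S :=
  Run.weaken (Run.fits_of_top h hb) (by exact_mod_cast hB)

end Comp

/-! ## Polynomial bounds -/

/-- Bounded by a polynomial. -/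
def PolyBdd (g : ℕ → ℕ) : Prop := ∃ d, ∀ n, g n ≤ (n + 2) ^ d

namespace PolyBdd

theorem of_le {g h : ℕ → ℕ} (hh : PolyBdd h) (hg : ∀ n, g n ≤ h n) : PolyBdd g :=
  hh.imp fun _ hd n => (hg n).trans (hd n)

theorem const (c : ℕ) : PolyBdd fun _ => c :=
  ⟨c, fun n => (Nat.lt_two_pow_self).le.trans (Nat.pow_le_pow_left (by omega) c)⟩

theorem id : PolyBdd fun n => n := ⟨1, fun n => by simp⟩

theorem mul {g h : ℕ → ℕ} (hg : PolyBdd g) (hh : PolyBdd h) : PolyBdd fun n => g n * h n := by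
  obtain ⟨d, hd⟩ := hg
  obtain ⟨e, he⟩ := hh
  exact ⟨d + e, fun n => by rw [pow_add]; exact Nat.mul_le_mul (hd n) (he n)⟩

theorem add {g h : ℕ → ℕ} (hg : PolyBdd g) (hh : PolyBdd h) : PolyBdd fun n => g n + h n := by
  obtain ⟨d, hd⟩ := hg
  obtain ⟨e, he⟩ := hh
  -- The additional factor `n + 2` is at least 2, which pays for a sum of two terms that are both at
  -- most `(n + 2) ^ (d + e)`.
  refine ⟨d + e + 1, fun n => ?_⟩
  have h1 : (n + 2) ^ d ≤ (n + 2) ^ (d + e) := Nat.pow_le_pow_right (by omega) (by omega)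
  have h2 : (n + 2) ^ e ≤ (n + 2) ^ (d + e) := Nat.pow_le_pow_right (by omega) (by omega)
  have := hd n
  have := he n
  rw [pow_succ]
  nlinarith

theorem pow {g : ℕ → ℕ} (hg : PolyBdd g) (k : ℕ) : PolyBdd fun n => g n ^ k := by
  obtain ⟨d, hd⟩ := hg
  exact ⟨d * k, fun n => by rw [pow_mul]; exact Nat.pow_le_pow_left (hd n) k⟩

theorem eval (p : Polynomial ℕ) : PolyBdd fun n => p.eval n := by
  induction p using Polynomial.induction_on' with
  | add p q hp hq => exact (hp.add hq).of_le fun n => by simp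
  | monomial n a => exact ((const a).mul (id.pow n)).of_le fun n => by simp

theorem const_mul {g : ℕ → ℕ} (c : ℕ) (hg : PolyBdd g) : PolyBdd fun n => c * g n := (const c).mul hg

theorem poly (d : ℕ) : PolyBdd fun n => (n + 2) ^ d := ⟨d, fun _ => le_rfl⟩

theorem exists_polynomial {g : ℕ → ℕ} (hg : PolyBdd g) : ∃ p : Polynomial ℕ, ∀ n, g n ≤ p.eval n := by
  obtain ⟨d, hd⟩ := hg
  exact ⟨(Polynomial.X + 2) ^ d, fun n => by simpa using hd n⟩

theorem clockTime (d : ℕ) : PolyBdd fun n => Comp.clockTime n d := by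
  induction d with
  | zero => exact const 1
  | succ d ih =>
    exact ih.add ((((id.add (const 2)).pow d).mul (((const 3).mul id).add (const 8))).add (const 9))

theorem exists_pow {g : ℕ → ℕ} (hg : PolyBdd g) : ∃ d, ∀ n, g n < (n + 2) ^ d := by
  obtain ⟨d, hd⟩ := hg.add (const 1)
  exact ⟨d, fun n => Nat.lt_of_succ_le (hd n)⟩

end PolyBdd

namespace TMTape

theorem size_act_le (t : TMTape) (a : TapeSym × Dir) : (t.act a).size ≤ t.size + 1 := by
  rcases a with ⟨a, _ | _ | _⟩ <;> simp [act, move, size] <;> omega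

theorem size_ofWord_le (w : Word) : (ofWord w).size ≤ w.length + 1 := by
  simp [ofWord, size]; omega

end TMTape

namespace OracleTM

variable {M : OracleTM} {O : Language Bool}

theorem StepsIn.size_le {c d : M.Cfg} {m : ℕ} (h : M.StepsIn O m c d) (i : M.K) :
    (d.tape i).size ≤ (c.tape i).size + m := by
  induction h with
  | zero => simp
  | succ n c d e _ hs ih =>
    refine le_trans ?_ (Nat.add_le_add_right ih 1)
    cases hs with
    | move _ _ _ a => exact TMTape.size_act_le _ _
    | yes => exact Nat.le_succ _
    | no => exact Nat.le_succ _

theorem size_init_le (x : Word) (i : M.K) : ((M.init x).tape i).size ≤ x.length + 1 := by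
  simp only [init]
  split
  · exact TMTape.size_ofWord_le x
  · exact (TMTape.size_ofWord_le []).trans (by simp)

/-- A step records at most one new cell, so a tape has at most `x.length + 1` cells plus one for
each step. A single exponent then serves for time, space and the length of the input. -/
theorem PolyTime.bounded (h : M.PolyTime O) : ∃ d, ∀ x : Word,
    M.Bounded O (M.init x) ((x.length + 2) ^ d) ((x.length + 2) ^ d) ∧
      x.length ≤ (x.length + 2) ^ d := by
  obtain ⟨p, hp⟩ := h
  obtain ⟨d, hd⟩ := (PolyBdd.id.add (PolyBdd.const 1)).add (PolyBdd.eval p)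
  refine ⟨d, fun x => ?_⟩
  have h1 := hd x.length
  beta_reduce at h1
  refine ⟨fun m c hc => ?_, by omega⟩
  have h2 := hp x m c hc
  refine ⟨by omega, fun i => ?_⟩
  have h3 := hc.size_le i
  have h4 := M.size_init_le x i
  omega

/-- `PolySpace` promises only that a halting configuration is reached. By determinism that
computation bounds all others, so some time bound `n` exists for each input, with no control of its
size. -/
theorem PolySpace.bounded (hM : M.Deterministic) (h : M.PolySpace O) : ∃ d, ∀ x : Word,
    (∃ n, M.Bounded O (M.init x) n ((x.length + 2) ^ d)) ∧ x.length ≤ (x.length + 2) ^ d := by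
  obtain ⟨p, hp⟩ := h
  obtain ⟨d, hd⟩ := (PolyBdd.id).add (PolyBdd.eval p)
  refine ⟨d, fun x => ?_⟩
  have h1 := hd x.length
  beta_reduce at h1
  obtain ⟨h2, c, ⟨n, hn⟩, hc⟩ := hp x
  refine ⟨⟨n, fun m e he => ⟨(hM.steps_le hn hc he).1, fun i => ?_⟩⟩, by omega⟩
  refine (Finset.single_le_sum (f := fun i => (e.tape i).size) (fun _ _ => Nat.zero_le _)
    (Finset.mem_univ i)).trans ((h2 e ⟨m, he⟩).trans (by omega))

theorem polyTime_of_bounded {g : ℕ → ℕ} (hg : PolyBdd g)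
    (h : ∀ x : Word, ∃ B, M.Bounded O (M.init x) (g x.length) B) : M.PolyTime O := by
  obtain ⟨p, hp⟩ := hg.exists_polynomial
  refine ⟨p, fun x n c hc => ?_⟩
  obtain ⟨B, hB⟩ := h x
  exact (hB n c hc).1.trans (hp _)

theorem polySpace_of_bounded {g : ℕ → ℕ} (hg : PolyBdd g)
    (h : ∀ x : Word, ∃ n, M.Bounded O (M.init x) n (g x.length)) : M.PolySpace O := by
  obtain ⟨p, hp⟩ := (PolyBdd.const (Fintype.card M.K)).mul hg |>.exists_polynomial
  refine ⟨p, fun x => ?_⟩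
  obtain ⟨n, hn⟩ := h x
  refine ⟨?_, ?_⟩
  · rintro c ⟨m, hc⟩
    refine le_trans ?_ (hp _)
    refine (Finset.sum_le_card_nsmul _ _ _ fun i _ => (hn m c hc).2 i).trans ?_
    simp
  · obtain ⟨m, d, h1, h2⟩ := hn.exists_halted
    exact ⟨d, ⟨m, h1⟩, h2⟩

end OracleTM
end

noncomputable section
open scoped Classical

/-! ## Calling a machine -/

theorem OracleTM.Bounded.mono {M : OracleTM} {O : Language Bool} {c : M.Cfg} {n n' B B' : ℕ}
    (h : M.Bounded O c n B) (hn : n ≤ n') (hB : B ≤ B') : M.Bounded O c n' B' :=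
  fun m d hd => ⟨(h m d hd).1.trans hn, fun i => ((h m d hd).2 i).trans hB⟩

namespace Comp

variable {D : Type} {O : Language Bool} {qT : Tp D}

/-- The tapes of a machine with input `x` and clock `N`. -/
def base (x : Word) (N : ℕ) : Tp D → ATape :=
  Function.update (initTapes .I x) .T (.ofWord (ones N))

@[simp] theorem base_I (x : Word) (N : ℕ) : base (D := D) x N .I = .ofWord x := by
  simp [base, initTapes]
@[simp] theorem base_X (x : Word) (N : ℕ) : base (D := D) x N .X = .blank := by
  simp [base, initTapes]
@[simp] theorem base_T (x : Word) (N : ℕ) : base (D := D) x N .T = .ofWord (ones N) := by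
  simp [base]

theorem fits_initTapes {K : Type} (i : K) (x : Word) (B : ℕ) : Fits B (initTapes i x) := by
  intro k
  simp only [initTapes]
  split <;> simp [ATape.ofWord, ATape.blank]

theorem fits_base (x : Word) (N B : ℕ) : Fits B (base (D := D) x N) := by
  intro k
  by_cases h : k = .T
  · simp [base, h, ATape.ofWord]
  · rw [base, Function.update_of_ne h]
    exact fits_initTapes _ _ _ k

/-- Set up the clock and mark the origin. -/
def prep (d : ℕ) : Comp (Tp D) Unit := (clock .I .T .V d).bind fun _ => mark

@[simp] theorem prep_det (d : ℕ) : (prep d : Comp (Tp D) Unit).Det :=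
  bind_det (clock_det _ _ _ _) fun _ => mark_det
@[simp] theorem prep_free (d : ℕ) : (prep d : Comp (Tp D) Unit).Free :=
  bind_free (clock_free _ _ _ _) fun _ => mark_free

theorem spec_prep (x : Word) (d : ℕ) : (prep d).Spec O qT ⊤ (initTapes .I x)
    (clockTime x.length d + 1)
    {((), Tp.lay (base x ((x.length + 2) ^ d)) fun _ => .blank)} := by
  refine spec_bind_single (spec_clock (w := x) (by simp) (by simp) (by simp) ?_ ?_ ?_ d)
    (spec_mark ?_ ?_) <;> simp [initTapes]

/-- Run `M` on a copy of the word on the tape `src`. -/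
def call (M : OracleTM) (b : Bool) (e : M.K → D) (src : Tp D) : Comp (Tp D) Bool :=
  (dup src (.dat (e M.inTape))).bind fun _ => M.sim b e

theorem call_det {M : OracleTM} (h : M.Deterministic) (b : Bool) (e : M.K → D) (src : Tp D) :
    (call M b e src).Det := bind_det (dup_det _ _) fun _ => OracleTM.sim_det h b e

theorem call_free {M : OracleTM} (h : M.OracleFree) (b : Bool) (e : M.K → D) (src : Tp D) :
    (call M b e src).Free := bind_free (dup_free _ _) fun _ => OracleTM.sim_free h b e

theorem spec_call {M : OracleTM} {b : Bool} {O' : Language Bool} (hO : ∀ x, b :: x ∈ O' ↔ x ∈ O)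
    {B W n : ℕ} {x : Word} (hb : M.Bounded O (M.init x) n B) (hx : x.length ≤ B) {e : M.K → D}
    (he : Function.Injective e) (hq : qT = .dat (e M.queryTape)) {τ : Tp D → ATape} {src : Tp D}
    (hsrc : src.aux) (hw : (τ src).HasWord x)
    (hτ : ∀ k : Tp D, k.aux → ((τ k).pos.natAbs : ℕ∞) ≤ B) (hW : B + (2 * x.length + 3) ≤ W) :
    ∃ S : Set (Bool × (D → ATape)),
      (call M b e src).Spec O' qT W (Tp.lay τ fun _ => .blank) ((2 * x.length + 3) + (4 * n + 1))
        ((fun z => (z.1, Tp.lay τ z.2)) '' S) ∧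
      (∀ z ∈ S, (∀ d, (z.2 d).pos.natAbs ≤ B ∧ ∀ i, B < Int.natAbs i → (z.2 d).cells i = none) ∧
        (z.1 = true → ∃ c, M.AcceptsWith O x c ∧
          ∀ k, (z.2 (e k)).HasWord (c.tape k).word ∧ (c.tape k).word.length ≤ B)) ∧
      (∀ c, M.AcceptsWith O x c → ∃ z ∈ S, z.1 = true ∧ ∀ k, (z.2 (e k)).HasWord (c.tape k).word) ∧
      S.Nonempty ∧ (M.Deterministic → S.Subsingleton) := by
  subst hq
  obtain ⟨S, h1, h2⟩ := OracleTM.spec_sim hO hb hx he hτ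
  refine ⟨S, ?_, h2⟩
  have hne : src ≠ .dat (e M.inTape) := by rintro rfl; exact hsrc
  have hs : Tp.lay τ (fun _ => ATape.blank) src = τ src := by
    cases src <;> simp_all [Tp.aux, Tp.lay]
  have h3 := spec_dup (O := O') (qT := .dat (e M.queryTape)) hne (τ := Tp.lay τ fun _ => .blank)
    (w := x) (by rw [hs]; exact hw) rfl
  rw [Tp.lay_update_dat τ (fun _ => .blank) (e M.inTape) (.ofWord x) rfl] at h3
  exact spec_bind_single (h3.lift (b := B) (Tp.fits_lay hτ fun d => by simp [ATape.blank]) hW)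
    (Run.weaken h1 (by exact_mod_cast (by omega : B ≤ W)))

/-- A deterministic machine has exactly one outcome, so `S` is a singleton and the value of `f`
becomes an `Option`. The bounds on `P` are what `clean` needs, and the bound on the length of `y` is
what a further call on `y` needs. -/
theorem spec_call_computes {M : OracleTM} {b : Bool} {O' : Language Bool}
    (hO : ∀ x, b :: x ∈ O' ↔ x ∈ O) (hM : M.Deterministic) {f : Word →. Word} (hf : M.Computes O f)
    {B W n : ℕ} {x : Word} (hb : M.Bounded O (M.init x) n B) (hx : x.length ≤ B) {e : M.K → D}
    (he : Function.Injective e) (hq : qT = .dat (e M.queryTape)) {τ : Tp D → ATape} {src : Tp D}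
    (hsrc : src.aux) (hw : (τ src).HasWord x)
    (hτ : ∀ k : Tp D, k.aux → ((τ k).pos.natAbs : ℕ∞) ≤ B) (hW : B + (2 * x.length + 3) ≤ W) :
    ∃ (o : Option Word) (P : D → ATape), (∀ y, y ∈ f x ↔ o = some y) ∧
      (call M b e src).Spec O' qT W (Tp.lay τ fun _ => .blank) ((2 * x.length + 3) + (4 * n + 1))
        {(o.isSome, Tp.lay τ P)} ∧
      (∀ d, (P d).pos.natAbs ≤ B ∧ ∀ i, B < Int.natAbs i → (P d).cells i = none) ∧
      (∀ y, o = some y → (P (e M.outTape)).HasWord y ∧ y.length ≤ B) := by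
  obtain ⟨S, h1, h2, h3, h4, h5⟩ := spec_call hO hb hx he hq hsrc hw hτ hW
  obtain ⟨⟨r, P⟩, rfl⟩ := (h5 hM).eq_empty_or_singleton.resolve_left h4.ne_empty
  rw [Set.image_singleton] at h1
  obtain ⟨h6, h7⟩ := h2 _ rfl
  cases r with
  | false =>
    refine ⟨none, P, fun y => ?_, h1, h6, by simp⟩
    rw [hf]
    simp only [reduceCtorEq, iff_false]
    rintro ⟨c, hc, -⟩
    obtain ⟨z, rfl, h8, -⟩ := h3 c hc
    cases h8
  | true =>
    obtain ⟨c, hc, h8⟩ := h7 rfl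
    refine ⟨some (c.tape M.outTape).word, P, fun y => ?_, h1, h6, ?_⟩
    · rw [hf]
      constructor
      · rintro ⟨c', hc', rfl⟩
        obtain ⟨z, rfl, -, h9⟩ := h3 c' hc'
        exact congrArg some ((h8 _).1.unique (h9 _))
      · intro h
        cases h
        exact ⟨c, hc, rfl⟩
    · intro y h
      obtain rfl : (c.tape M.outTape).word = y := by simpa using h
      exact h8 _

end Comp

/-! ## Composition -/

/-- The tapes of two machines, with a common query tape. -/
abbrev Pair (M N : OracleTM) : Type := Option (M.K ⊕ N.K)

namespace Pair

variable (M N : OracleTM)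

/-- A component asks about one fixed tape, so the query tapes of both machines are identified; the
first letter of the query tells the oracles apart. -/
def fst (k : M.K) : Pair M N := if k = M.queryTape then none else some (.inl k)
def snd (k : N.K) : Pair M N := if k = N.queryTape then none else some (.inr k)

theorem fst_injective : Function.Injective (fst M N) := by
  intro a b h
  simp only [fst] at h
  split_ifs at h <;> simp_all

theorem snd_injective : Function.Injective (snd M N) := by
  intro a b h
  simp only [snd] at h
  split_ifs at h <;> simp_all

@[simp] theorem fst_query : fst M N M.queryTape = none := if_pos rfl
@[simp] theorem snd_query : snd M N N.queryTape = none := if_pos rfl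

end Pair

namespace OracleTM

open Comp

variable (F G : OracleTM)

/-- First `G`, then `F`. -/
def composeComp (d : ℕ) : Comp (Tp (Pair G F)) Unit :=
  (prep d).bind fun _ => (call G false (Pair.fst G F) .I).bind fun r =>
    if r = false then fail else
    (dup (.dat (Pair.fst G F G.outTape)) .X).bind fun _ => clean.bind fun _ =>
    (call F true (Pair.snd G F) .X).bind fun r => if r = false then fail else ret ()

variable {F G} {Of Og O : Language Bool} {f g : Word →. Word}

theorem composeComp_det (hF : F.Deterministic) (hG : G.Deterministic) (d : ℕ) :
    (composeComp F G d).Det := by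
  refine bind_det (prep_det _) fun _ => bind_det (call_det hG _ _ _) fun r => ?_
  split
  · simp
  · refine bind_det (dup_det _ _) fun _ => bind_det clean_det fun _ =>
      bind_det (call_det hF _ _ _) fun r => ?_
    split <;> simp

theorem composeComp_free (hF : F.OracleFree) (hG : G.OracleFree) (d : ℕ) :
    (composeComp F G d).Free := by
  refine bind_free (prep_free _) fun _ => bind_free (call_free hG _ _ _) fun r => ?_
  split
  · simp
  · refine bind_free (dup_free _ _) fun _ => bind_free clean_free fun _ =>
      bind_free (call_free hF _ _ _) fun r => ?_
    split <;> simp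

/-- The value of `G` is saved on `X` before `clean`, after which `F` finds blank tapes, including
the shared query tape. The clock exceeds the radius `Bg` of everything `G` has touched, so the
cleaning is complete. Times and radii are separate parameters: for polynomial space the times `ng`
and `nf` may be arbitrarily large. -/
theorem spec_composeComp (hOg : ∀ x, false :: x ∈ O ↔ x ∈ Og) (hOf : ∀ x, true :: x ∈ O ↔ x ∈ Of)
    (hG : G.Deterministic) (hF : F.Deterministic) (hg : G.Computes Og g) (hf : F.Computes Of f)
    {x : Word} {ng nf Bg Bf d : ℕ} (hbg : G.Bounded Og (G.init x) ng Bg) (hx : x.length ≤ Bg)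
    (hbf : ∀ y : Word, y.length ≤ Bg → F.Bounded Of (F.init y) nf Bf ∧ y.length ≤ Bf)
    (hN : Bg < (x.length + 2) ^ d) : ∃ S,
    (composeComp F G d).Spec O (.dat none) ((Bg + Bf + clockTime x.length d + 1 + (2 * Bg + 3) +
        (10 * (x.length + 2) ^ d + 10) : ℕ)) (initTapes .I x)
      ((clockTime x.length d + 1) + ((2 * Bg + 3) + (4 * ng + 1) + ((2 * Bg + 3) +
        (10 * (x.length + 2) ^ d + 10) + ((2 * Bg + 3) + (4 * nf + 1) + 1)))) S ∧
    ∀ y, y ∈ (f.comp g) x ↔ ∃ z ∈ S, (z.2 (.dat (Pair.snd G F F.outTape))).HasWord y := by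
  generalize hWdef : (Bg + Bf + clockTime x.length d + 1 + (2 * Bg + 3) +
        (10 * (x.length + 2) ^ d + 10) : ℕ) = W
  have hmem : ∀ z, z ∈ (f.comp g) x ↔ ∃ y ∈ g x, z ∈ f y := fun z => Part.mem_bind_iff
  have h1 := (spec_prep (D := Pair G F) (O := O) (qT := .dat none) x d).lift (b := 0)
    (fits_initTapes _ _ _) (B := W) (by omega)
  obtain ⟨o, P, ho, h2, h3, h4⟩ := spec_call_computes (O' := O) (qT := .dat none) hOg hG hg
    (W := W) hbg hx (Pair.fst_injective G F) (by simp)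
    (τ := base x ((x.length + 2) ^ d)) (src := .I) trivial
    (by simpa using ATape.hasWord_ofWord x) (fun k _ => fits_base _ _ _ k) (by omega)
  have h2 := h2.mono (m := (2 * Bg + 3) + (4 * ng + 1)) (by omega)
  cases o with
  | none =>
    have h5 : (fail : Comp (Tp (Pair G F)) Unit).Spec O (.dat none) W
        (Tp.lay (base x ((x.length + 2) ^ d)) P) ((2 * Bg + 3) +
        (10 * (x.length + 2) ^ d + 10) + ((2 * Bg + 3) + (4 * nf + 1) + 1)) ∅ :=
      Run.mono (spec_fail ((h2.fits_exit _ rfl))) (by omega)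
    refine ⟨∅, spec_bind_single h1 (spec_bind_single h2 h5), fun y => ?_⟩
    rw [hmem]
    simp [ho]
  | some y =>
    obtain ⟨h5, h6⟩ := h4 y rfl
    obtain ⟨hbf1, hbf2⟩ := hbf y h6
    have hτ : ∀ k : Tp (Pair G F), k.aux → ((Function.update (base x ((x.length + 2) ^ d)) .X
        (ATape.ofWord y) k).pos.natAbs : ℕ∞) ≤ (0 : ℕ) := fun k _ => by
      by_cases h : k = .X
      · simp [h, ATape.ofWord]
      · rw [Function.update_of_ne h]; exact fits_base _ _ _ k
    have h7 := spec_dup (O := O) (qT := .dat none) (a := .dat (Pair.fst G F G.outTape)) (b := .X)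
      (τ := Tp.lay (base x ((x.length + 2) ^ d)) P) (w := y) (by simp) h5 (base_X _ _)
    rw [Tp.lay_update _ _ (k := .X) trivial] at h7
    have h7 := (h7.lift (b := Bg) (B := W) (Tp.fits_lay (fun k _ => fits_base _ _ _ k)
      fun d => by exact_mod_cast (h3 d).1) (by omega)).mono (m := 2 * Bg + 3) (by omega)
    have h8 := (spec_clean (O := O) (qT := .dat none)
      (τ := Function.update (base x ((x.length + 2) ^ d)) .X (.ofWord y)) (P := P)
      (N := (x.length + 2) ^ d) (by simp) (fun d => ((h3 d).1).trans_lt hN)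
      fun d i hi => (h3 d).2 i (by omega)).lift (b := Bg) (B := W)
      (Tp.fits_lay (fun k hk => (hτ k hk).trans (by simp)) fun d => by exact_mod_cast (h3 d).1)
      (by omega)
    obtain ⟨o', P', ho', h9, h10, h11⟩ := spec_call_computes (O' := O) (qT := .dat none) hOf hF hf
      (W := W) hbf1 hbf2 (Pair.snd_injective G F) (by simp)
      (τ := Function.update (base x ((x.length + 2) ^ d)) .X (.ofWord y)) (src := .X) trivial
      (by simpa using ATape.hasWord_ofWord y) (fun k hk => (hτ k hk).trans (by simp)) (by omega)
    have h9 := h9.mono (m := (2 * Bg + 3) + (4 * nf + 1)) (by omega)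
    have hmem : ∀ z, z ∈ (f.comp g) x ↔ o' = some z := fun z => by
      rw [hmem]
      simp [ho, ho']
    cases o' with
    | none =>
      refine ⟨∅, spec_bind_single h1 (spec_bind_single h2 ((spec_bind_single h7
        (spec_bind_single h8 (spec_bind_single h9 (spec_fail (h9.fits_exit _ rfl))))).mono
        (by omega))), fun y => ?_⟩
      rw [hmem]
      simp
    | some z =>
      refine ⟨_, spec_bind_single h1 (spec_bind_single h2 ((spec_bind_single h7
        (spec_bind_single h8 (spec_bind_single h9 (spec_ret (h9.fits_exit _ rfl) ())))).mono
        (by omega))), fun y => ?_⟩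
      rw [hmem]
      have h12 := (h11 z rfl).1
      constructor
      · intro h
        cases h
        exact ⟨_, rfl, h12⟩
      · rintro ⟨_, rfl, h⟩
        exact congrArg some (h12.unique h)

end OracleTM

/-! ### Closure of the function classes under composition -/

theorem PolyBalanced.comp {f g : Word →. Word} (hf : PolyBalanced f) (hg : PolyBalanced g) :
    PolyBalanced (f.comp g) := by
  obtain ⟨pf, qf, hf⟩ := hf
  obtain ⟨pg, qg, hg⟩ := hg
  have mono : ∀ p : Polynomial ℕ, Monotone fun n => p.eval n := fun p => by
    induction p using Polynomial.induction_on' with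
    | add p q hp hq => simpa using hp.add hq
    | monomial n a =>
      intro b c h
      simpa using Nat.mul_le_mul_left a (Nat.pow_le_pow_left h n)
  refine ⟨pf.comp pg, qg.comp qf, fun x z hz => ?_⟩
  obtain ⟨y, hy, hz⟩ : ∃ y ∈ g x, z ∈ f y := Part.mem_bind_iff.1 hz
  simp only [Polynomial.eval_comp]
  exact ⟨(hf y z hz).1.trans (mono pf (hg x y hy).1), (hg x y hy).2.trans (mono qg (hf y z hz).2)⟩

open OracleTM Comp

theorem fPOracle_of_spec {D : Type} [Finite D] {C : Comp (Tp D) Unit} (hC : C.Det)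
    {O : Language Bool} {𝒞 : Set (Language Bool)} (hO : O ∈ 𝒞) {qT out : Tp D} {f : Word →. Word}
    (hf : PolyBalanced f) {n : ℕ → ℕ} (hn : PolyBdd n)
    (h : ∀ x : Word, ∃ S, C.Spec O qT ⊤ (initTapes .I x) (n x.length) S ∧
      ∀ y, y ∈ f x ↔ ∃ z ∈ S, (z.2 out).HasWord y) : f ∈ fPOracle 𝒞 := by
  choose S hS hS' using h
  have key := fun x => ((hS x).lift (fits_initTapes _ _ x.length) le_rfl).toTM (outT := out)
    (Nat.le_add_right _ _)
  refine ⟨hf, O, hO, C.toTM .I out qT, toTM_deterministic hC _ _ _,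
    polyTime_of_bounded hn fun x => ⟨_, (key x).1⟩, fun x y => ?_⟩
  rw [hS']
  exact ((key x).2.2 y).symm

/-- The running time is arbitrary here. The input may extend beyond the head radius `W`, so the
recorded cells are bounded with the radius `W + |x|`. -/
theorem fPSpace_of_spec {D : Type} [Finite D] {C : Comp (Tp D) Unit} (hC : C.Det) (hC' : C.Free)
    {qT out : Tp D} {f : Word →. Word} (hf : PolyBalanced f) {W : ℕ → ℕ} (hW : PolyBdd W)
    (h : ∀ x : Word, ∃ n S, C.Spec 0 qT (W x.length) (initTapes .I x) n S ∧
      ∀ y, y ∈ f x ↔ ∃ z ∈ S, (z.2 out).HasWord y) : f ∈ fPSpace := by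
  choose n S hS hS' using h
  have key := fun x => Spec.toTM (outT := out) (Run.weaken (hS x)
    (by exact_mod_cast Nat.le_add_right _ _ : (W x.length : ℕ∞) ≤ (W x.length + x.length : ℕ)))
    (Nat.le_add_left _ _)
  refine ⟨hf, C.toTM .I out qT, toTM_oracleFree hC' _ _ _, toTM_deterministic hC _ _ _,
    polySpace_of_bounded ((((hW.add .id).const_mul 2)).add (.const 1)) fun x => ⟨_, (key x).1⟩,
    fun x y => ?_⟩
  rw [hS']
  exact ((key x).2.2 y).symm

/-- The singletons fix the oracle of each factor. Any language whose halves, by first letter, are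
`Og` and `Of` can replace both of them. -/
theorem fPOracle_comp {𝒞 : Set (Language Bool)} {Of Og O : Language Bool} (hO : O ∈ 𝒞)
    (hOg : ∀ x, false :: x ∈ O ↔ x ∈ Og) (hOf : ∀ x, true :: x ∈ O ↔ x ∈ Of) {f g : Word →. Word}
    (hf : f ∈ fPOracle {Of}) (hg : g ∈ fPOracle {Og}) : f.comp g ∈ fPOracle 𝒞 := by
  obtain ⟨hf0, _, rfl, F, hF, hFt, hf⟩ := hf
  obtain ⟨hg0, _, rfl, G, hG, hGt, hg⟩ := hg
  obtain ⟨df, hdf⟩ := hFt.bounded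
  obtain ⟨dg, hdg⟩ := hGt.bounded
  obtain ⟨d, hd⟩ := PolyBdd.exists_pow (PolyBdd.poly dg)
  refine fPOracle_of_spec (composeComp_det hF hG d) hO (qT := .dat none)
    (out := .dat (Pair.snd G F F.outTape)) (hf0.comp hg0) (n := fun n =>
      (clockTime n d + 1) + ((2 * (n + 2) ^ dg + 3) + (4 * (n + 2) ^ dg + 1) +
        ((2 * (n + 2) ^ dg + 3) + (10 * (n + 2) ^ d + 10) +
          ((2 * (n + 2) ^ dg + 3) + (4 * ((n + 2) ^ dg + 2) ^ df + 1) + 1)))) ?_ fun x => ?_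
  · have h1 := PolyBdd.poly dg
    have h2 : PolyBdd fun n => ((n + 2) ^ dg + 2) ^ df := (h1.add (.const 2)).pow df
    have h3 := ((h1.const_mul 2).add (.const 3))
    exact ((PolyBdd.clockTime d).add (.const 1)).add ((h3.add ((h1.const_mul 4).add (.const 1))).add
      ((h3.add (((PolyBdd.poly d).const_mul 10).add (.const 10))).add
        ((h3.add ((h2.const_mul 4).add (.const 1))).add (.const 1))))
  · obtain ⟨S, h1, h2⟩ := spec_composeComp hOg hOf hG hF hg hf (hdg x).1 (hdg x).2
      (nf := ((x.length + 2) ^ dg + 2) ^ df) (Bf := ((x.length + 2) ^ dg + 2) ^ df)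
      (fun y hy => by
        have h := Nat.pow_le_pow_left (Nat.add_le_add_right hy 2) df
        exact ⟨(hdf y).1.mono h h, (hdf y).2.trans h⟩) (hd x.length)
    exact ⟨S, Run.weaken h1 le_top, h2⟩

theorem fPSpace_comp {f g : Word →. Word} (hf : f ∈ fPSpace) (hg : g ∈ fPSpace) :
    f.comp g ∈ fPSpace := by
  obtain ⟨hf0, F, hFf, hF, hFs, hf⟩ := hf
  obtain ⟨hg0, G, hGf, hG, hGs, hg⟩ := hg
  obtain ⟨df, hdf⟩ := hFs.bounded hF
  obtain ⟨dg, hdg⟩ := hGs.bounded hG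
  obtain ⟨d, hd⟩ := PolyBdd.exists_pow (PolyBdd.poly dg)
  -- The empty language is the join of itself with itself, so prefixed queries get the same answers.
  have h0 : ∀ b, ∀ x : Word, b :: x ∈ (0 : Language Bool) ↔ x ∈ (0 : Language Bool) := fun b x => by
    simp [Language.notMem_zero]
  refine fPSpace_of_spec (composeComp_det hF hG d) (composeComp_free hFf hGf d) (qT := .dat none)
    (out := .dat (Pair.snd G F F.outTape)) (hf0.comp hg0)
    (W := fun n => (n + 2) ^ dg + ((n + 2) ^ dg + 2) ^ df + clockTime n d + 1 +
      (2 * (n + 2) ^ dg + 3) + (10 * (n + 2) ^ d + 10)) ?_ fun x => ?_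
  · have h1 := PolyBdd.poly dg
    have h2 : PolyBdd fun n => ((n + 2) ^ dg + 2) ^ df := (h1.add (.const 2)).pow df
    exact ((((h1.add h2).add (.clockTime d)).add (.const 1)).add
      ((h1.const_mul 2).add (.const 3))).add (((PolyBdd.poly d).const_mul 10).add (.const 10))
  · obtain ⟨⟨ng, hng⟩, h1⟩ := hdg x
    choose n hn using fun y => (hdf y).1
    -- The times of `F` have no uniform bound, but only finitely many intermediate words are short
    -- enough to occur; `m` is a maximum over these.
    obtain ⟨m, hm⟩ := ((List.finite_length_le Bool ((x.length + 2) ^ dg)).image n).bddAbove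
    exact ⟨_, spec_composeComp (h0 false) (h0 true) hG hF hg hf hng h1 (nf := m)
      (Bf := ((x.length + 2) ^ dg + 2) ^ df) (fun y hy => by
        have h := Nat.pow_le_pow_left (Nat.add_le_add_right hy 2) df
        exact ⟨(hn y).mono (hm ⟨y, hy, rfl⟩) h, (hdf y).2.trans h⟩) (hd x.length)⟩
end

/-! ### Acceptance of languages by components -/

noncomputable section
open scoped Classical

namespace Comp

variable {K : Type} {O : Language Bool} {qT : K} {B : ℕ∞}

/-- Halt with acceptance if the value of `C` is `true`. -/
def guard (C : Comp K Bool) : Comp K Unit := C.bind fun r => if r = false then fail else ret ()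

theorem guard_det {C : Comp K Bool} (h : C.Det) : (guard C).Det :=
  bind_det h fun r => by split <;> simp
theorem guard_free {C : Comp K Bool} (h : C.Free) : (guard C).Free :=
  bind_free h fun r => by split <;> simp

theorem spec_guard {C : Comp K Bool} {τ : K → ATape} {n : ℕ} {S} (h : C.Spec O qT B τ n S) :
    (guard C).Spec O qT B τ (n + 1) {z | (true, z.2) ∈ S} := by
  refine Run.congr (spec_bind (m := 1)
    (G := fun e τ' => if e = false then ∅ else {((), τ')}) h fun e τ' he => ?_) ?_
  · cases e
    · exact spec_fail (h.fits_exit _ he)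
    · exact spec_ret (h.fits_exit _ he) ()
  · ext ⟨⟨⟩, τ'⟩
    simp

/-- Read a cell and move right. -/
def next (a : K) : Comp K TapeSym := one a fun s => (s, (s, .right))

@[simp] theorem next_free (a : K) : (next a).Free := one_free _ _

theorem spec_next (a : K) (τ : K → ATape) : (next a).Spec O qT ⊤ τ 1
    {((τ a).read, Function.update τ a ⟨(τ a).pos + 1, (τ a).cells⟩)} :=
  spec_one_top rfl (by rw [ATape.act_same _ rfl]; rfl)

end Comp

theorem ATape.HasWord.tail {t : ATape} {b : Bool} {w : Word} (h : t.HasWord (b :: w)) :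
    (⟨t.pos + 1, t.cells⟩ : ATape).HasWord w := by
  intro i hi
  have := h (i + 1) (by simpa using hi)
  simpa [add_assoc, add_comm (1 : ℤ)] using this

theorem ATape.HasWord.read_cons {t : ATape} {b : Bool} {w : Word} (h : t.HasWord (b :: w)) :
    t.read = some b := by
  simpa [ATape.read] using h 0 (by simp)

theorem ATape.HasWord.read_nil {t : ATape} (h : t.HasWord []) : t.read = none := by
  simpa [ATape.read] using h 0 (by simp)

open OracleTM Comp

theorem exists_accepts_of_spec {D : Type} [Finite D] {C : Comp (Tp D) Unit}
    {O L : Language Bool} {qT : Tp D} {n : ℕ → ℕ} (hn : PolyBdd n)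
    (h : ∀ x : Word, ∃ S, C.Spec O qT ⊤ (initTapes .I x) (n x.length) S ∧
      (x ∈ L ↔ S.Nonempty)) :
    ∃ M : OracleTM, (C.Free → M.OracleFree) ∧ M.PolyTime O ∧ M.Accepts O L := by
  choose S hS hS' using h
  have key := fun x => ((hS x).lift (fits_initTapes _ _ x.length) le_rfl).toTM (outT := .I)
    (Nat.le_add_right _ _)
  refine ⟨C.toTM .I .I qT, fun hC => toTM_oracleFree hC _ _ _,
    polyTime_of_bounded hn fun x => ⟨_, (key x).1⟩, fun x => ?_⟩
  rw [hS']
  exact (key x).2.1.symm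

/-! ## The classes `Σ_k` -/

/-- `L` serves as its own oracle: the machine puts the single question whether its input is in `L`,
with the input tape as query tape. -/
theorem sigmaP_subset_succ (k : ℕ) (hk : 1 ≤ k) : SigmaP k ⊆ SigmaP (k + 1) := by
  obtain ⟨k, rfl⟩ : ∃ j, k = j + 1 := ⟨k - 1, by omega⟩
  intro L hL
  obtain ⟨M, -, h⟩ := exists_accepts_of_spec (D := Empty) (C := guard ask) (O := L) (L := L)
    (qT := .I) (PolyBdd.const 2) fun x => by
      have hw : (initTapes (K := Tp Empty) .I x .I).HasWord x := by
        simpa [initTapes] using ATape.hasWord_ofWord x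
      refine ⟨_, spec_guard (spec_ask (fits_top _) (b := decide (x ∈ L)) ?_), ?_⟩
      · rw [decide_eq_true_iff]
        exact ⟨fun h => ⟨x, h, hw⟩, fun ⟨w, h, hw'⟩ => hw'.unique hw ▸ h⟩
      · by_cases h : x ∈ L <;> simp [h, Set.Nonempty]
  exact ⟨L, hL, M, h⟩

theorem sigmaP_mono {j k : ℕ} (hj : 1 ≤ j) (h : j ≤ k) : SigmaP j ⊆ SigmaP k := by
  induction k, h using Nat.le_induction with
  | base => exact subset_rfl
  | succ k hk ih => exact ih.trans (sigmaP_subset_succ k (hj.trans hk))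

/-- The join of two languages. -/
def joinLang (L₀ L₁ : Language Bool) : Language Bool :=
  {x : Word | ∃ y, (x = false :: y ∧ y ∈ L₀) ∨ (x = true :: y ∧ y ∈ L₁)}

theorem mem_joinLang {L₀ L₁ : Language Bool} {x : Word} :
    x ∈ joinLang L₀ L₁ ↔ ∃ y, (x = false :: y ∧ y ∈ L₀) ∨ (x = true :: y ∧ y ∈ L₁) := Iff.rfl

theorem false_cons_mem_joinLang {L₀ L₁ : Language Bool} (x : Word) :
    false :: x ∈ joinLang L₀ L₁ ↔ x ∈ L₀ := by simp [mem_joinLang]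

theorem true_cons_mem_joinLang {L₀ L₁ : Language Bool} (x : Word) :
    true :: x ∈ joinLang L₀ L₁ ↔ x ∈ L₁ := by simp [mem_joinLang]

namespace Comp

variable {D : Type} {O O' : Language Bool} {qT : Tp D}

theorem spec_guard_call {M : OracleTM} {b : Bool} {L : Language Bool} (hL : M.Accepts O L)
    (hO : ∀ x, b :: x ∈ O' ↔ x ∈ O)
    {B n : ℕ} {x : Word} (hb : M.Bounded O (M.init x) n B) (hx : x.length ≤ B) {e : M.K → D}
    (he : Function.Injective e) (hq : qT = .dat (e M.queryTape)) {τ : Tp D → ATape} {src : Tp D}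
    (hsrc : src.aux) (hw : (τ src).HasWord x)
    (hτ : ∀ k : Tp D, k.aux → ((τ k).pos.natAbs : ℕ∞) ≤ B) : ∃ S,
    (guard (call M b e src)).Spec O' qT ⊤ (Tp.lay τ fun _ => .blank)
      ((2 * x.length + 3) + (4 * n + 1) + 1) S ∧ (x ∈ L ↔ S.Nonempty) := by
  obtain ⟨S, h1, h2, h3, -⟩ := spec_call hO hb hx he hq hsrc hw hτ le_rfl
  refine ⟨_, spec_guard (Run.weaken h1 le_top), ?_⟩
  rw [hL]
  constructor
  · rintro ⟨c, hc⟩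
    obtain ⟨z, hz, h4, -⟩ := h3 c hc
    exact ⟨((), Tp.lay τ z.2), z, hz, Prod.ext h4 rfl⟩
  · rintro ⟨_, z, hz, h⟩
    obtain ⟨c, hc, -⟩ := (h2 z hz).2 (congrArg Prod.fst h)
    exact ⟨c, hc⟩

end Comp

namespace OracleTM

/-- Accepts the join of the languages of `M` and `N`. -/
def joinComp (M N : OracleTM) : Comp (Tp (Pair M N)) Unit :=
  mark.bind fun _ => (next .I).bind fun
    | none => fail
    | some false => guard (call M false (Pair.fst M N) .I)
    | some true => guard (call N true (Pair.snd M N) .I)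

theorem joinComp_free {M N : OracleTM} (hM : M.OracleFree) (hN : N.OracleFree) :
    (joinComp M N).Free := bind_free mark_free fun _ => bind_free (by simp) fun
  | none => by simp
  | some false => guard_free (call_free hM _ _ _)
  | some true => guard_free (call_free hN _ _ _)

end OracleTM

/-- The first letter decides whether `M` or `N` runs on the rest of the input, and the same letter
is put in front of the queries. This covers `NP`, where all oracles are empty, and the higher
levels, where `O` is a join. -/
theorem exists_accepts_joinLang {M N : OracleTM} {O₀ O₁ O L₀ L₁ : Language Bool}
    (hO₀ : ∀ x, false :: x ∈ O ↔ x ∈ O₀) (hO₁ : ∀ x, true :: x ∈ O ↔ x ∈ O₁) (hM : M.PolyTime O₀)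
    (hN : N.PolyTime O₁) (hL₀ : M.Accepts O₀ L₀) (hL₁ : N.Accepts O₁ L₁) :
    ∃ M' : OracleTM, (M.OracleFree → N.OracleFree → M'.OracleFree) ∧ M'.PolyTime O ∧
      M'.Accepts O (joinLang L₀ L₁) := by
  obtain ⟨d, hd⟩ := hM.bounded
  obtain ⟨e, he⟩ := hN.bounded
  have hn : PolyBdd fun n => 2 * n + 6 + 4 * ((n + 2) ^ d + (n + 2) ^ e) :=
    (((PolyBdd.id.const_mul 2).add (.const 6)).add (((PolyBdd.poly d).add (.poly e)).const_mul 4))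
  suffices h : ∀ x : Word, ∃ S, (joinComp M N).Spec O (.dat none) ⊤ (initTapes .I x)
      (2 * x.length + 7 + 4 * ((x.length + 2) ^ d + (x.length + 2) ^ e)) S ∧
      (x ∈ joinLang L₀ L₁ ↔ S.Nonempty) by
    obtain ⟨M', h1, h2⟩ := exists_accepts_of_spec (hn.add (.const 1)) (L := joinLang L₀ L₁)
      fun x => (h x).imp fun S hS => ⟨hS.1.mono (by omega), hS.2⟩
    exact ⟨M', fun hM hN => h1 (joinComp_free hM hN), h2⟩
  intro x
  have h1 := spec_mark (O := O) (qT := .dat none) (τ := initTapes (K := Tp (Pair M N)) .I x)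
    (by simp [initTapes]) (by simp [initTapes])
  have h2 := spec_next (O := O) (qT := .dat none) .I
    (Tp.lay (initTapes (K := Tp (Pair M N)) .I x) fun _ => .blank)
  rw [Tp.lay_update _ _ (k := .I) trivial] at h2
  have hI : Tp.lay (initTapes (K := Tp (Pair M N)) .I x) (fun _ => .blank) .I = .ofWord x := by
    simp [Tp.lay, initTapes]
  rw [hI] at h2
  generalize hτ : Function.update (initTapes (K := Tp (Pair M N)) .I x) .I
    ⟨(ATape.ofWord x).pos + 1, (ATape.ofWord x).cells⟩ = τ at h2
  -- After the first letter has been read, the head on `I` is at position 1.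
  have hpos : ∀ B : ℕ, 1 ≤ B → ∀ k : Tp (Pair M N), k.aux → ((τ k).pos.natAbs : ℕ∞) ≤ B := by
    intro B hB k _
    subst hτ
    by_cases h : k = .I
    · simpa [h, ATape.ofWord] using hB
    · rw [Function.update_of_ne h]; exact fits_initTapes _ _ _ _
  cases x with
  | nil =>
    refine ⟨∅, ((spec_bind_single h1 (spec_bind_single h2 ?_)).mono (n := 1 + (1 + 1)) (by omega)),
      by simp [mem_joinLang]⟩
    rw [ATape.HasWord.read_nil (ATape.hasWord_ofWord [])]
    exact spec_fail (fits_top _)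
  | cons b y =>
    have hw : (τ .I).HasWord y := by
      subst hτ
      simpa using (ATape.hasWord_ofWord (b :: y)).tail
    rw [(ATape.hasWord_ofWord (b :: y)).read_cons] at h2
    have hp1 := Nat.pow_le_pow_left (by simp : y.length + 2 ≤ (b :: y).length + 2) d
    have hp2 := Nat.pow_le_pow_left (by simp : y.length + 2 ≤ (b :: y).length + 2) e
    cases b with
    | false =>
      obtain ⟨S, h3, h4⟩ := spec_guard_call (qT := .dat none) hL₀ hO₀ (hd y).1 (hd y).2
        (Pair.fst_injective M N) (by simp) (src := .I) trivial hw (hpos _ (Nat.one_le_pow _ _ (by omega)))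
      exact ⟨S, (spec_bind_single h1 (spec_bind_single h2 h3)).mono
        (by simp only [List.length_cons] at *; omega), by rw [false_cons_mem_joinLang, h4]⟩
    | true =>
      obtain ⟨S, h3, h4⟩ := spec_guard_call (qT := .dat none) hL₁ hO₁ (he y).1 (he y).2
        (Pair.snd_injective M N) (by simp) (src := .I) trivial hw (hpos _ (Nat.one_le_pow _ _ (by omega)))
      exact ⟨S, (spec_bind_single h1 (spec_bind_single h2 h3)).mono
        (by simp only [List.length_cons] at *; omega), by rw [true_cons_mem_joinLang, h4]⟩

/-- Induction on the level: a join of languages in `NP` relative to `O₀` and `O₁` is in `NP`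
relative to the join of `O₀` and `O₁`, which lies one level lower. -/
theorem joinLang_mem_sigmaP {k : ℕ} (hk : 1 ≤ k) {L₀ L₁ : Language Bool} (h₀ : L₀ ∈ SigmaP k)
    (h₁ : L₁ ∈ SigmaP k) : joinLang L₀ L₁ ∈ SigmaP k := by
  induction k, hk using Nat.le_induction generalizing L₀ L₁ with
  | base =>
    obtain ⟨M, hMf, hM, hL₀⟩ := h₀
    obtain ⟨N, hNf, hN, hL₁⟩ := h₁
    obtain ⟨M', h1, h2⟩ := exists_accepts_joinLang (O := 0) (by simp [Language.notMem_zero])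
      (by simp [Language.notMem_zero]) hM hN hL₀ hL₁
    exact ⟨M', h1 hMf hNf, h2⟩
  | succ k hk ih =>
    obtain ⟨k, rfl⟩ : ∃ j, k = j + 1 := ⟨k - 1, by omega⟩
    obtain ⟨O₀, hO₀, M, hM, hL₀⟩ := h₀
    obtain ⟨O₁, hO₁, N, hN, hL₁⟩ := h₁
    obtain ⟨M', -, h2⟩ := exists_accepts_joinLang (O := joinLang O₀ O₁) false_cons_mem_joinLang
      true_cons_mem_joinLang hM hN hL₀ hL₁
    exact ⟨_, ih hO₀ hO₁, M', h2⟩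

theorem fPOracle_subset {𝒞 𝒟 : Set (Language Bool)} (h : 𝒞 ⊆ 𝒟) : fPOracle 𝒞 ⊆ fPOracle 𝒟 :=
  fun _ ⟨hf, O, hO, hM⟩ => ⟨hf, O, h hO, hM⟩

/-- Both oracles are raised to the level `max j k`, which contains their join. -/
theorem fPOracle_classPH_comp {f g : Word →. Word} (hf : f ∈ fPOracle classPH)
    (hg : g ∈ fPOracle classPH) : f.comp g ∈ fPOracle classPH := by
  obtain ⟨hf0, Of, ⟨j, hj, hOf⟩, hf⟩ := hf
  obtain ⟨hg0, Og, ⟨k, hk, hOg⟩, hg⟩ := hg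
  exact fPOracle_comp (𝒞 := classPH) (O := joinLang Og Of) ⟨max j k, hj.trans (le_max_left _ _),
    joinLang_mem_sigmaP (hj.trans (le_max_left _ _)) (sigmaP_mono hk (le_max_right _ _) hOg)
      (sigmaP_mono hj (le_max_left _ _) hOf)⟩ false_cons_mem_joinLang true_cons_mem_joinLang
    ⟨hf0, Of, rfl, hf⟩ ⟨hg0, Og, rfl, hg⟩
end

noncomputable section
open scoped Classical

/-! ## Languages of prefixes of preimages -/

/-- `parse w z` reads `z = 1 b₁ 1 b₂ … 1 bₖ 0 y` and returns `bₖ … b₁ w` and `y`. -/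
def parse (w : Word) : Word → Option (Word × Word)
  | true :: b :: z => parse (b :: w) z
  | false :: y => some (w, y)
  | _ => none

/-- Asks whether `w` (flag `0`) or some extension of `w` (flag `1`) is a preimage of `y`. -/
def prefixLang (f : Word →. Word) : Language Bool :=
  {u : Word | ∃ z w y, parse [] z = some (w, y) ∧
    ((u = false :: z ∧ y ∈ f w) ∨ (u = true :: z ∧ ∃ x, w <+: x ∧ y ∈ f x))}

namespace Comp

variable {K E : Type} {O : Language Bool} {qT : K}

/-- Within `n` steps all computations of `C` halt, and some computation accepts iff `p`. -/
def Acc (C : Comp K E) (O : Language Bool) (qT : K) (τ : K → ATape) (n : ℕ) (p : Prop) : Prop :=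
  ∃ S, C.Spec O qT ⊤ τ n S ∧ (p ↔ S.Nonempty)

theorem Acc.mono {C : Comp K E} {τ n p m} (h : C.Acc O qT τ n p) (hn : n ≤ m) : C.Acc O qT τ m p :=
  h.imp fun _ h => ⟨h.1.mono hn, h.2⟩

theorem Acc.congr {C : Comp K E} {τ n p p'} (h : C.Acc O qT τ n p) (hp : p' ↔ p) :
    C.Acc O qT τ n p' := h.imp fun _ h => ⟨h.1, hp.trans h.2⟩

theorem acc_fail {τ : K → ATape} : (fail : Comp K E).Acc O qT τ 1 False :=
  ⟨∅, spec_fail (fits_top _), by simp⟩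

theorem acc_bind [Fintype E] {E' : Type} {C : Comp K E} {D : E → Comp K E'} {τ n m S}
    {p : E → (K → ATape) → Prop} (h : C.Spec O qT ⊤ τ n S)
    (hD : ∀ e τ', (e, τ') ∈ S → (D e).Acc O qT τ' m (p e τ')) :
    (C.bind D).Acc O qT τ (n + m) (∃ e τ', (e, τ') ∈ S ∧ p e τ') := by
  choose! G hG hG' using hD
  refine ⟨_, spec_bind h hG, ?_⟩
  constructor
  · rintro ⟨e, τ', h1, h2⟩
    obtain ⟨z, hz⟩ := (hG' e τ' h1).1 h2
    exact ⟨z, e, τ', h1, hz⟩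
  · rintro ⟨z, e, τ', h1, hz⟩
    exact ⟨e, τ', h1, (hG' e τ' h1).2 ⟨z, hz⟩⟩

theorem acc_bind_single [Fintype E] {E' : Type} {C : Comp K E} {D : E → Comp K E'} {τ n m e τ' p}
    (h : C.Spec O qT ⊤ τ n {(e, τ')}) (hD : (D e).Acc O qT τ' m p) :
    (C.bind D).Acc O qT τ (n + m) p :=
  hD.imp fun _ hS => ⟨spec_bind_single h hS.1, hS.2⟩

theorem acc_bind_empty [Fintype E] {E' : Type} {C : Comp K E} {D : E → Comp K E'} {τ n}
    (h : C.Spec O qT ⊤ τ n ∅) : (C.bind D).Acc O qT τ n False :=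
  ⟨∅, spec_bind_empty h, by simp⟩

end Comp

/-- Tapes of which only the input tape, the work tape and the clock are in use. -/
def Tp.st {D : Type} (i x t : ATape) : Tp D → ATape
  | .I => i
  | .X => x
  | .T => t
  | _ => .blank

namespace Tp

variable {D : Type}

@[simp] theorem st_I (i x t : ATape) : st (D := D) i x t .I = i := rfl
@[simp] theorem st_X (i x t : ATape) : st (D := D) i x t .X = x := rfl
@[simp] theorem st_T (i x t : ATape) : st (D := D) i x t .T = t := rfl

@[simp] theorem update_st_I (i x t i' : ATape) :
    Function.update (st (D := D) i x t) .I i' = st i' x t := by funext k; cases k <;> simp [st]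
@[simp] theorem update_st_X (i x t x' : ATape) :
    Function.update (st (D := D) i x t) .X x' = st i x' t := by funext k; cases k <;> simp [st]
@[simp] theorem update_st_T (i x t t' : ATape) :
    Function.update (st (D := D) i x t) .T t' = st i x t' := by funext k; cases k <;> simp [st]

theorem initTapes_eq_st (x : Word) : Comp.initTapes (K := Tp D) .I x = st (.ofWord x) .blank .blank := by
  funext k; cases k <;> simp [Comp.initTapes, st]

theorem st_pos {i x t : ATape} {B : ℕ} (hi : i.pos.natAbs ≤ B) (hx : x.pos.natAbs ≤ B)
    (ht : t.pos.natAbs ≤ B) (k : Tp D) : ((st i x t k).pos.natAbs : ℕ∞) ≤ B := by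
  cases k <;> simp [st, ATape.blank, hi, hx, ht]

end Tp

/-! ### A nondeterministic machine for the language of prefixes -/

namespace Comp

variable {D : Type} {O O' : Language Bool} {qT : Tp D}

/-- Is the word on `I` the value of `M` on the word on `X`? -/
def verify (M : OracleTM) : Comp (Tp M.K) Unit :=
  mark.bind fun _ => (call M false id .X).bind fun r => if r = false then fail else
    guard (compare (.dat M.outTape) .I)

theorem verify_free {M : OracleTM} (hM : M.OracleFree) : (verify M).Free :=
  bind_free mark_free fun _ => bind_free (call_free hM _ _ _) fun r => by
    split
    · simp
    · exact guard_free (compare_free _ _)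

theorem acc_verify {M : OracleTM} (hO : ∀ x, false :: x ∈ O' ↔ x ∈ O) (hM : M.Deterministic)
    {f : Word →. Word} (hf : M.Computes O f) {B n : ℕ} {x y : Word}
    (hb : M.Bounded O (M.init x) n B) (hx : x.length ≤ B) {i u t : ATape} (hi : i.pos.natAbs ≤ B)
    (hu : u.pos.natAbs ≤ B) (ht : t.pos.natAbs ≤ B) (hiy : i.HasWord y) (hux : u.HasWord x) :
    (verify M).Acc O' (.dat M.queryTape) (Tp.st i u t)
      (1 + (((2 * x.length + 3) + (4 * n + 1)) + (y.length + 2))) (y ∈ f x) := by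
  obtain ⟨o, P, h1, h2, h3, h4⟩ := spec_call_computes (e := id) (qT := .dat M.queryTape) hO hM hf hb hx
    Function.injective_id rfl (τ := Tp.st i u t) (src := .X) trivial hux
    (fun k _ => Tp.st_pos hi hu ht k) le_rfl
  refine acc_bind_single (spec_mark (by simp [Tp.st]) (by simp [Tp.st]))
    (acc_bind_single (Run.weaken h2 le_top) ?_)
  rw [h1]
  cases o with
  | none => exact (acc_fail.mono (by omega)).congr (by simp)
  | some v =>
    obtain ⟨j, -, hj⟩ := spec_compare (O := O') (qT := .dat M.queryTape)
      (τ := Tp.lay (Tp.st i u t) P) (a := .dat M.outTape) (b := .I) (by simp)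
      (v := v) (w := y) (by simpa [Tp.lay] using (h4 v rfl).1) (by simpa [Tp.lay] using hiy)
    refine ⟨_, spec_guard hj, ?_⟩
    by_cases h : v = y <;> simp [h, Set.Nonempty]

/-- Continue to `parse` after the first letter. -/
def parseStep : TapeSym → Comp (Tp D) (Option Unit)
  | some false => ret (some ())
  | some true => (two .I .X fun s _ => (s, (s, .right), (s, .left))).bind fun s =>
      if s = none then fail else ret none
  | none => fail

/-- The loop that carries out `parse`. -/
def parseComp : Comp (Tp D) Unit := loop ((next .I).bind parseStep)

theorem parseComp_free : (parseComp (D := D)).Free :=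
  loop_free (bind_free (by simp) fun
    | some false => ret_free _
    | some true => bind_free (by simp) fun s => by split <;> simp
    | none => fail_free)

/-- Invariant: on `X` the word `w` ends at cell 0, and the head is on the cell to its left. A pair
`1 b` writes `b` there, which undoes the reversal in the code. On `I` the head advances until it
rests at the start of `y`. -/
theorem spec_parseComp (t : ATape) (c : ℤ → TapeSym) (w z : Word) (p : ℤ)
    (hz : (⟨p, c⟩ : ATape).HasWord z) :
    (parse w z = none → (parseComp).Spec O qT ⊤
      (Tp.st ⟨p, c⟩ ⟨-w.length, ATape.wordCells (1 - w.length) w⟩ t) (2 * z.length + 3) ∅) ∧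
    ∀ w' y, parse w z = some (w', y) → ∃ j : ℕ, j ≤ z.length ∧ (⟨p + j, c⟩ : ATape).HasWord y ∧
      y.length ≤ z.length ∧ w'.length ≤ w.length + z.length ∧ (parseComp).Spec O qT ⊤
      (Tp.st ⟨p, c⟩ ⟨-w.length, ATape.wordCells (1 - w.length) w⟩ t) (2 * z.length + 3)
      {((), Tp.st ⟨p + j, c⟩ ⟨-w'.length, ATape.wordCells (1 - w'.length) w'⟩ t)} := by
  have h1 := spec_next (O := O) (qT := qT) .I
    (Tp.st ⟨p, c⟩ ⟨-w.length, ATape.wordCells (1 - w.length) w⟩ t)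
  simp only [Tp.update_st_I, Tp.st_I] at h1
  induction w, z using parse.induct generalizing p with
  | case1 w b z ih =>
    rw [hz.read_cons] at h1
    have h2 : (two (Tp.I (D := D)) .X fun s _ => (s, (s, .right), (s, .left))).Spec O qT ⊤
        (Tp.st ⟨p + 1, c⟩ ⟨-w.length, ATape.wordCells (1 - w.length) w⟩ t) 1 {(some b,
          Tp.st ⟨p + 2, c⟩ ⟨-(b :: w).length, ATape.wordCells (1 - (b :: w).length) (b :: w)⟩ t)} := by
      refine spec_two_top (by simp) hz.tail.read_cons ?_
      rw [ATape.act_same _ rfl]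
      simp only [Tp.update_st_I, Tp.st_I, Tp.update_st_X, Tp.st_X, Dir.shift, ATape.act,
        hz.tail.read_cons]
      have e : (1 - w.length - 1 : ℤ) = -w.length := by ring
      have e' : (1 - (b :: w).length : ℤ) = -w.length := by simp
      rw [← e, ATape.wordCells_cons, e, ← e', add_assoc]
      congr 2
      ring
    have h3 : (parseStep (some true)).Spec O qT ⊤ _ (1 + 1) {((none : Option Unit), _)} :=
      spec_bind_single h2 (spec_ret (fits_top _) none)
    have h3 := spec_bind_single h1 h3
    have hz2 : (⟨p + 2, c⟩ : ATape).HasWord z := by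
      have := hz.tail.tail
      simpa [add_assoc] using this
    have h4 := ih (p + 2) hz2 (by
      have := spec_next (O := O) (qT := qT) .I (Tp.st ⟨p + 2, c⟩ ⟨-(b :: w).length,
        ATape.wordCells (1 - (b :: w).length) (b :: w)⟩ t)
      simpa only [Tp.update_st_I, Tp.st_I] using this)
    rw [parse]
    refine ⟨fun h => ?_, fun w' y h => ?_⟩
    · refine (spec_loop_next h3 (h4.1 h)).mono ?_
      simp only [List.length_cons]; omega
    · obtain ⟨j, h5, h6, h7, h8, h9⟩ := h4.2 w' y h
      refine ⟨j + 2, ?_, ?_, ?_, ?_, (spec_loop_next h3 h9).of_eq ?_ rfl ?_⟩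
      · simpa using h5
      · rw [Nat.cast_add, Nat.cast_ofNat, add_comm (j : ℤ), ← add_assoc]
        exact h6
      · simp only [List.length_cons]; omega
      · simp only [List.length_cons] at *; omega
      · simp only [List.length_cons]; omega
      · congr 3
        push_cast; congr 1; ring
  | case2 w y =>
    rw [hz.read_cons] at h1
    refine ⟨fun h => by simp [parse] at h, fun w' y' h => ?_⟩
    obtain ⟨rfl, rfl⟩ : w = w' ∧ y = y' := by simpa [parse] using h
    exact ⟨1, by simp, hz.tail, by simp, by omega,
      (spec_loop_exit (spec_bind_single (D := parseStep) h1
        (spec_ret (fits_top _) (some ())))).mono (by omega)⟩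
  | case3 z w hz1 hz2 =>
    have h0 : parse w z = none := by
      rw [parse] <;> assumption
    refine ⟨fun _ => ?_, fun w' y h => by simp [h0] at h⟩
    rcases z with _ | ⟨_ | _, _ | ⟨b, z⟩⟩
    · rw [hz.read_nil] at h1
      exact (spec_loop_fail (spec_bind_single (D := parseStep) h1 (spec_fail (fits_top _)))).mono
        (by simp)
    · exact absurd rfl (hz2 _)
    · exact absurd rfl (hz2 _)
    · rw [hz.read_cons] at h1
      have h2 : (two (Tp.I (D := D)) .X fun s _ => (s, (s, .right), (s, .left))).Spec O qT ⊤
        (Tp.st ⟨p + 1, c⟩ ⟨-w.length, ATape.wordCells (1 - w.length) w⟩ t) 1 {(none, _)} :=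
        spec_two_top (by simp) hz.tail.read_nil rfl
      have h3 : (parseStep (some true)).Spec O qT ⊤ _ (1 + 1) ∅ :=
        spec_bind_single h2 (spec_fail (fits_top _))
      exact (spec_loop_fail (spec_bind_single h1 h3)).mono (by simp)
    · exact absurd rfl (hz1 _ _)

/-- Move to the right end of the word that starts to the right of the head. -/
def toEnd : Comp (Tp D) Unit :=
  (next .X).bind fun _ => loop (one .X fun s => (if s = none then some () else none,
    (s, if s = none then .stay else .right)))

theorem toEnd_free : (toEnd (D := D)).Free := bind_free (by simp) fun _ => loop_free (by simp)

theorem spec_toEnd (i t : ATape) (w : Word) : (toEnd).Spec O qT ⊤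
    (Tp.st i ⟨-w.length, ATape.wordCells (1 - w.length) w⟩ t) (w.length + 2)
    {((), Tp.st i ⟨1, ATape.wordCells (1 - w.length) w⟩ t)} := by
  have h1 := spec_next (O := O) (qT := qT) .X
    (Tp.st i ⟨-w.length, ATape.wordCells (1 - w.length) w⟩ t)
  simp only [Tp.update_st_X, Tp.st_X] at h1
  have h := spec_loop_iterate (O := O) (qT := qT) (B := ⊤) (m := 1) (m' := 1)
    (C := one .X fun s => (if s = none then some () else none,
      (s, if s = none then .stay else .right)))
    (S := {((), Tp.st i ⟨1, ATape.wordCells (1 - w.length) w⟩ t)})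
    w.length (fun j => Tp.st i ⟨1 - w.length + j, ATape.wordCells (1 - w.length) w⟩ t) ?_ ?_
  · refine Run.mono (spec_bind_single h1 (h.of_eq le_rfl ?_ rfl)) (by omega)
    congr 2
    push_cast; ring
  · intro j hj
    have hne := ATape.wordCells_ne_none (s := 1 - w.length) (w := w) (i := 1 - w.length + j)
      (by omega) (by omega)
    refine spec_one_top (by simp [ATape.read, hne]) ?_
    rw [ATape.act_same _ rfl]
    simp only [Tp.update_st_X, Tp.st_X, ATape.read, hne, if_false, Dir.shift]
    congr 2
    push_cast; ring
  · have h0 : ATape.wordCells (1 - w.length) w 1 = none := ATape.wordCells_of_ge (by omega)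
    have e : (1 - w.length + w.length : ℤ) = 1 := by ring
    refine spec_loop_exit (spec_one_top (by simp [ATape.read, h0]) ?_)
    rw [ATape.act_same _ rfl]
    simp [ATape.read, h0, Dir.shift]

/-- Append a letter, or stop. -/
def guessStep : Comp (Tp D) (Option Unit) :=
  choose fun s => {z | z = (some (), fun k => (s k, .stay)) ∨ s .T ≠ none ∧ ∃ b : Bool,
    z = (none, Function.update (Function.update (fun k => (s k, .stay)) .T (s .T, .right)) .X
      (some b, .right))}

theorem spec_guessStep (i x t : ATape) : (guessStep).Spec O qT ⊤ (Tp.st i x t) 1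
    {z | z = (some (), Tp.st i x t) ∨ t.read ≠ none ∧ ∃ b : Bool,
      z = (none, Tp.st i (x.act (some b, .right)) ⟨t.pos + 1, t.cells⟩)} := by
  refine (spec_choose (fits_top _) fun _ _ => fits_top _).of_eq le_rfl rfl ?_
  have h : ∀ b : Bool, (fun k => (Tp.st (D := D) i x t k).act
      (Function.update (Function.update (fun k => ((Tp.st (D := D) i x t k).read, Dir.stay)) .T
        (t.read, .right)) .X (some b, .right) k)) =
      Tp.st i (x.act (some b, .right)) ⟨t.pos + 1, t.cells⟩ := fun b => by
    funext k
    cases k <;> simp [Tp.st, ATape.act_same, Dir.shift]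
  ext z
  simp only [Set.mem_image, Set.mem_ofPred_eq]
  constructor
  · rintro ⟨z, rfl | ⟨h1, b, rfl⟩, rfl⟩
    · simp
    · exact .inr ⟨h1, b, Prod.ext rfl (h b)⟩
  · rintro (rfl | ⟨h1, b, rfl⟩)
    · exact ⟨_, .inl rfl, by simp⟩
    · exact ⟨_, .inr ⟨h1, b, rfl⟩, Prod.ext rfl (h b)⟩

/-- Append a word, of at most the length of the clock. -/
def guess : Comp (Tp D) Unit := loop guessStep

theorem guess_free : (guess (D := D)).Free := loop_free (choose_free _)

/-- Induction on the number `m` of cells left on the clock. Stopping gives the empty suffix, going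
on writes one of the two letters; at the end of the clock only stopping is possible. -/
theorem spec_guess (i : ATape) (N m p : ℕ) (hm : p + m = N) (s : ℤ) (w : Word) : (guess).Spec O qT ⊤
    (Tp.st i ⟨s + w.length, ATape.wordCells s w⟩ ⟨p, ATape.wordCells 0 (ones N)⟩) (m + 1)
    {z | ∃ v : Word, v.length ≤ m ∧ z = ((), Tp.st i ⟨s + (w ++ v).length, ATape.wordCells s (w ++ v)⟩
      ⟨(p + v.length : ℕ), ATape.wordCells 0 (ones N)⟩)} := by
  induction m generalizing w p with
  | zero =>
    have h1 := spec_guessStep (O := O) (qT := qT) i ⟨s + w.length, ATape.wordCells s w⟩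
      ⟨p, ATape.wordCells 0 (ones N)⟩
    have h0 : ATape.wordCells 0 (ones N) p = none := ATape.wordCells_of_ge (by simp; omega)
    have h2 : (guessStep).Spec O qT ⊤ _ 1 {(some (), Tp.st i ⟨s + w.length, ATape.wordCells s w⟩
        ⟨p, ATape.wordCells 0 (ones N)⟩)} := h1.of_eq le_rfl rfl (by ext z; simp [ATape.read, h0])
    refine (spec_loop_exit h2).of_eq le_rfl rfl ?_
    ext z
    simp
  | succ m ih =>
    have h1 := spec_guessStep (O := O) (qT := qT) i ⟨s + w.length, ATape.wordCells s w⟩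
      ⟨p, ATape.wordCells 0 (ones N)⟩
    have h0 : ATape.wordCells 0 (ones N) p ≠ none := ATape.wordCells_ne_none (by simp) (by simp; omega)
    have h2 : ∀ b, (⟨s + w.length, ATape.wordCells s w⟩ : ATape).act (some b, .right) =
        ⟨s + (w ++ [b]).length, ATape.wordCells s (w ++ [b])⟩ := fun b => by
      rw [ATape.act, ATape.wordCells_append s w b _ rfl]
      simp [Dir.shift, add_assoc]
    simp only [h2] at h1
    -- The outcomes after the first letter must be a function of the tapes alone, so the letter is
    -- quantified existentially.
    refine ((spec_loop h1 (m := m + 1) (G := fun τ' => {z | ∃ b : Bool, τ' = Tp.st i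
      ⟨s + (w ++ [b]).length, ATape.wordCells s (w ++ [b])⟩ ⟨p + 1, ATape.wordCells 0 (ones N)⟩ ∧
      ∃ v : Word, v.length ≤ m ∧ z = ((), Tp.st i
        ⟨s + (w ++ [b] ++ v).length, ATape.wordCells s (w ++ [b] ++ v)⟩
        ⟨(p + 1 + v.length : ℕ), ATape.wordCells 0 (ones N)⟩)}) ?_)).of_eq (by omega) rfl ?_
    · rintro τ' (h | ⟨-, b, h⟩)
      · cases h
      · obtain rfl := (Prod.ext_iff.1 h).2
        have h3 := ih (p + 1) (by omega) (w ++ [b])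
        refine h3.of_eq le_rfl (by simp) ?_
        ext z
        constructor
        · rintro ⟨v, hv, rfl⟩
          exact ⟨b, rfl, v, hv, rfl⟩
        · rintro ⟨b', hb', v, hv, rfl⟩
          -- The letter just written stands to the left of the head, so the tapes determine it.
          have h4 := congrArg (fun σ => ATape.read ⟨(σ .X).pos - 1, (σ .X).cells⟩) hb'
          have h5 : ∀ b, ATape.wordCells s (w ++ [b]) (s + w.length) = some b := fun b => by
            rw [ATape.wordCells_add]; simp
          have h6 : (s + (w.length + 1) - 1 : ℤ) = s + w.length := by ring
          obtain rfl : b = b' := by simpa [ATape.read, h6, h5] using h4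
          exact ⟨v, hv, rfl⟩
    · ext ⟨⟨⟩, σ⟩
      constructor
      · rintro ((h | ⟨-, b, h⟩) | ⟨τ', -, b, -, v, hv, h⟩)
        · exact ⟨[], by simp, by simpa using h⟩
        · cases (Prod.ext_iff.1 h).1
        · exact ⟨b :: v, by simpa using hv, by rw [h]; simp [add_assoc, add_comm (1 : ℤ)]⟩
      · rintro ⟨v, hv, h⟩
        cases v with
        | nil => exact .inl (.inl (by simpa using h))
        | cons b v =>
          refine .inr ⟨_, .inr ⟨h0, b, rfl⟩, b, rfl, v, by simpa using hv, ?_⟩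
          rw [h]; simp [add_assoc, add_comm (1 : ℤ)]

end Comp
end

/-! ### Prefix languages in the polynomial hierarchy -/

noncomputable section
open scoped Classical
open OracleTM Comp

namespace Comp

variable {D : Type} {O O' : Language Bool} {qT : Tp D}

/-- Append a word if `b`. -/
def guessIf (b : Bool) : Comp (Tp D) Unit := if b then guess else ret ()

theorem guessIf_free (b : Bool) : (guessIf b : Comp (Tp D) Unit).Free := by
  cases b
  · exact ret_free _
  · exact guess_free

theorem spec_guessIf (b : Bool) (i : ATape) (N : ℕ) (w : Word) : (guessIf b).Spec O qT ⊤
    (Tp.st i ⟨1, ATape.wordCells (1 - w.length) w⟩ (.ofWord (ones N))) (N + 1)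
    {z | ∃ v : Word, v.length ≤ N ∧ (b = false → v = []) ∧ z = ((), Tp.st i
      ⟨1 + v.length, ATape.wordCells (1 - w.length) (w ++ v)⟩
      ⟨v.length, ATape.wordCells 0 (ones N)⟩)} := by
  cases b with
  | false =>
    refine Run.mono ((spec_ret (fits_top _) ()).of_eq le_rfl rfl ?_) (by omega : 1 ≤ N + 1)
    ext z
    simp [ATape.ofWord]
  | true =>
    refine (spec_guess i N N 0 (by simp) (1 - w.length) w).of_eq le_rfl ?_ ?_
    · simp [ATape.ofWord]
    · have e : ∀ v : Word, (1 - w.length + (w ++ v).length : ℤ) = 1 + v.length := fun v => by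
        simp; ring
      ext z
      simp only [e]
      simp

/-- Accepts `prefixLang f` if `M` computes `f`. -/
def prefixComp (M : OracleTM) (d : ℕ) : Comp (Tp M.K) Unit :=
  (clock .I .T .V d).bind fun _ => (next .I).bind fun
    | none => fail
    | some b => parseComp.bind fun _ => toEnd.bind fun _ => (guessIf b).bind fun _ =>
        (rewind .X).bind fun _ => verify M

theorem prefixComp_free {M : OracleTM} (hM : M.OracleFree) (d : ℕ) : (prefixComp M d).Free :=
  bind_free (clock_free _ _ _ _) fun _ => bind_free (by simp) fun
    | none => fail_free
    | some b => bind_free parseComp_free fun _ => bind_free toEnd_free fun _ =>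
      bind_free (guessIf_free b) fun _ => bind_free (rewind_free _) fun _ => verify_free hM

/-- Preimages of `y` have length at most `N`, so the quantifier over all extensions reduces to
suffixes within reach of the clock. The flag `0` is the case of the empty suffix. -/
theorem mem_prefixLang_cons {f : Word →. Word} {b : Bool} {z w y : Word}
    (h : parse [] z = some (w, y)) {N : ℕ} (hN : ∀ x, y ∈ f x → x.length ≤ N) :
    b :: z ∈ prefixLang f ↔ ∃ v : Word, v.length ≤ N ∧ (b = false → v = []) ∧ y ∈ f (w ++ v) := by
  have h1 : b :: z ∈ prefixLang f ↔ (b = false ∧ y ∈ f w) ∨ (b = true ∧ ∃ x, w <+: x ∧ y ∈ f x) := by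
    constructor
    · rintro ⟨z', w', y', h2, ⟨h3, h4⟩ | ⟨h3, h4⟩⟩ <;> cases h3 <;>
        obtain ⟨rfl, rfl⟩ : w = w' ∧ y = y' := by simpa [h] using h2
      · exact .inl ⟨rfl, h4⟩
      · exact .inr ⟨rfl, h4⟩
    · rintro (⟨rfl, h2⟩ | ⟨rfl, h2⟩)
      · exact ⟨z, w, y, h, .inl ⟨rfl, h2⟩⟩
      · exact ⟨z, w, y, h, .inr ⟨rfl, h2⟩⟩
  rw [h1]
  constructor
  · rintro (⟨rfl, h2⟩ | ⟨rfl, x, ⟨v, rfl⟩, h2⟩)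
    · exact ⟨[], by simp, fun _ => rfl, by simpa using h2⟩
    · exact ⟨v, by have := hN _ h2; simp at this; omega, by simp, h2⟩
  · rintro ⟨v, -, h2, h3⟩
    cases b with
    | false =>
      obtain rfl := h2 rfl
      exact .inl ⟨rfl, by simpa using h3⟩
    | true => exact .inr ⟨rfl, _, ⟨v, rfl⟩, h3⟩

theorem not_mem_prefixLang_cons {f : Word →. Word} {b : Bool} {z : Word} (h : parse [] z = none) :
    b :: z ∉ prefixLang f := by
  rintro ⟨z', w', y', h2, ⟨h3, h4⟩ | ⟨h3, h4⟩⟩ <;> cases h3 <;> simp [h] at h2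

theorem nil_not_mem_prefixLang {f : Word →. Word} : [] ∉ prefixLang f := by
  rintro ⟨z', w', y', h2, ⟨h3, h4⟩ | ⟨h3, h4⟩⟩ <;> cases h3

/-- The guess produces one branch for each suffix `v`; the branch runs `M` on `w ++ v` and compares
the value with `y`. An accepting branch exists exactly when the bounded quantifier of
`mem_prefixLang_cons` is satisfied. The time bound lists the stages in their order. -/
theorem acc_prefixComp {M : OracleTM} (hO : ∀ x, false :: x ∈ O' ↔ x ∈ O) (hM : M.Deterministic)
    {f : Word →. Word} (hf : M.Computes O f) {B n d : ℕ} {u : Word}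
    (hb : ∀ x : Word, x.length ≤ u.length + (u.length + 2) ^ d →
      M.Bounded O (M.init x) n B ∧ x.length ≤ B)
    (hB : u.length + (u.length + 2) ^ d ≤ B)
    (hd : ∀ x y : Word, y ∈ f x → x.length ≤ (y.length + 2) ^ d) :
    (prefixComp M d).Acc O' (.dat M.queryTape) (initTapes .I u)
      (clockTime u.length d + (1 + ((2 * u.length + 3) + ((u.length + 2) + (((u.length + 2) ^ d + 1) +
        ((u.length + (u.length + 2) ^ d + 2) + (1 + (((2 * (u.length + (u.length + 2) ^ d) + 3) +
          (4 * n + 1)) + (u.length + 2)))))))))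
      (u ∈ prefixLang f) := by
  have h1 := spec_clock (O := O') (qT := .dat M.queryTape) (a := .I) (t := .T) (v := .V)
    (τ := initTapes (K := Tp M.K) .I u) (w := u) (by simp) (by simp) (by simp) (by simp [initTapes])
    (by simp [initTapes]) (by simp [initTapes]) d
  generalize hN : (u.length + 2) ^ d = N at *
  rw [Tp.initTapes_eq_st, Tp.update_st_T] at h1
  have h2 := spec_next (O := O') (qT := .dat M.queryTape) .I
    (Tp.st (D := M.K) (.ofWord u) .blank (.ofWord (ones N)))
  simp only [Tp.update_st_I, Tp.st_I] at h2
  rw [Tp.initTapes_eq_st]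
  refine acc_bind_single h1 ?_
  cases u with
  | nil =>
    rw [ATape.HasWord.read_nil (ATape.hasWord_ofWord [])] at h2
    exact (acc_bind_single h2 (acc_fail.mono (by omega))).congr (by simpa using nil_not_mem_prefixLang)
  | cons b z =>
    rw [(ATape.hasWord_ofWord (b :: z)).read_cons] at h2
    refine acc_bind_single h2 ?_
    have h3 := spec_parseComp (O := O') (qT := .dat M.queryTape) (.ofWord (ones N)) _ [] z _
      (ATape.hasWord_ofWord (b :: z)).tail
    have e : (⟨-([] : Word).length, ATape.wordCells (1 - ([] : Word).length) []⟩ : ATape) = .blank := by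
      simp [ATape.blank]
    rw [e] at h3
    simp only [List.length_cons] at *
    rcases hp : parse [] z with _ | ⟨w, y⟩
    · exact ((acc_bind_empty (h3.1 hp)).mono (by omega)).congr
        (by simpa using not_mem_prefixLang_cons hp)
    · obtain ⟨j, hj, h4, h5, h6, h7⟩ := h3.2 w y hp
      have h6 : w.length ≤ z.length := by simpa using h6
      -- The clock was set from the whole input, which is longer than `y`.
      have hyN : ∀ x, y ∈ f x → x.length ≤ N := fun x hx =>
        (hd x y hx).trans (hN ▸ Nat.pow_le_pow_left (by omega) d)
      refine (acc_bind_single (h7.mono (by omega)) (acc_bind_single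
        ((spec_toEnd _ _ w).mono (by omega : w.length + 2 ≤ z.length + 1 + 2))
        -- The guessed suffix is visible only through the tapes: the candidate is the word on `X`
        -- that starts at `1 - w.length`.
        (acc_bind (spec_guessIf b _ N w) (p := fun _ τ' => ∃ x,
          (⟨1 - w.length, (τ' .X).cells⟩ : ATape).HasWord x ∧ y ∈ f x) ?_))).congr ?_
      · rintro ⟨⟩ τ' ⟨v, hv, -, hτ'⟩
        obtain rfl := (Prod.ext_iff.1 hτ').2
        have h8 := spec_rewind (O := O') (qT := .dat M.queryTape) (a := .X) (τ := Tp.st (D := M.K)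
          ⟨(ATape.ofWord (b :: z)).pos + 1 + j, (ATape.ofWord (b :: z)).cells⟩
          ⟨1 + v.length, ATape.wordCells (1 - w.length) (w ++ v)⟩
          ⟨v.length, ATape.wordCells 0 (ones N)⟩) (1 - w.length) (w ++ v).length
          (by simp; ring) (fun i hi hi' => ATape.wordCells_ne_none hi hi')
          (ATape.wordCells_of_lt _ (by omega))
        simp only [Tp.update_st_X, Tp.st_X] at h8
        have hw := ATape.hasWord_wordCells (1 - w.length) (w ++ v)
        have hl : (w ++ v).length ≤ z.length + 1 + N := by simp; omega
        obtain ⟨hb1, hb2⟩ := hb (w ++ v) hl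
        refine ((acc_bind_single h8 (acc_verify hO hM hf hb1 hb2 ?_ ?_ ?_ h4 hw)).mono ?_).congr ?_
        · simp [ATape.ofWord]; omega
        · simp; omega
        · simp; omega
        · omega
        · exact ⟨fun ⟨x, hx, hx'⟩ => hw.unique hx ▸ hx', fun h => ⟨_, hw, h⟩⟩
      · rw [mem_prefixLang_cons hp hyN]
        constructor
        · rintro ⟨v, hv, hb, h⟩
          exact ⟨(), _, ⟨v, hv, hb, rfl⟩, w ++ v, ATape.hasWord_wordCells _ _, h⟩
        · rintro ⟨e, τ', ⟨v, hv, hb, hτ'⟩, x, hx, h⟩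
          obtain rfl := (Prod.ext_iff.1 hτ').2
          exact ⟨v, hv, hb, (ATape.hasWord_wordCells _ _).unique hx ▸ h⟩

end Comp

theorem PolyBalanced.exists_pow {f : Word →. Word} (hf : PolyBalanced f) : ∃ d, ∀ x y : Word,
    y ∈ f x → x.length ≤ (y.length + 2) ^ d := by
  obtain ⟨p, q, h⟩ := hf
  exact (PolyBdd.eval q).imp fun d hd x y hy => (h x y hy).2.trans (hd _)

theorem exists_accepts_prefixLang {M : OracleTM} {O O' : Language Bool}
    (hO : ∀ x, false :: x ∈ O' ↔ x ∈ O) (hM : M.Deterministic) (ht : M.PolyTime O)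
    {f : Word →. Word} (hf : M.Computes O f) (hb : PolyBalanced f) : ∃ M' : OracleTM,
    (M.OracleFree → M'.OracleFree) ∧ M'.PolyTime O' ∧ M'.Accepts O' (prefixLang f) := by
  obtain ⟨d, hd⟩ := hb.exists_pow
  obtain ⟨e, he⟩ := ht.bounded
  have h1 := PolyBdd.poly d
  have h2 := PolyBdd.id
  have h3 : PolyBdd fun n => (n + (n + 2) ^ d + 2) ^ e := ((h2.add h1).add (.const 2)).pow e
  have hn := (PolyBdd.clockTime d).add ((PolyBdd.const 1).add (((h2.const_mul 2).add (.const 3)).add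
    ((h2.add (.const 2)).add ((h1.add (.const 1)).add (((h2.add h1).add (.const 2)).add
      ((PolyBdd.const 1).add (((((h2.add h1).const_mul 2).add (.const 3)).add
        ((h3.const_mul 4).add (.const 1))).add (h2.add (.const 2)))))))))
  obtain ⟨M', h4, h5⟩ := exists_accepts_of_spec hn fun u => acc_prefixComp hO hM hf
    -- A candidate has at most `|u| + (|u| + 2) ^ d` letters, and `e` is the exponent of the time of
    -- `M`. The radius also contains this length itself, because the heads have moved over the code
    -- and the guess.
    (n := (u.length + (u.length + 2) ^ d + 2) ^ e)
    (B := (u.length + (u.length + 2) ^ d + 2) ^ e + (u.length + (u.length + 2) ^ d))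
    (fun x hx => by
      have h := Nat.pow_le_pow_left (Nat.add_le_add_right hx 2) e
      exact ⟨(he x).1.mono h (h.trans (Nat.le_add_right _ _)), hx.trans (Nat.le_add_left _ _)⟩)
    (Nat.le_add_left _ _) hd
  exact ⟨M', fun h => h4 (prefixComp_free h d), h5⟩

theorem prefixLang_mem_NP {f : Word →. Word} (hf : f ∈ fP) : prefixLang f ∈ SigmaP 1 := by
  obtain ⟨hb, M, hMf, hM, ht, hf⟩ := hf
  obtain ⟨M', h1, h2⟩ := exists_accepts_prefixLang (O' := 0) (by simp [Language.notMem_zero])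
    hM ht hf hb
  exact ⟨M', h1 hMf, h2⟩

/-- Simulated queries carry a letter in front, so `O` is replaced by `joinLang O O`, which lies at
the same level. -/
theorem prefixLang_mem_sigmaP {k : ℕ} (hk : 1 ≤ k) {f : Word →. Word}
    (hf : f ∈ fPOracle (SigmaP k)) : prefixLang f ∈ SigmaP (k + 1) := by
  obtain ⟨hb, O, hO, M, hM, ht, hf⟩ := hf
  obtain ⟨M', -, h2⟩ := exists_accepts_prefixLang (O' := joinLang O O) false_cons_mem_joinLang
    hM ht hf hb
  obtain ⟨k, rfl⟩ : ∃ j, k = j + 1 := ⟨k - 1, by omega⟩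
  exact ⟨_, joinLang_mem_sigmaP hk hO hO, M', h2⟩
end

noncomputable section
open scoped Classical
open OracleTM Comp

/-! ## Least preimages -/

theorem Word.le_of_prefix {v w : Word} (h : v <+: w) : v ≤ w := by
  obtain ⟨u, rfl⟩ := h
  induction v with
  | nil => exact not_lt.1 (List.not_lt_nil u)
  | cons a v ih => exact List.cons_le_cons a ih

theorem Word.append_false_lt (w u v : Word) : w ++ false :: u < w ++ true :: v := by
  induction w with
  | nil => exact List.Lex.rel (by decide)
  | cons a w ih => exact List.Lex.cons ih

/-- The least preimage. -/
def minPreimage (f : Word →. Word) : Word →. Word :=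
  fun y => ⟨∃ x, IsLeast {z : Word | y ∈ f z} x, fun h => h.choose⟩

theorem mem_minPreimage {f : Word →. Word} {x y : Word} :
    x ∈ minPreimage f y ↔ IsLeast {z : Word | y ∈ f z} x :=
  ⟨fun ⟨h, h'⟩ => h' ▸ h.choose_spec, fun h => ⟨⟨x, h⟩, IsLeast.unique (Exists.choose_spec ⟨x, h⟩) h⟩⟩

theorem isMinPreimage_minPreimage (f : Word →. Word) : IsMinPreimage (minPreimage f) f :=
  fun _ _ => mem_minPreimage

/-- Balance bounds the length of an argument in terms of the length of its value. Finiteness is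
essential, since the dictionary order on words is not well-founded. -/
theorem PolyBalanced.finite_preimage {f : Word →. Word} (hf : PolyBalanced f) (y : Word) :
    {z : Word | y ∈ f z}.Finite := by
  obtain ⟨d, hd⟩ := hf.exists_pow
  exact (List.finite_length_le Bool ((y.length + 2) ^ d)).subset fun z hz => hd z y hz

theorem PolyBalanced.exists_isLeast {f : Word →. Word} (hf : PolyBalanced f) {x y : Word}
    (h : y ∈ f x) : ∃ x, IsLeast {z : Word | y ∈ f z} x := by
  obtain ⟨z, h1, h2⟩ := Set.exists_min_image {z : Word | y ∈ f z} id (hf.finite_preimage y) ⟨x, h⟩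
  exact ⟨z, h1, fun w hw => h2 w hw⟩

theorem PolyBalanced.of_preimage {f f' : Word →. Word} (hf : PolyBalanced f)
    (h : ∀ x y, x ∈ f' y → y ∈ f x) : PolyBalanced f' := by
  obtain ⟨p, q, hf⟩ := hf
  exact ⟨q, p, fun y x hx => (hf x y (h x y hx)).symm⟩

/-- `f'` sends `f x` to some preimage of `f x`, and `f` sends this back to `f x`. Minimality plays
no part, so the same argument serves the search in polynomial space. -/
theorem isInverse_of_preimage {f f' : Word →. Word} (h : ∀ x y, x ∈ f' y → y ∈ f x)
    (h' : ∀ x y, y ∈ f x → ∃ z, z ∈ f' y) : IsInverse f' f := by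
  refine PFun.ext fun x y => ?_
  have : y ∈ (f * f' * f) x ↔ ∃ v ∈ f x, ∃ u ∈ f' v, y ∈ f u :=
    Part.mem_bind_iff.trans (exists_congr fun v => and_congr_right fun _ => Part.mem_bind_iff)
  rw [this]
  constructor
  · rintro ⟨v, hv, u, hu, hy⟩
    exact Part.mem_unique (h u v hu) hy ▸ hv
  · intro hy
    obtain ⟨z, hz⟩ := h' x y hy
    exact ⟨y, hy, z, hz, h z y hz⟩

theorem PolyBalanced.isInverse_minPreimage {f : Word →. Word} (hf : PolyBalanced f) :
    IsInverse (minPreimage f) f :=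
  isInverse_of_preimage (fun _ _ h => (mem_minPreimage.1 h).1) fun _ _ h =>
    (hf.exists_isLeast h).imp fun _ hz => mem_minPreimage.2 hz

/-- The question about `w` in `prefixLang`, without the flag. -/
def question (y w : Word) : Word := w.reverse.foldr (fun b u => true :: b :: u) (false :: y)

@[simp] theorem question_nil (y : Word) : question y [] = false :: y := rfl

-- The prefix is coded backwards in front of `y`, so a new letter goes to the left end of the query
-- and the rest stays in place.
@[simp] theorem question_append (y w : Word) (b : Bool) :
    question y (w ++ [b]) = true :: b :: question y w := by simp [question]

theorem parse_question (y w v : Word) : parse v (question y w) = some (w ++ v, y) := by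
  induction w using List.reverseRecOn generalizing v with
  | nil => simp [parse]
  | append_singleton w b ih => simp [parse, ih]

theorem false_question_mem {f : Word →. Word} {y w : Word} :
    false :: question y w ∈ prefixLang f ↔ y ∈ f w := by
  constructor
  · rintro ⟨z', w', y', h2, ⟨h3, h4⟩ | ⟨h3, h4⟩⟩ <;> cases h3
    obtain ⟨rfl, rfl⟩ : w = w' ∧ y = y' := by simpa [parse_question] using h2
    exact h4
  · exact fun h => ⟨_, w, y, by simpa using parse_question y w [], .inl ⟨rfl, h⟩⟩

theorem true_question_mem {f : Word →. Word} {y w : Word} :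
    true :: question y w ∈ prefixLang f ↔ ∃ x, w <+: x ∧ y ∈ f x := by
  constructor
  · rintro ⟨z', w', y', h2, ⟨h3, h4⟩ | ⟨h3, h4⟩⟩ <;> cases h3
    obtain ⟨rfl, rfl⟩ : w = w' ∧ y = y' := by simpa [parse_question] using h2
    exact h4
  · exact fun h => ⟨_, w, y, by simpa using parse_question y w [], .inr ⟨rfl, h⟩⟩

/-! ### Search for the least preimage with the prefix oracle -/

namespace ATape

/-- The word `v` starts to the right of the head. -/
def Behind (t : ATape) (v : Word) : Prop := (⟨t.pos + 1, t.cells⟩ : ATape).HasWord v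

theorem Behind.left {t : ATape} {v : Word} (h : t.Behind v) (b : Bool) :
    (t.act (some b, .left)).Behind (b :: v) := by
  have := HasWord.cons h b
  simpa [Behind, act, Dir.shift] using this

theorem Behind.hasWord {t : ATape} {v : Word} (h : t.Behind v) (b : Bool) :
    (t.act (some b, .stay)).HasWord (b :: v) := by
  have := HasWord.cons h b
  simpa [act, Dir.shift] using this

theorem Behind.stay {t : ATape} {v : Word} (h : t.Behind v) (b : Bool) :
    (t.act (some b, .stay)).Behind v := (h.hasWord b).tail

/-- Two moves to the right pass over the leading pair, and the way back overwrites it. This corrects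
the tentative pair `1 0` to `1 1` when the letter `0` is rejected. -/
theorem Behind.rewrite {t : ATape} {v : Word} {a b : Bool} (h : t.Behind (a :: b :: v)) (a' b' : Bool) :
    ((((t.act (t.read, .right)).act ((t.act (t.read, .right)).read, .right)).act
      (some b', .left)).act (some a', .left)).Behind (a' :: b' :: v) := by
  refine Behind.left (Behind.left ?_ _) _
  rw [act_same _ rfl, act_same _ rfl]
  exact h.tail.tail

end ATape

namespace Comp

variable {O : Language Bool}

/-- Write `b` on the query tape and move. -/
def wr (b : Bool) (m : Dir) : Comp (Tp Empty) Unit := one .T fun _ => ((), (some b, m))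
/-- Move on the query tape. -/
def keep (m : Dir) : Comp (Tp Empty) Unit := one .T fun s => ((), (s, m))
/-- Append `b` to the output. -/
def app (b : Bool) : Comp (Tp Empty) (Option Unit) := one .X fun _ => (none, (some b, .right))

@[simp] theorem wr_det (b : Bool) (m : Dir) : (wr b m).Det := one_det _ _
@[simp] theorem keep_det (m : Dir) : (keep m).Det := one_det _ _
@[simp] theorem app_det (b : Bool) : (app b).Det := one_det _ _

theorem spec_wr (b : Bool) (m : Dir) (i x t : ATape) :
    (wr b m).Spec O .T ⊤ (Tp.st i x t) 1 {((), Tp.st i x (t.act (some b, m)))} :=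
  spec_one_top rfl (by simp)

theorem spec_keep (m : Dir) (i x t : ATape) :
    (keep m).Spec O .T ⊤ (Tp.st i x t) 1 {((), Tp.st i x (t.act (t.read, m)))} :=
  spec_one_top rfl (by simp)

theorem spec_app (b : Bool) (i t : ATape) (w : Word) :
    (app b).Spec O .T ⊤ (Tp.st i ⟨w.length, ATape.wordCells 0 w⟩ t) 1
      {(none, Tp.st i ⟨(w ++ [b]).length, ATape.wordCells 0 (w ++ [b])⟩ t)} :=
  spec_one_top rfl (by
    simp only [Tp.st_X, Tp.update_st_X, ATape.act]
    rw [ATape.wordCells_append 0 w b _ (by simp)]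
    simp [Dir.shift])

theorem spec_ask_word {i x t : ATape} {u : Word} (h : t.HasWord u) :
    (ask : Comp (Tp Empty) Bool).Spec O .T ⊤ (Tp.st i x t) 1 {(decide (u ∈ O), Tp.st i x t)} :=
  spec_ask (fits_top _) (by
    rw [decide_eq_true_iff]
    exact ⟨fun h' => ⟨u, h', h⟩, fun ⟨w, h1, h2⟩ => h2.unique h ▸ h1⟩)

/-- Stop if the prefix is a preimage, otherwise extend it by one letter. -/
def extend : Comp (Tp Empty) (Option Unit) :=
  (wr false .stay).bind fun _ => ask.bind fun r => if r then ret (some ()) else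
    (wr false .left).bind fun _ => (wr true .left).bind fun _ => (wr true .stay).bind fun _ =>
    ask.bind fun r => if r then app false else
      (keep .right).bind fun _ => (keep .right).bind fun _ => (wr true .left).bind fun _ =>
      (wr true .left).bind fun _ => app true

/-- Find the least preimage with the help of `prefixLang`. -/
def search : Comp (Tp Empty) Unit :=
  (dup .I .T).bind fun _ => (keep .left).bind fun _ => (wr false .left).bind fun _ =>
  (wr true .stay).bind fun _ => ask.bind fun r => if r then (loop extend).bind fun _ => rewind .X
    else fail

theorem extend_det : extend.Det := by
  refine bind_det (by simp) fun _ => bind_det ask_det fun r => ?_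
  split
  · simp
  · refine bind_det (by simp) fun _ => bind_det (by simp) fun _ => bind_det (by simp) fun _ =>
      bind_det ask_det fun r => ?_
    split
    · simp
    · exact bind_det (by simp) fun _ => bind_det (by simp) fun _ => bind_det (by simp) fun _ =>
        bind_det (by simp) fun _ => by simp

theorem search_det : search.Det := by
  refine bind_det (by simp) fun _ => bind_det (by simp) fun _ => bind_det (by simp) fun _ =>
    bind_det (by simp) fun _ => bind_det ask_det fun r => ?_
  split
  · exact bind_det (loop_det extend_det) fun _ => rewind_det _
  · simp

/-- The prefix `w` found so far is always a prefix of the least preimage `x`, and `v` is what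
remains. If `v` is nonempty then `w < x`, so `w` is no preimage and the search goes on. If `x`
continues with `1`, no extension of `w0` is a preimage, for it would be smaller than `x`; so the
answer about `w0` is the next letter. A round takes at most 11 steps, the last one 3. -/
theorem spec_loop_extend {f : Word →. Word} {y x : Word} (hx : IsLeast {z : Word | y ∈ f z} x)
    (i : ATape) {w v : Word} (hw : w ++ v = x) {t : ATape} (ht : t.Behind (question y w)) :
    ∃ t', (loop extend).Spec (prefixLang f) .T ⊤ (Tp.st i ⟨w.length, ATape.wordCells 0 w⟩ t)
      (v.length * 11 + 3) {((), Tp.st i ⟨x.length, ATape.wordCells 0 x⟩ t')} := by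
  induction v generalizing w t with
  | nil =>
    obtain rfl : w = x := by simpa using hw
    have h1 := spec_ask_word (O := prefixLang f) (i := i) (x := ⟨w.length, ATape.wordCells 0 w⟩)
      (ht.hasWord false)
    rw [decide_eq_true (false_question_mem.2 hx.1)] at h1
    exact ⟨_, (spec_loop_exit (C := extend) (spec_bind_single (spec_wr false .stay _ _ _)
      (spec_bind_single h1 (spec_ret (fits_top _) (some ()))))).mono (by simp)⟩
  | cons b v ih =>
    have h1 := spec_ask_word (O := prefixLang f) (i := i) (x := ⟨w.length, ATape.wordCells 0 w⟩)
      (ht.hasWord false)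
    have hn : false :: question y w ∉ prefixLang f := fun h => by
      have h2 := hx.2 (false_question_mem.1 h)
      have h3 : w < x := lt_of_le_of_ne (Word.le_of_prefix ⟨_, hw⟩) (by
        rintro rfl
        simp at hw)
      exact absurd h3 (not_lt.2 h2)
    rw [decide_eq_false hn] at h1
    have h2 := (((ht.stay false).left false).left true)
    have h3 := spec_ask_word (O := prefixLang f) (i := i) (x := ⟨w.length, ATape.wordCells 0 w⟩)
      (h2.hasWord true)
    have h4 : true :: true :: false :: question y w ∈ prefixLang f ↔
        ∃ z, w ++ [false] <+: z ∧ y ∈ f z := by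
      rw [← question_append, true_question_mem]
    cases b with
    | false =>
      rw [decide_eq_true (h4.2 ⟨x, ⟨v, by simpa using hw⟩, hx.1⟩)] at h3
      have h5 : (w ++ [false]) ++ v = x := by simpa using hw
      obtain ⟨t', h6⟩ := ih h5 (t := _) (by rw [question_append]; exact h2.stay true)
      refine ⟨t', (spec_loop_next (C := extend) (spec_bind_single (spec_wr false .stay _ _ _)
        (spec_bind_single h1 (spec_bind_single (spec_wr false .left _ _ _)
        (spec_bind_single (spec_wr true .left _ _ _) (spec_bind_single (spec_wr true .stay _ _ _)
        (spec_bind_single h3 (spec_app false _ _ _))))))) h6).mono ?_⟩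
      simp only [List.length_cons]; omega
    | true =>
      have h7 : ¬ ∃ z, w ++ [false] <+: z ∧ y ∈ f z := by
        rintro ⟨z, ⟨u, rfl⟩, hz⟩
        have h8 := hx.2 hz
        rw [← hw, List.append_assoc] at h8
        exact absurd (Word.append_false_lt w u v) (not_lt.2 h8)
      rw [decide_eq_false (mt h4.1 h7)] at h3
      have h5 : (w ++ [true]) ++ v = x := by simpa using hw
      obtain ⟨t', h6⟩ := ih h5 (t := _) (by
        rw [question_append]; exact (h2.stay true).rewrite true true)
      refine ⟨t', (spec_loop_next (C := extend) (spec_bind_single (spec_wr false .stay _ _ _)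
        (spec_bind_single h1 (spec_bind_single (spec_wr false .left _ _ _)
        (spec_bind_single (spec_wr true .left _ _ _) (spec_bind_single (spec_wr true .stay _ _ _)
        (spec_bind_single h3 (spec_bind_single (spec_keep .right _ _ _)
        (spec_bind_single (spec_keep .right _ _ _) (spec_bind_single (spec_wr true .left _ _ _)
        (spec_bind_single (spec_wr true .left _ _ _) (spec_app true _ _ _))))))))))) h6).mono ?_⟩
      simp only [List.length_cons]; omega

theorem spec_search {f : Word →. Word} (hf : PolyBalanced f) {d : ℕ}
    (hd : ∀ x y : Word, y ∈ f x → x.length ≤ (y.length + 2) ^ d) (y : Word) : ∃ S,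
    search.Spec (prefixLang f) .T ⊤ (initTapes .I y) (2 * y.length + 12 + 12 * (y.length + 2) ^ d) S ∧
      ∀ x, x ∈ minPreimage f y ↔ ∃ z ∈ S, (z.2 .X).HasWord x := by
  have h1 := spec_dup (O := prefixLang f) (qT := .T) (a := .I) (b := .T) (w := y)
    (τ := initTapes (K := Tp Empty) .I y) (by simp)
    (by simpa [initTapes] using ATape.hasWord_ofWord y) (by simp [initTapes])
  rw [Tp.initTapes_eq_st, Tp.update_st_T] at h1
  have h2 : ((ATape.ofWord y).act ((ATape.ofWord y).read, .left)).Behind y := by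
    rw [ATape.act_same _ rfl]
    simpa [ATape.Behind, Dir.shift, ATape.ofWord] using ATape.hasWord_ofWord y
  have h3 := h2.left false
  rw [← question_nil] at h3
  -- The empty word is a prefix of every word, so this first question asks whether `y` lies in the
  -- image of `f`.
  have h4 := spec_ask_word (O := prefixLang f) (i := .ofWord y) (x := .blank) (h3.hasWord true)
  rw [Tp.initTapes_eq_st]
  by_cases h : ∃ x, y ∈ f x
  · obtain ⟨x, hx⟩ := hf.exists_isLeast h.choose_spec
    rw [decide_eq_true (true_question_mem.2 ⟨x, List.nil_prefix, hx.1⟩)] at h4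
    obtain ⟨t', h5⟩ := spec_loop_extend hx (.ofWord y) (w := []) (v := x) rfl (h3.stay true)
    rw [show (⟨([] : Word).length, ATape.wordCells 0 []⟩ : ATape) = .blank by simp [ATape.blank]] at h5
    have h6 := spec_rewind (O := prefixLang f) (qT := Tp.T) (a := Tp.X) (τ := Tp.st (D := Empty)
      (.ofWord y) ⟨x.length, ATape.wordCells 0 x⟩ t') 0 x.length (by simp)
      (fun i hi hi2 => ATape.wordCells_ne_none (w := x) hi hi2) (by simpa using ATape.wordCells_of_lt x (by omega))
    have h7 : (if true = true then (loop extend).bind fun _ => rewind .X else fail).Spec (prefixLang f)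
      .T ⊤ _ _ _ := spec_bind_single h5 h6
    refine ⟨_, (spec_bind_single h1 (spec_bind_single (spec_keep .left _ _ _)
      (spec_bind_single (spec_wr false .left _ _ _) (spec_bind_single (spec_wr true .stay _ _ _)
      (spec_bind_single h4 h7))))).mono ?_, fun z => ?_⟩
    · have := hd x y hx.1
      omega
    · rw [mem_minPreimage]
      simp only [Set.mem_singleton_iff, exists_eq_left, Tp.update_st_X, Tp.st_X]
      exact ⟨fun h => h.unique hx ▸ ATape.hasWord_ofWord _,
        fun h => h.unique (ATape.hasWord_ofWord x) ▸ hx⟩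
  · rw [decide_eq_false fun h' => h ((true_question_mem.1 h').imp fun _ h => h.2)] at h4
    have h7 : ∀ τ, (if false = true then (loop extend).bind fun _ => rewind .X else fail).Spec
      (prefixLang f) .T ⊤ τ _ _ := fun τ => spec_fail (fits_top τ)
    refine ⟨_, (spec_bind_single h1 (spec_bind_single (spec_keep .left _ _ _)
      (spec_bind_single (spec_wr false .left _ _ _) (spec_bind_single (spec_wr true .stay _ _ _)
      (spec_bind_single h4 (h7 _)))))).mono ?_, fun z => ?_⟩
    · omega
    · rw [mem_minPreimage]
      simp only [Set.mem_empty_iff_false, false_and, exists_false, iff_false]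
      exact fun hz => h ⟨z, hz.1⟩

end Comp

theorem minPreimage_mem_fPOracle {f : Word →. Word} (hf : PolyBalanced f)
    {𝒞 : Set (Language Bool)} (h : prefixLang f ∈ 𝒞) : minPreimage f ∈ fPOracle 𝒞 := by
  obtain ⟨d, hd⟩ := hf.exists_pow
  exact fPOracle_of_spec search_det h (hf.of_preimage fun _ _ h => (mem_minPreimage.1 h).1)
    (((PolyBdd.id.const_mul 2).add (.const 12)).add ((PolyBdd.poly d).const_mul 12))
    fun y => spec_search hf hd y
end

noncomputable section
open scoped Classical
open OracleTM Comp

/-! ## Enumeration of words -/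

/-- The word after `w`. -/
def incr : Word → Word
  | [] => [false]
  | false :: w => true :: w
  | true :: w => false :: incr w

/-- The position of a word in the enumeration by `incr`. -/
def rank : Word → ℕ
  | [] => 0
  | b :: w => (if b then 2 else 1) + 2 * rank w

theorem rank_incr (w : Word) : rank (incr w) = rank w + 1 := by
  induction w with
  | nil => rfl
  | cons b w ih => cases b <;> simp [incr, rank, ih] <;> ring

/-- `rank` reads a word as a numeral in base 2 with the digits 1 and 2, least significant first.
Parity determines the first digit. -/
theorem rank_injective : Function.Injective rank := by
  intro v
  induction v with
  | nil =>
    rintro (_ | ⟨b, w⟩) h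
    · rfl
    · cases b <;> simp [rank] at h <;> omega
  | cons a v ih =>
    rintro (_ | ⟨b, w⟩) h
    · cases a <;> simp [rank] at h
    · simp only [rank] at h
      cases a <;> cases b <;> simp only [if_true, if_false, Bool.false_eq_true] at h
      · exact congrArg _ (ih (by omega))
      · omega
      · omega
      · exact congrArg _ (ih (by omega))

/-- Words of length `l` have ranks between `2 ^ l - 1` and `2 ^ (l + 1) - 2`, so `incr` runs through
the words in order of length. -/
theorem rank_bounds (w : Word) : 2 ^ w.length ≤ rank w + 1 ∧ rank w + 2 ≤ 2 ^ (w.length + 1) := by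
  induction w with
  | nil => simp [rank]
  | cons b w ih =>
    simp only [rank, List.length_cons, pow_succ] at *
    cases b <;> simp <;> omega

/-- Since the rank grows with the length, the enumeration has passed all admissible words once the
next one is too long. -/
theorem rank_le_of_length {L : ℕ} {v w : Word} (hw : L < (incr w).length) (hv : v.length ≤ L) :
    rank v ≤ rank w := by
  have h1 := (rank_bounds v).2
  have h2 := (rank_bounds (incr w)).1
  have h3 : 2 ^ (v.length + 1) ≤ 2 ^ (incr w).length := Nat.pow_le_pow_right (by omega) (by omega)
  rw [rank_incr] at h2
  omega

/-- The input tape, the work tape, and two clocks. -/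
def Tp.full {D : Type} (i x v t : ATape) : Tp D → ATape
  | .I => i
  | .X => x
  | .V => v
  | .T => t
  | _ => .blank

namespace Tp

variable {D : Type} {P : D → ATape}

@[simp] theorem lay_full_I (i x v t : ATape) : lay (full i x v t) P .I = i := rfl
@[simp] theorem lay_full_X (i x v t : ATape) : lay (full i x v t) P .X = x := rfl
@[simp] theorem lay_full_V (i x v t : ATape) : lay (full i x v t) P .V = v := rfl
@[simp] theorem lay_dat (τ : Tp D → ATape) (d : D) : lay τ P (.dat d) = P d := rfl

@[simp] theorem update_lay_full_I (i x v t i' : ATape) :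
    Function.update (lay (full i x v t) P) .I i' = lay (full i' x v t) P := by
  funext k; cases k <;> simp [full, lay]
@[simp] theorem update_lay_full_X (i x v t x' : ATape) :
    Function.update (lay (full i x v t) P) .X x' = lay (full i x' v t) P := by
  funext k; cases k <;> simp [full, lay]
@[simp] theorem update_lay_full_V (i x v t v' : ATape) :
    Function.update (lay (full i x v t) P) .V v' = lay (full i x v' t) P := by
  funext k; cases k <;> simp [full, lay]

theorem full_pos (y w : Word) (v t : Word) (B : ℕ) (k : Tp D) :
    ((full (.ofWord y) (.ofWord w) (.ofWord v) (.ofWord t) k).pos.natAbs : ℕ∞) ≤ B := by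
  cases k <;> simp [full, ATape.blank, ATape.ofWord]

end Tp

/-! ### Exhaustive search in polynomial space -/

namespace Comp

variable {D : Type} {O : Language Bool} {qT : Tp D}

/-- One step of the passage to the next word; the value `some false` signals that the word
becomes too long. -/
def incStep : Comp (Tp D) (Option (Option Bool)) := two .X .V fun
  | some true, u => (none, (some false, .right), (u, .right))
  | some false, u => (some none, (some true, .stay), (u, .stay))
  | none, none => (some (some false), (none, .stay), (none, .stay))
  | none, u => (some none, (some false, .stay), (u, .stay))

/-- Pass to the next word. -/
def inc : Comp (Tp D) (Option Bool) :=
  (loop incStep).bind fun r => (rewindWith .X .V).bind fun _ => ret r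

theorem inc_det : (inc (D := D)).Det :=
  bind_det (loop_det (two_det _ _ _)) fun _ => bind_det (by simp) fun _ => by simp
theorem inc_free : (inc (D := D)).Free :=
  bind_free (loop_free (two_free _ _ _)) fun _ => bind_free (by simp) fun _ => by simp

/-- `u` is the part that the carry has already rewritten, `v` the rest. The head of `V` moves along
on `1 ^ L`; blanks on both tapes mean that the carry would lengthen a word of the full length `L`.
-/
theorem spec_loop_incStep (i t : ATape) (P : D → ATape) (L : ℕ) (v u : Word)
    (h : (u ++ v).length ≤ L) : ∃ (r : Option Bool) (w : Word) (j : ℕ), j ≤ w.length ∧ j ≤ L ∧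
      (loop incStep).Spec O qT ⊤
        (Tp.lay (Tp.full i ⟨u.length, ATape.wordCells 0 (u ++ v)⟩
          ⟨u.length, ATape.wordCells 0 (ones L)⟩ t) P) (v.length + 1)
        {(r, Tp.lay (Tp.full i ⟨j, ATape.wordCells 0 w⟩ ⟨j, ATape.wordCells 0 (ones L)⟩ t) P)} ∧
      (r = none → w = u ++ incr v ∧ w.length ≤ L) ∧
      (r ≠ none → r = some false ∧ L < (u ++ incr v).length) := by
  have hV : ∀ p : ℤ, (⟨p, ATape.wordCells 0 (ones L)⟩ : ATape).act
      ((⟨p, ATape.wordCells 0 (ones L)⟩ : ATape).read, .stay) = ⟨p, ATape.wordCells 0 (ones L)⟩ :=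
    fun p => ATape.act_read_stay _
  induction v generalizing u with
  | nil =>
    rw [List.append_nil]
    have hX : (⟨u.length, ATape.wordCells 0 u⟩ : ATape).read = none := by
      have : ATape.wordCells 0 u u.length = none := ATape.wordCells_of_ge (by simp)
      exact this
    rcases (by simpa using h : u.length ≤ L).lt_or_eq with h1 | h1
    · have h2 : (⟨u.length, ATape.wordCells 0 (ones L)⟩ : ATape).read = some true := by
        simp only [ATape.read, ATape.wordCells_zero]
        simp [ones, h1]
      refine ⟨none, u ++ [false], u.length, by simp, h1.le, spec_loop_exit (C := incStep)
        (spec_two_top (by simp) (by simp [hX, h2]) ?_), fun _ => ⟨rfl, by simpa using h1⟩, by simp⟩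
      simp only [Tp.lay_full_X, Tp.lay_full_V, hX, h2, Tp.update_lay_full_X, Tp.update_lay_full_V]
      rw [← h2, hV]
      simp only [ATape.act, Dir.shift]
      rw [ATape.wordCells_append 0 u false _ (by simp), add_zero]
    · have h2 : (⟨u.length, ATape.wordCells 0 (ones L)⟩ : ATape).read = none := by
        have : ATape.wordCells 0 (ones L) u.length = none := ATape.wordCells_of_ge (by simp [h1])
        exact this
      refine ⟨some false, u, u.length, le_rfl, h1.le, spec_loop_exit (C := incStep)
        (spec_two_top (by simp) (by simp [hX, h2]) ?_), by simp, fun _ => ⟨rfl, by simp [incr, h1]⟩⟩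
      simp only [Tp.lay_full_X, Tp.lay_full_V, hX, h2, Tp.update_lay_full_X, Tp.update_lay_full_V]
      nth_rw 1 [← hX]
      rw [← h2, hV, ATape.act_read_stay]
  | cons b v ih =>
    have hX : (⟨u.length, ATape.wordCells 0 (u ++ b :: v)⟩ : ATape).read = some b := by
      simp [ATape.read, ATape.wordCells_zero]
    cases b with
    | false =>
      refine ⟨none, u ++ true :: v, u.length, by simp, by simp at h; omega,
        (spec_loop_exit (C := incStep) (spec_two_top (by simp) (by simp [hX]) ?_)).mono (by simp),
        fun _ => ⟨rfl, by simpa using h⟩, by simp⟩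
      simp only [Tp.lay_full_X, Tp.lay_full_V, hX, Tp.update_lay_full_X, Tp.update_lay_full_V, hV]
      simp only [ATape.act, Dir.shift]
      rw [ATape.wordCells_set u v false true _ rfl, add_zero]
    | true =>
      obtain ⟨r, w, j, h1, h2, h3, h4, h5⟩ := ih (u ++ [false]) (by simpa using h)
      refine ⟨r, w, j, h1, h2, (spec_loop_next (C := incStep) (spec_two_top (by simp)
        (by simp [hX]) ?_) h3).mono (by simp; omega), by simpa [incr] using h4,
        by simpa [incr] using h5⟩
      simp only [Tp.lay_full_X, Tp.lay_full_V, hX, Tp.update_lay_full_X, Tp.update_lay_full_V]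
      rw [ATape.act_same _ rfl, ATape.act, ATape.wordCells_set u v true false _ rfl]
      simp [Dir.shift]

theorem spec_inc (i t : ATape) (P : D → ATape) (L : ℕ) (w : Word) (h : w.length ≤ L) :
    ∃ (r : Option Bool) (w' : Word), (inc).Spec O qT ⊤
      (Tp.lay (Tp.full i (.ofWord w) (.ofWord (ones L)) t) P) (2 * L + 4)
      {(r, Tp.lay (Tp.full i (.ofWord w') (.ofWord (ones L)) t) P)} ∧
      (r = none → w' = incr w ∧ w'.length ≤ L) ∧ (r ≠ none → r = some false ∧ L < (incr w).length) := by
  obtain ⟨r, w', j, h1, h2, h3, h4, h5⟩ := spec_loop_incStep (O := O) (qT := qT) i t P L w [] h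
  have h6 := spec_rewindWith (O := O) (qT := qT) (a := Tp.X) (b := Tp.V)
    (τ := Tp.lay (Tp.full i ⟨j, ATape.wordCells 0 w'⟩ ⟨j, ATape.wordCells 0 (ones L)⟩ t) P)
    (by simp) 0 j (by simp) (fun k hk hk' => ATape.wordCells_ne_none (w := w') hk (by omega))
    (by simpa using ATape.wordCells_of_lt w' (by omega))
  simp only [Tp.lay_full_X, Tp.lay_full_V, Tp.update_lay_full_X, Tp.update_lay_full_V, sub_self] at h6
  exact ⟨r, w', (spec_bind_single h3 (spec_bind_single h6 (spec_ret (fits_top _) r))).mono (by omega),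
    h4, h5⟩

/-- Compare the tape `a` with the input. -/
def test (a : Tp D) : Comp (Tp D) Bool :=
  (compare a .I).bind fun r => (rewindWith .I a).bind fun _ => ret r

theorem test_det (a : Tp D) : (test a).Det :=
  bind_det (by simp) fun _ => bind_det (by simp) fun _ => by simp
theorem test_free (a : Tp D) : (test a).Free :=
  bind_free (by simp) fun _ => bind_free (by simp) fun _ => by simp

/-- The comparison displaces both heads by the same `j`. The start of the input, marked by the blank
to its left, tells how far to go back, so the test leaves no trace on the tapes. -/
theorem spec_test {k : D} {v y : Word} (x u t : ATape) {P : D → ATape} (h : (P k).HasWord v) :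
    (test (.dat k)).Spec O qT ⊤ (Tp.lay (Tp.full (.ofWord y) x u t) P) (2 * y.length + 4)
      {(decide (v = y), Tp.lay (Tp.full (.ofWord y) x u t) P)} := by
  obtain ⟨j, hj, h1⟩ := spec_compare (O := O) (qT := qT) (a := Tp.dat k) (b := Tp.I)
    (τ := Tp.lay (Tp.full (.ofWord y) x u t) P) (v := v) (w := y) (by simp) (by simpa using h)
    (by simpa using ATape.hasWord_ofWord y)
  have e : (P k).pos + j - j = (P k).pos := by ring
  have h2 := spec_rewindWith (O := O) (qT := qT) (a := Tp.I) (b := Tp.dat k) (by simp) 0 j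
    (τ := Function.update (Function.update (Tp.lay (Tp.full (.ofWord y) x u t) P) (.dat k)
      ⟨(P k).pos + j, (P k).cells⟩) .I ⟨(ATape.ofWord y).pos + j, (ATape.ofWord y).cells⟩)
    (by simp [ATape.ofWord]) (fun i hi hi' => by
      simpa [ATape.ofWord] using ATape.wordCells_ne_none (w := y) hi (by omega))
    (by simpa [ATape.ofWord] using ATape.wordCells_of_lt y (by omega))
  have h3 : Function.update (Tp.lay (Tp.full (.ofWord y) x u t) P) (.dat k) (P k) =
      Tp.lay (Tp.full (.ofWord y) x u t) P := Function.update_eq_self _ _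
  rw [Function.update_idem, Function.update_comm (by simp : Tp.I ≠ Tp.dat k), Function.update_self,
    Function.update_of_ne (by simp : Tp.dat k ≠ Tp.I), Function.update_idem,
    Function.update_self, e, h3, Tp.update_lay_full_I] at h2
  have h4 : (test (.dat k)).Spec O qT ⊤ _ _ _ :=
    spec_bind_single h1 (spec_bind_single h2 (spec_ret (fits_top _) (decide (v = y))))
  exact h4.mono (by omega)

/-- Is the word on `X` a preimage of the input? If not, pass to the next word. -/
def tryWord (M : OracleTM) : Comp (Tp M.K) (Option Bool) :=
  (call M false id .X).bind fun s => (if s then test (.dat M.outTape) else ret false).bind fun r =>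
    clean.bind fun _ => if r then ret (some true) else inc

theorem tryWord_det {M : OracleTM} (hM : M.Deterministic) : (tryWord M).Det := by
  refine bind_det (call_det hM _ _ _) fun s => bind_det ?_ fun r => bind_det clean_det fun _ => ?_
  · split
    · exact test_det _
    · exact ret_det _
  · split
    · exact ret_det _
    · exact inc_det

theorem tryWord_free {M : OracleTM} (hM : M.OracleFree) : (tryWord M).Free := by
  refine bind_free (call_free hM _ _ _) fun s => bind_free ?_ fun r => bind_free clean_free fun _ => ?_
  · split
    · exact test_free _
    · exact ret_free _
  · split
    · exact ret_free _
    · exact inc_free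

/-- Each trial starts and ends with blank simulated tapes, so the space is used again for the next
word; only the word on `X` changes. -/
theorem spec_tryWord {M : OracleTM} (hM : M.Deterministic) {f : Word →. Word} (hf : M.Computes 0 f)
    {n B L N W : ℕ} {w y : Word} (hb : M.Bounded 0 (M.init w) n B) (hw : w.length ≤ L) (hB : L ≤ B)
    (hN : B < N) (hW : B + (2 * y.length + 5 + (10 * N + 10) + (2 * L + 4)) ≤ W) :
    ∃ (r : Option Bool) (w' : Word), (tryWord M).Spec 0 (.dat M.queryTape) W
      (Tp.lay (Tp.full (.ofWord y) (.ofWord w) (.ofWord (ones L)) (.ofWord (ones N))) fun _ => .blank)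
      (((2 * L + 3) + (4 * n + 1)) + ((2 * y.length + 4) + ((10 * N + 10) + (2 * L + 4))))
      {(r, Tp.lay (Tp.full (.ofWord y) (.ofWord w') (.ofWord (ones L)) (.ofWord (ones N)))
        fun _ => .blank)} ∧
      (r = none → y ∉ f w ∧ w' = incr w ∧ w'.length ≤ L) ∧ (r = some true → w' = w ∧ y ∈ f w) ∧
      (r = some false → y ∉ f w ∧ L < (incr w).length) := by
  obtain ⟨o, P, h1, h2, h3, h4⟩ := spec_call_computes (e := id) (qT := .dat M.queryTape) (b := false)
    (O' := 0) (W := W) (by simp [Language.notMem_zero]) hM hf hb (hw.trans hB) Function.injective_id rfl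
    (τ := Tp.full (.ofWord y) (.ofWord w) (.ofWord (ones L)) (.ofWord (ones N))) (src := .X) trivial
    (ATape.hasWord_ofWord w) (fun k _ => Tp.full_pos _ _ _ _ _ k) (by omega)
  have h2 := h2.mono (m := (2 * L + 3) + (4 * n + 1)) (by omega)
  have hP : Fits B (Tp.lay (Tp.full (.ofWord y) (.ofWord w) (.ofWord (ones L)) (.ofWord (ones N))) P) :=
    Tp.fits_lay (fun k _ => Tp.full_pos _ _ _ _ _ k) fun d => by exact_mod_cast (h3 d).1
  have hP0 : Fits B (Tp.lay (Tp.full (.ofWord y) (.ofWord w) (.ofWord (ones L)) (.ofWord (ones N)))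
      (fun _ : M.K => .blank)) :=
    Tp.fits_lay (fun k _ => Tp.full_pos _ _ _ _ _ k) fun d => by simp [ATape.blank]
  have h5 : (if o.isSome then test (.dat M.outTape) else ret false).Spec 0 (.dat M.queryTape) W
      (Tp.lay (Tp.full (.ofWord y) (.ofWord w) (.ofWord (ones L)) (.ofWord (ones N))) P)
      (2 * y.length + 4) {(decide (y ∈ f w),
        Tp.lay (Tp.full (.ofWord y) (.ofWord w) (.ofWord (ones L)) (.ofWord (ones N))) P)} := by
    cases o with
    | none =>
      rw [decide_eq_false (by rw [h1]; simp)]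
      exact Run.mono ((spec_ret (fits_top _) false).lift hP (by omega)) (by omega)
    | some v =>
      have h6 : (y ∈ f w) = (v = y) := by rw [h1]; simp
      simp only [h6]
      exact (spec_test _ _ _ (h4 v rfl).1).lift hP (by omega)
  have h7 := (spec_clean (O := 0) (qT := .dat M.queryTape) (N := N) (P := P)
    (τ := Tp.full (.ofWord y) (.ofWord w) (.ofWord (ones L)) (.ofWord (ones N))) rfl
    (fun d => (h3 d).1.trans_lt hN) fun d i hi => (h3 d).2 i (by omega)).lift (B := W) hP (by omega)
  by_cases hy : y ∈ f w
  · rw [decide_eq_true hy] at h5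
    have h8 : (if true = true then ret (some true) else inc : Comp (Tp M.K) (Option Bool)).Spec 0
        (.dat M.queryTape) W _ _ _ := (spec_ret (fits_top _) (some true)).lift hP0 (by omega)
    exact ⟨some true, w, (spec_bind_single h2 (spec_bind_single h5 (spec_bind_single h7 h8))).mono
      (by omega), by simp, fun _ => ⟨rfl, hy⟩, by simp⟩
  · rw [decide_eq_false hy] at h5
    obtain ⟨r, w', h9, h10, h11⟩ := spec_inc (O := 0) (qT := .dat M.queryTape) (.ofWord y)
      (.ofWord (ones N)) (fun _ : M.K => .blank) L w hw
    have h8 : (if false = true then ret (some true) else inc : Comp (Tp M.K) (Option Bool)).Spec 0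
        (.dat M.queryTape) W _ _ _ := h9.lift hP0 (by omega)
    refine ⟨r, w', spec_bind_single h2 (spec_bind_single h5 (spec_bind_single h7 h8)),
      fun h => ⟨hy, h10 h⟩, fun h => ?_, fun h => ⟨hy, (h11 (by simp [h])).2⟩⟩
    have := (h11 (by simp [h])).1
    simp [h] at this

/-- Invariant: no preimage of `y` has smaller rank than the current word. Induction on the number
`m` of ranks left; at `m = 0` the rank would be too large for a word of length at most `L`. The time
`k` may be exponential, only the radius `W` is controlled. -/
theorem spec_loop_tryWord {M : OracleTM} (hM : M.Deterministic) {f : Word →. Word}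
    (hf : M.Computes 0 f) {n B L N W : ℕ} {y : Word}
    (hb : ∀ w : Word, w.length ≤ L → M.Bounded 0 (M.init w) n B) (hB : L ≤ B)
    (hN : B < N) (hW : B + (2 * y.length + 5 + (10 * N + 10) + (2 * L + 4)) ≤ W) (m : ℕ) (w : Word)
    (hw : w.length ≤ L) (hm : 2 ^ (L + 1) ≤ rank w + m) (h : ∀ x, y ∈ f x → rank w ≤ rank x) :
    ∃ (k : ℕ) (r : Bool) (w' : Word), (loop (tryWord M)).Spec 0 (.dat M.queryTape) W
      (Tp.lay (Tp.full (.ofWord y) (.ofWord w) (.ofWord (ones L)) (.ofWord (ones N))) fun _ => .blank) k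
      {(r, Tp.lay (Tp.full (.ofWord y) (.ofWord w') (.ofWord (ones L)) (.ofWord (ones N)))
        fun _ => .blank)} ∧ (r = true → y ∈ f w') ∧ (r = false → ∀ x, y ∈ f x → L < x.length) := by
  induction m generalizing w with
  | zero =>
    have h1 := (rank_bounds w).2
    have h2 : 2 ^ (w.length + 1) ≤ 2 ^ (L + 1) := Nat.pow_le_pow_right (by omega) (by omega)
    omega
  | succ m ih =>
    obtain ⟨r, w', h1, h2, h3, h4⟩ := spec_tryWord hM hf (y := y) (hb w hw) hw hB hN hW
    rcases r with _ | _ | _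
    · obtain ⟨h5, rfl, h6⟩ := h2 rfl
      obtain ⟨k, r, w', h7, h8⟩ := ih (incr w) h6 (by rw [rank_incr]; omega) fun x hx => by
        rw [rank_incr]
        refine Nat.lt_of_le_of_ne (h x hx) fun he => h5 ?_
        rwa [rank_injective he]
      exact ⟨_, r, w', spec_loop_next h1 h7, h8⟩
    · obtain ⟨h5, h6⟩ := h4 rfl
      refine ⟨_, false, w', spec_loop_exit h1, by simp, fun _ x hx => ?_⟩
      by_contra! hx'
      have h7 := rank_le_of_length h6 hx'
      exact h5 (rank_injective (le_antisymm h7 (h x hx)) ▸ hx)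
    · obtain ⟨rfl, h5⟩ := h3 rfl
      exact ⟨_, true, w', spec_loop_exit h1, fun _ => h5, by simp⟩

/-- Search for a preimage, among the words of length at most `(n + 2) ^ e`. -/
def spaceSearch (M : OracleTM) (d e : ℕ) : Comp (Tp M.K) Unit :=
  (clock .I .T .V d).bind fun _ => (clock .I .V .Q e).bind fun _ => mark.bind fun _ =>
    guard (loop (tryWord M))

theorem spaceSearch_det {M : OracleTM} (hM : M.Deterministic) (d e : ℕ) : (spaceSearch M d e).Det :=
  bind_det (clock_det _ _ _ _) fun _ => bind_det (clock_det _ _ _ _) fun _ => bind_det mark_det fun _ =>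
    guard_det (loop_det (tryWord_det hM))

theorem spaceSearch_free {M : OracleTM} (hM : M.OracleFree) (d e : ℕ) : (spaceSearch M d e).Free :=
  bind_free (clock_free _ _ _ _) fun _ => bind_free (clock_free _ _ _ _) fun _ =>
    bind_free mark_free fun _ => guard_free (loop_free (tryWord_free hM))

theorem spec_spaceSearch {M : OracleTM} (hM : M.Deterministic) {f : Word →. Word}
    (hf : M.Computes 0 f) {n B W d e : ℕ} {y : Word}
    (hb : ∀ w : Word, w.length ≤ (y.length + 2) ^ e → M.Bounded 0 (M.init w) n B)
    (he : ∀ x y : Word, y ∈ f x → x.length ≤ (y.length + 2) ^ e)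
    (hB : (y.length + 2) ^ e ≤ B) (hN : B < (y.length + 2) ^ d)
    (hW : B + (2 * y.length + 5 + (10 * (y.length + 2) ^ d + 10) + (2 * (y.length + 2) ^ e + 4)) +
      clockTime y.length d + clockTime y.length e ≤ W) :
    ∃ (o : Option Word) (k : ℕ) (S : _), (spaceSearch M d e).Spec 0 (.dat M.queryTape) W
      (initTapes .I y) k S ∧ (∀ x, o = some x ↔ ∃ z ∈ S, (z.2 .X).HasWord x) ∧
      (∀ x, o = some x → y ∈ f x) ∧ (o = none → ∀ x, y ∉ f x) := by
  -- From the empty word, of rank 0, `2 ^ (L + 1)` rounds are enough for all words of length at most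
  -- `L`.
  obtain ⟨k, r, w, h1, h2, h3⟩ := spec_loop_tryWord (W := W) (y := y) hM hf hb hB hN (by omega) (2 ^ _) []
    (by simp) (Nat.le_add_left _ _) (fun _ _ => Nat.zero_le _)
  have h4 := spec_clock (O := 0) (qT := .dat M.queryTape) (a := Tp.I) (t := Tp.T) (v := Tp.V)
    (τ := initTapes (K := Tp M.K) .I y) (w := y) (by simp) (by simp) (by simp) (by simp [initTapes])
    (by simp [initTapes]) (by simp [initTapes]) d
  -- `V`, the scratch tape of the first clock, is blank again and becomes the second clock; `Q` is
  -- its scratch tape.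
  have h5 := spec_clock (O := 0) (qT := .dat M.queryTape) (a := Tp.I) (t := Tp.V) (v := Tp.Q)
    (τ := Function.update (initTapes (K := Tp M.K) .I y) .T (.ofWord (ones ((y.length + 2) ^ d))))
    (w := y) (by simp) (by simp) (by simp) (by simp [initTapes])
    (by simp [initTapes]) (by simp [initTapes]) e
  have h6 : Function.update (Function.update (initTapes (K := Tp M.K) .I y) .T
      (.ofWord (ones ((y.length + 2) ^ d)))) .V (.ofWord (ones ((y.length + 2) ^ e))) =
      Tp.full (.ofWord y) (.ofWord []) (.ofWord (ones ((y.length + 2) ^ e)))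
        (.ofWord (ones ((y.length + 2) ^ d))) := by
    funext k
    cases k <;> simp [initTapes, Tp.full, ATape.ofWord, ATape.blank]
  rw [h6] at h5
  have h7 := spec_mark (O := 0) (qT := .dat M.queryTape) (D := M.K) (τ := Tp.full (.ofWord y) (.ofWord [])
    (.ofWord (ones ((y.length + 2) ^ e))) (.ofWord (ones ((y.length + 2) ^ d))))
    (by simp [Tp.full]) (by simp [Tp.full])
  have h4 := h4.lift (fits_initTapes _ _ 0) (B := W) (by omega)
  have h5 := h5.lift (b := 0) (B := W) (fun k => by
    by_cases hk : k = .T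
    · simp [hk, ATape.ofWord]
    · rw [Function.update_of_ne hk]; exact fits_initTapes _ _ 0 k) (by omega)
  have h7 := h7.lift (b := 0) (B := W) (fun k => Tp.full_pos _ _ _ _ _ k) (by omega)
  refine ⟨if r then some w else none, _, _, spec_bind_single h4 (spec_bind_single h5
    (spec_bind_single h7 (spec_guard h1))), fun x => ?_, fun x hx => ?_, fun h x hx => ?_⟩
  · cases r with
    | false => simp
    | true =>
      simp only [if_true, Option.some.injEq, Set.mem_ofPred_eq, Set.mem_singleton_iff]
      constructor
      · rintro rfl
        exact ⟨((), Tp.lay (Tp.full (.ofWord y) (.ofWord w) _ _) _), rfl, ATape.hasWord_ofWord w⟩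
      · rintro ⟨z, hz, hx⟩
        rw [(Prod.ext_iff.1 hz).2] at hx
        exact (ATape.hasWord_ofWord w).unique hx
  · cases r with
    | false => simp at hx
    | true =>
      obtain rfl : w = x := by simpa using hx
      exact h2 rfl
  · cases r with
    | true => simp at h
    | false => exact absurd (he x y hx) (not_le.2 (h3 rfl x hx))

end Comp

/-- The inverse takes the preimage that the enumeration meets, if there is one. Balance ensures that
a fruitless search up to length `(|y| + 2) ^ e` excludes all preimages. -/
theorem exists_isInverse_fPSpace {f : Word →. Word} (hf : f ∈ fPSpace) :
    ∃ f' ∈ fPSpace, IsInverse f' f := by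
  obtain ⟨hb, M, hMf, hM, hs, hf⟩ := hf
  obtain ⟨e, he⟩ := hb.exists_pow
  obtain ⟨c, hc⟩ := hs.bounded hM
  have hB : PolyBdd fun n => ((n + 2) ^ e + 2) ^ c + (n + 2) ^ e :=
    (((PolyBdd.poly e).add (.const 2)).pow c).add (PolyBdd.poly e)
  obtain ⟨d, hd⟩ := hB.exists_pow
  choose n hn using fun x => (hc x).1
  -- The halting times of `M` are known only input by input; `m y` bounds them on the finitely many
  -- candidates for `y`.
  choose m hm using fun y : Word =>
    ((List.finite_length_le Bool ((y.length + 2) ^ e)).image n).bddAbove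
  have key := fun y : Word =>
    spec_spaceSearch (n := m y) (B := ((y.length + 2) ^ e + 2) ^ c + (y.length + 2) ^ e)
      (d := d) (y := y) hM hf (fun x hx => (hn x).mono (hm y ⟨x, hx, rfl⟩) ((Nat.pow_le_pow_left
        (Nat.add_le_add_right hx 2) c).trans (Nat.le_add_right _ _))) he (Nat.le_add_left _ _)
      (hd y.length) le_rfl
  choose o k S h1 h2 h3 h4 using key
  have h5 : ∀ x y, x ∈ (o y : Part Word) → y ∈ f x := fun x y h => h3 y x (Part.mem_ofOption.1 h)
  refine ⟨fun y => o y, fPSpace_of_spec (spaceSearch_det hM d e) (spaceSearch_free hMf d e)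
    (qT := .dat M.queryTape) (out := .X) (hb.of_preimage h5) (((hB.add ((((PolyBdd.id.const_mul 2).add
      (.const 5)).add (((PolyBdd.poly d).const_mul 10).add (.const 10))).add
      (((PolyBdd.poly e).const_mul 2).add (.const 4)))).add (.clockTime d)).add (.clockTime e))
    fun y => ⟨_, _, h1 y, fun x => Part.mem_ofOption.trans (h2 y x)⟩,
    isInverse_of_preimage h5 fun x y hx => ?_⟩
  rcases ho : o y with _ | z
  · exact absurd hx (h4 y ho x)
  · exact ⟨z, by simp⟩
end

noncomputable section
open scoped Classical
open OracleTM Comp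

/-! ## The monoids -/

theorem polyBalanced_id : PolyBalanced (PFun.id Word) :=
  ⟨Polynomial.X, Polynomial.X, fun x y h => by
    obtain rfl : y = x := by simpa using h
    simp⟩

theorem spec_ret_id {O : Language Bool} {W : ℕ∞} (x : Word) : ∃ S,
    (ret () : Comp (Tp Empty) Unit).Spec O .I W (initTapes .I x) 1 S ∧
      ∀ y, y ∈ PFun.id Word x ↔ ∃ z ∈ S, (z.2 .I).HasWord y := by
  have hx : (initTapes (K := Tp Empty) .I x .I).HasWord x := by
    simpa [initTapes] using ATape.hasWord_ofWord x
  have h0 : Fits W (initTapes (K := Tp Empty) .I x) :=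
    (fits_initTapes (K := Tp Empty) .I x 0).mono (by simp)
  refine ⟨_, spec_ret h0 (), fun y => ?_⟩
  simp only [Set.mem_singleton_iff, exists_eq_left]
  constructor
  · intro h
    obtain rfl : y = x := by simpa using h
    exact hx
  · intro h
    rw [hx.unique h]
    exact Part.mem_some y

theorem id_mem_fPOracle {𝒞 : Set (Language Bool)} {O : Language Bool} (h : O ∈ 𝒞) :
    PFun.id Word ∈ fPOracle 𝒞 :=
  fPOracle_of_spec (ret_det ()) h polyBalanced_id (PolyBdd.const 1) spec_ret_id

theorem id_mem_fPSpace : PFun.id Word ∈ fPSpace :=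
  fPSpace_of_spec (W := fun _ => 0) (ret_det ()) (ret_free ()) polyBalanced_id (PolyBdd.const 0)
    fun x => ⟨1, spec_ret_id x⟩

theorem zero_mem_classPH : (0 : Language Bool) ∈ classPH := by
  obtain ⟨M, h1, h2⟩ := exists_accepts_of_spec (D := Empty) (C := fail) (O := 0) (L := 0) (qT := .I)
    (PolyBdd.const 1) fun x => ⟨∅, spec_fail (fits_top _), by simp [Language.notMem_zero]⟩
  exact ⟨1, le_rfl, M, h1 fail_free, h2⟩

/-- The monoid `fP^PH`. -/
def fPHSubmonoid : Submonoid (Word →. Word) where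
  carrier := fPOracle classPH
  mul_mem' := fPOracle_classPH_comp
  one_mem' := id_mem_fPOracle zero_mem_classPH

/-- The monoid `fPSpace`. -/
def fPSpaceSubmonoid : Submonoid (Word →. Word) where
  carrier := fPSpace
  mul_mem' := fPSpace_comp
  one_mem' := id_mem_fPSpace

theorem isRegularMonoid_of_isInverse {S : Submonoid (Word →. Word)}
    (h : ∀ f ∈ S, ∃ f' ∈ S, IsInverse f' f) : IsRegularMonoid S := fun ⟨f, hf⟩ => by
  obtain ⟨f', hf', h⟩ := h f hf
  exact ⟨⟨f', hf'⟩, Subtype.ext h⟩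

theorem minPreimage_mem_fPOracle_succ {k : ℕ} (hk : 1 ≤ k) {f : Word →. Word}
    (hf : f ∈ fPOracle (SigmaP k)) : minPreimage f ∈ fPOracle (SigmaP (k + 1)) :=
  minPreimage_mem_fPOracle hf.1 (prefixLang_mem_sigmaP hk hf)

/-- The least preimage costs one level of the hierarchy, which the union over all levels absorbs. -/
theorem isRegularMonoid_fPHSubmonoid : IsRegularMonoid fPHSubmonoid :=
  isRegularMonoid_of_isInverse fun f ⟨hb, O, ⟨k, hk, hO⟩, hM⟩ =>
    ⟨minPreimage f, fPOracle_subset (𝒟 := classPH) (fun _ hL => ⟨k + 1, Nat.le_add_left _ _, hL⟩)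
      (minPreimage_mem_fPOracle_succ hk ⟨hb, O, hO, hM⟩), hb.isInverse_minPreimage⟩

end

theorem mainTheorem8 :
    (∀ f ∈ fP, ∃ f' ∈ fPOracle (SigmaP 1), IsInverse f' f ∧ IsMinPreimage f' f) ∧
    (∀ k : ℕ, 1 ≤ k → ∀ f ∈ fPOracle (SigmaP k),
      ∃ f' ∈ fPOracle (SigmaP (k + 1)), IsInverse f' f ∧ IsMinPreimage f' f) ∧
    (∃ S : Submonoid (Word →. Word), (S : Set (Word →. Word)) = fPOracle classPH ∧
      IsRegularMonoid S) ∧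
    (∃ S : Submonoid (Word →. Word), (S : Set (Word →. Word)) = fPSpace ∧
      IsRegularMonoid S) :=
  ⟨fun f hf => ⟨minPreimage f, minPreimage_mem_fPOracle hf.1 (prefixLang_mem_NP hf),
      hf.1.isInverse_minPreimage, isMinPreimage_minPreimage f⟩,
    fun _ hk f hf => ⟨minPreimage f, minPreimage_mem_fPOracle_succ hk hf,
      hf.1.isInverse_minPreimage, isMinPreimage_minPreimage f⟩,
    ⟨fPHSubmonoid, rfl, isRegularMonoid_fPHSubmonoid⟩,
    ⟨fPSpaceSubmonoid, rfl, isRegularMonoid_of_isInverse fun _ => exists_isInverse_fPSpace⟩⟩
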